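/- Let $0<m<n$ be integers. Let $\widetilde S_n$ be the affine symmetric group with generators $s_i$, $i\in\mathbb Z/n\mathbb Z$, subject to $s_i^2=1$, $s_is_{i+1}s_i=s_{i+1}s_is_{i+1}$ (no such relation if $n=2$) and $s_is_j=s_js_i$ for $i-j\ne\pm1$; let $\ell$ be its length function. Call $w\in\widetilde S_n$ $0$-Grassmannian if every reduced word of $w$ ends with $s_0$ (the identity included), and $321$-avoiding if no reduced word of $w$ contains three consecutive letters $s_is_{i+1}s_i$. For $J\subsetneq\mathbb Z/n\mathbb Z$ let $d_J$ (resp. $u_J$) be the product of the $s_j$, $j\in J$, each used once, with $s_{i+1}$ to the left (resp. right) of $s_i$ whenever $i,i+1\in J$; the elements $d_J$ are called cyclically decreasing. Let $\mathrm{maxr}(w)$ (resp. $\mathrm{maxc}(w)$) be the largest $|J|$ such that $w=vd_J$ (resp. $w=vu_J$) with $\ell(w)=\ell(v)+|J|$. Let $A_{(n-m,m)}$ be the set of $321$-avoiding $w$ with $\mathrm{maxc}(w)\le m$ and $\mathrm{maxr}(w)\le n-m$, and let $A^0_{(n-m,m)}$ be the set of its $0$-Grassmannian elements. Let $\mathbb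 A$ be the affine nilCoxeter algebra over $\mathbb Z$, with generators $A_i$, $i\in\mathbb Z/n\mathbb Z$, satisfying $A_i^2=0$ and the same braid and commutation relations as the $s_i$; for a reduced word $w=s_{i_1}\cdots s_{i_l}$ put $A_w=A_{i_1}\cdots A_{i_l}$. Let ${\bf h}_i=\sum_{|J|=i}A_{d_J}$ for $0\le i<n$. Let $\mathbb A_{m,n}$ be the quotient of $\mathbb A$ by the relations $A_iA_{i+1}A_i=A_{i+1}A_iA_{i+1}=0$ for all $i$, $A_{d_J}=0$ for $|J|>n-m$, and $A_{u_J}=0$ for $|J|>m$, and let $\mathbb B_{m,n}$ be its subalgebra generated by the images of ${\bf h}_1,\dots,{\bf h}_{n-m}$. For $w\in\widetilde S_n$ let $F_w=\sum x_1^{\ell(w_1)}x_2^{\ell(w_2)}\cdots$, summed over factorizations $w=w_1w_2\cdots$ into cyclically decreasing elements (almost all trivial) with $\ell(w)=\sum_j\ell(w_j)$. Let $\{s^{(k)}_u\}$, $k=n-1$, be the basis of $\mathbb Z[h_1,\dots,h_{n-1}]$ dual to $\{F_u: u \text{ is } 0\text{-Grassmannian}\}$ under the Hall pairing, $\langle h_\lambda,m_\mu\rangle=\delta_{\lambda\mu}$.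 For $0$-Grassmannian $u$ let ${\bf s}^{(m,n)}_u\in\mathbb A_{m,n}$ be the image of $s^{(k)}_u$ under $h_\lambda\mapsto{\bf h}_{\lambda_1}{\bf h}_{\lambda_2}\cdots\in\mathbb A$ followed by the projection $\mathbb A\to\mathbb A_{m,n}$. Let $$r_m=s_{-m}s_{-m+1}\cdots s_{-1}\,s_{n-m-1}\cdots s_1s_0 .$$ Let $w\in A^0_{(n-m,m)}$ and let $w=w^{(0)}r_m^d$ be a ribbon decomposition, that is, $d\ge 0$, $\ell(w)=\ell(w^{(0)})+nd$, $w^{(0)}\in A_{(n-m,m)}$, and some generator $s_i$ does not occur in any reduced word of $w^{(0)}$ (then $w^{(0)}$ is again $0$-Grassmannian). Then the elements ${\bf s}^{(m,n)}_{w}$, ${\bf s}^{(m,n)}_{w^{(0)}}$ and ${\bf s}^{(m,n)}_{r_m}$ lie in $\mathbb B_{m,n}$, and $${\bf s}^{(m,n)}_{w}={\bf s}^{(m,n)}_{w^{(0)}}\,\bigl({\bf s}^{(m,n)}_{r_m}\bigr)^d .$$ -/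

import Mathlib

open Finset

noncomputable section

namespace AffineNil

/-! ## The affine symmetric group -/

/-- The Coxeter matrix of the affine symmetric group: nodes `ZMod n`, with `m(i, i ± 1) = 3` and
`m(i, j) = 2` for the other `j ≠ i`. For `n = 2` the two nodes carry no braid relation, as usual
(Mathlib's entry `0` stands for `∞`). -/
def affineMatrix (n : ℕ) : CoxeterMatrix (ZMod n) where
  M := Matrix.of fun i j =>
    if i = j then 1
    else if i = j + 1 ∨ j = i + 1 then (if n = 2 then 0 else 3)
    else 2
  isSymm := by
    ext i j
    simp only [Matrix.transpose_apply, Matrix.of_apply, eq_comm (a := j) (b := i),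
      or_comm (a := j = i + 1)]
  diagonal := by simp
  off_diagonal := by
    intro i j hij
    simp only [Matrix.of_apply, if_neg hij]
    split_ifs <;> decide

/-- The affine symmetric group with simple generators `s_i`, `i ∈ ZMod n`. -/
abbrev AffSym (n : ℕ) : Type := (affineMatrix n).Group

/-- The standard Coxeter system on the affine symmetric group; it provides the simple
reflections, the product `wordProd` of a word, reduced words and the length. -/
abbrev cs (n : ℕ) : CoxeterSystem (affineMatrix n) (AffSym n) := (affineMatrix n).toCoxeterSystem

/-- `l` is a reduced word of `w`. -/
def IsReducedWord {n : ℕ} (l : List (ZMod n)) (w : AffSym n) : Prop :=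
  (cs n).IsReduced l ∧ (cs n).wordProd l = w

/-- `w` is `0`-Grassmannian: every reduced word ends with `s_0`. (The identity, whose reduced word
is empty, is `0`-Grassmannian: it is the minimal length representative of its coset.) -/
def IsZeroGrassmannian {n : ℕ} (w : AffSym n) : Prop :=
  ∀ l : List (ZMod n), IsReducedWord l w → ∀ i ∈ l.getLast?, i = 0

/-- `w` is `321`-avoiding: no reduced word of `w` has three consecutive letters `s_i s_{i+1} s_i`
(nor, equivalently for `n ≥ 3`, `s_{i+1} s_i s_{i+1}`). -/
def Is321Avoiding {n : ℕ} (w : AffSym n) : Prop :=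
  ∀ l : List (ZMod n), IsReducedWord l w → ∀ i : ZMod n, ¬ [i, i + 1, i] <:+: l

/-! ## Cyclically decreasing and increasing elements -/

/-- A word is cyclically decreasing if each letter occurs at most once and `s_{i+1}` precedes
`s_i` whenever both occur. -/
def IsCycDecWord {n : ℕ} (l : List (ZMod n)) : Prop :=
  l.Nodup ∧ ∀ i : ZMod n, i ∈ l → i + 1 ∈ l → l.idxOf (i + 1) < l.idxOf i

/-- A cyclically decreasing element. -/
def IsCycDec {n : ℕ} (w : AffSym n) : Prop :=
  ∃ l : List (ZMod n), IsCycDecWord l ∧ (cs n).wordProd l = w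

/-- A cyclically decreasing word with set of letters `J`, for `J` a proper subset of `ZMod n`:
choose `a ∉ J` and list the elements of `J` in the order `a - 1, a - 2, …, a - n`. -/
def cycDecWord {n : ℕ} (J : Finset (ZMod n)) : List (ZMod n) :=
  ((List.range n).map fun k : ℕ => Classical.epsilon (fun a : ZMod n => a ∉ J) - 1 - (k : ZMod n)).filter
    (· ∈ J)

/-- `cycDecWord J` is a cyclically decreasing word whose set of letters is `J`. -/
theorem cycDecWord_spec {n : ℕ} [NeZero n] (J : Finset (ZMod n)) (hJ : J ≠ univ) :
    IsCycDecWord (cycDecWord J) ∧ (cycDecWord J).toFinset = J := by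
  have ha : Classical.epsilon (fun a : ZMod n => a ∉ J) ∉ J := by
    apply Classical.epsilon_spec (p := fun a : ZMod n => a ∉ J)
    by_contra h
    push Not at h
    exact hJ (Finset.eq_univ_iff_forall.2 h)
  unfold cycDecWord
  set a := Classical.epsilon (fun a : ZMod n => a ∉ J) with hadef
  let f : ZMod n → ℕ := fun x => (a - 1 - x).val
  have hval : ∀ k < n, f (a - 1 - (k : ZMod n)) = k := by
    intro k hk
    simp only [f, sub_sub_cancel]
    exact ZMod.val_natCast_of_lt hk
  have hpw : (((List.range n).map fun k : ℕ => a - 1 - (k : ZMod n)).filter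
      (· ∈ J)).Pairwise (fun x y => f x < f y) := by
    apply List.Pairwise.filter
    rw [List.pairwise_map]
    have h0 := List.pairwise_lt_range (n := n)
    refine List.Pairwise.imp_of_mem ?_ h0
    intro x y hx hy hxy
    rw [hval x (List.mem_range.1 hx), hval y (List.mem_range.1 hy)]
    exact hxy
  have hmem : ∀ x, x ∈ (((List.range n).map fun k : ℕ => a - 1 - (k : ZMod n)).filter
      (· ∈ J)) ↔ x ∈ J := by
    intro x
    simp only [List.mem_filter, List.mem_map, List.mem_range, decide_eq_true_eq,
      and_iff_right_iff_imp]
    intro _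
    exact ⟨f x, ZMod.val_lt _, by simp [f]⟩
  generalize (((List.range n).map fun k : ℕ => a - 1 - (k : ZMod n)).filter
      (· ∈ J)) = L at hpw hmem ⊢
  refine ⟨⟨hpw.imp (fun h e => by simp [e] at h), ?_⟩, by ext x; simp [hmem]⟩
  intro i hi hi1
  have hlt : f (i + 1) < f i := by
    have hne : a - 1 - i ≠ 0 := by
      intro h
      have : i + 1 = a := by linear_combination -h
      exact ha (this ▸ (hmem _).1 hi1)
    have h1 : f i ≠ 0 := by simpa [f, ZMod.val_eq_zero] using hne
    have h2 : a - 1 - (i + 1) = ((f i - 1 : ℕ) : ZMod n) := by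
      rw [Nat.cast_sub (by omega)]
      simp [f]
      ring
    have h3 : f (i + 1) = f i - 1 := by
      show (a - 1 - (i + 1)).val = _
      rw [h2]
      exact ZMod.val_natCast_of_lt (lt_of_le_of_lt (Nat.sub_le _ _) (ZMod.val_lt _))
    omega
  by_contra hcon
  push Not at hcon
  have hA := List.idxOf_lt_length_iff.2 hi
  have hB := List.idxOf_lt_length_iff.2 hi1
  rcases hcon.lt_or_eq with h | h
  · have := List.pairwise_iff_getElem.1 hpw _ _ hA hB h
    simp at this
    omega
  · have := (List.idxOf_inj hi).1 h
    rw [← this] at hlt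
    exact lt_irrefl _ hlt

/-- The cyclically decreasing element `d_J`, for `J ≠ univ`. -/
def dElt {n : ℕ} (J : Finset (ZMod n)) : AffSym n := (cs n).wordProd (cycDecWord J)

/-- The cyclically increasing element `u_J`, for `J ≠ univ`. -/
def uElt {n : ℕ} (J : Finset (ZMod n)) : AffSym n := (cs n).wordProd (cycDecWord J).reverse

open Classical in
/-- `maxr w` is the size of the largest proper subset `J` such that `w = v d_J` for some `v` with
`ℓ(w) = ℓ(v) + ℓ(d_J)`. -/
def maxr {n : ℕ} [NeZero n] (w : AffSym n) : ℕ :=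
  {J : Finset (ZMod n) | J ≠ univ ∧ ∃ v : AffSym n, w = v * dElt J ∧
    (cs n).length w = (cs n).length v + (cs n).length (dElt J)}.toFinset.sup card

open Classical in
/-- `maxc w` is the size of the largest proper subset `J` such that `w = v u_J` for some `v` with
`ℓ(w) = ℓ(v) + ℓ(u_J)`. -/
def maxc {n : ℕ} [NeZero n] (w : AffSym n) : ℕ :=
  {J : Finset (ZMod n) | J ≠ univ ∧ ∃ v : AffSym n, w = v * uElt J ∧
    (cs n).length w = (cs n).length v + (cs n).length (uElt J)}.toFinset.sup card

/-- The set `A_{(n-m,m)}` of `321`-avoiding `w` with `maxc w ≤ m` and `maxr w ≤ n - m`. -/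
def ASet (m n : ℕ) [NeZero n] : Set (AffSym n) :=
  {w | Is321Avoiding w ∧ maxc w ≤ m ∧ maxr w ≤ n - m}

/-- The set `A_{(n-m,m)}^0` of `0`-Grassmannian elements of `A_{(n-m,m)}`. -/
def ASetZero (m n : ℕ) [NeZero n] : Set (AffSym n) :=
  {w | w ∈ ASet m n ∧ IsZeroGrassmannian w}

/-! ## Ribbons -/

/-- An `n`-connected ribbon: an element `u_{Jᶜ} d_J`, where `J` and its complement are proper. -/
def IsConnectedRibbon {n : ℕ} [NeZero n] (v : AffSym n) : Prop :=
  ∃ J : Finset (ZMod n), J.Nonempty ∧ J ≠ univ ∧ v = uElt Jᶜ * dElt J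

/-- The ribbon `r_m = s_{-m} s_{-m+1} ⋯ s_{-1} s_{n-m-1} ⋯ s_1 s_0`. -/
def ribbon (m n : ℕ) : AffSym n :=
  (cs n).wordProd (((List.range m).map fun k : ℕ => -(m : ZMod n) + (k : ZMod n)) ++
    ((List.range (n - m)).map fun k : ℕ => (k : ZMod n)).reverse)

/-- `w = w₀ v ^ d` is a ribbon decomposition of `w` (of type `(m, n)`): the factorization is length
additive, `v` is an `n`-connected ribbon (of length `n`), `w₀ ∈ A_{(n-m,m)}`, and some generator
occurs in no reduced word of `w₀`. -/
structure IsRibbonDecomposition (m n : ℕ) [NeZero n] (w w₀ v : AffSym n) (d : ℕ) : Prop where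
  eq : w = w₀ * v ^ d
  length_eq : (cs n).length w = (cs n).length w₀ + n * d
  mem : w₀ ∈ ASet m n
  ribbon : IsConnectedRibbon v
  missing : ∃ i : ZMod n, ∀ l : List (ZMod n), IsReducedWord l w₀ → i ∉ l

/-! ## Affine Stanley symmetric functions and `k`-Schur functions, `k = n - 1` -/

/-- The affine Stanley symmetric function `F_w`, as a power series in `x_0, x_1, …`. The coefficient
of `x ^ a` is the number of sequences `(w_0, w_1, …)` of cyclically decreasing elements with
`ℓ(w_j) = a_j`, whose ordered product is `w`, and with `ℓ(w) = ∑ ℓ(w_j)`. The factors with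
`a_j = 0` are trivial, so the product is taken over the support of `a`. -/
def affineStanley {n : ℕ} (w : AffSym n) : MvPowerSeries ℕ ℤ := fun a =>
  (Nat.card {c : ℕ → AffSym n // (∀ j, IsCycDec (c j) ∧ (cs n).length (c j) = a j) ∧
    ((a.support.sort (· ≤ ·)).map c).prod = w ∧
    (cs n).length w = a.sum fun _ p => p} : ℤ)

/-- The ring `Λ_(n) = ℤ[h_1, …, h_{n-1}]`, a polynomial ring; the variable `X i` is `h_{i+1}`. -/
abbrev SymmH (n : ℕ) : Type := MvPolynomial (Fin (n - 1)) ℤ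

/-- The partition `λ`, listed in weakly decreasing order, with `e i` parts equal to `i + 1`; the
monomial of `Λ_(n)` with exponent `e` is `h_λ`. -/
def partsOf {n : ℕ} (e : Fin (n - 1) →₀ ℕ) : List ℕ :=
  (List.finRange (n - 1)).reverse.flatMap fun i => List.replicate (e i) (i.val + 1)

/-- The Hall pairing of `f ∈ Λ_(n)` with a symmetric function `F`. It is determined by
`⟨h_λ, m_μ⟩ = δ_{λμ}`, so `⟨h_λ, F⟩` is the coefficient of `x ^ λ` in `F`. -/
def hallPairing {n : ℕ} (f : SymmH n) (F : MvPowerSeries ℕ ℤ) : ℤ :=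
  ∑ e ∈ f.support, f.coeff e * MvPowerSeries.coeff (partsOf e).toFinsupp F

/-- The defining property of the basis of `Λ_(n)` dual to the affine Schur functions `F_v`,
`v` `0`-Grassmannian. -/
def IsKSchur {n : ℕ} (u : AffSym n) (f : SymmH n) : Prop :=
  ∀ v : AffSym n, IsZeroGrassmannian v →
    (v = u → hallPairing f (affineStanley v) = 1) ∧ (v ≠ u → hallPairing f (affineStanley v) = 0)

/-- The `k`-Schur function `s_u^{(k)}`: the element of the dual basis indexed by the
`0`-Grassmannian element `u`. -/
def kSchur {n : ℕ} (u : AffSym n) : SymmH n := Classical.epsilon (IsKSchur u)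

/-! ## The affine nilCoxeter algebra and its quotient -/

/-- The relations of the affine nilCoxeter algebra (for `n = 2` there is no braid relation). -/
inductive NilCoxeterRel (n : ℕ) : FreeAlgebra ℤ (ZMod n) → FreeAlgebra ℤ (ZMod n) → Prop
  | sq (i : ZMod n) : NilCoxeterRel n (FreeAlgebra.ι ℤ i * FreeAlgebra.ι ℤ i) 0
  | braid (hn : n ≠ 2) (i : ZMod n) :
      NilCoxeterRel n (FreeAlgebra.ι ℤ i * FreeAlgebra.ι ℤ (i + 1) * FreeAlgebra.ι ℤ i)
        (FreeAlgebra.ι ℤ (i + 1) * FreeAlgebra.ι ℤ i * FreeAlgebra.ι ℤ (i + 1))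
  | comm (i j : ZMod n) (h₁ : i - j ≠ 1) (h₂ : i - j ≠ -1) :
      NilCoxeterRel n (FreeAlgebra.ι ℤ i * FreeAlgebra.ι ℤ j)
        (FreeAlgebra.ι ℤ j * FreeAlgebra.ι ℤ i)

/-- The affine nilCoxeter algebra `𝔸` over `ℤ`. -/
abbrev NilCoxeter (n : ℕ) : Type := RingQuot (NilCoxeterRel n)

/-- The generator `A_i`. -/
def nilGen {n : ℕ} (i : ZMod n) : NilCoxeter n :=
  RingQuot.mkAlgHom ℤ (NilCoxeterRel n) (FreeAlgebra.ι ℤ i)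

/-- `A_{i_1} ⋯ A_{i_l}`. For a reduced word of `w` this is `A_w`. -/
def nilWord {n : ℕ} (l : List (ZMod n)) : NilCoxeter n := (l.map nilGen).prod

/-- `A_{d_J}` for `J ≠ univ`; the word used is a reduced word of `d_J`. -/
def nilD {n : ℕ} (J : Finset (ZMod n)) : NilCoxeter n := nilWord (cycDecWord J)

/-- `A_{u_J}` for `J ≠ univ`; the word used is a reduced word of `u_J`. -/
def nilU {n : ℕ} (J : Finset (ZMod n)) : NilCoxeter n := nilWord (cycDecWord J).reverse

/-- `𝐡_i = ∑ A_{d_J}`, the sum over proper subsets `J` of `ZMod n` of size `i`. -/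
def hElt {n : ℕ} [NeZero n] (i : ℕ) : NilCoxeter n :=
  ∑ J : Finset (ZMod n) with J ≠ univ ∧ #J = i, nilD J

/-- The isomorphism of `Λ_(n)` onto the affine Fomin–Stanley algebra, as a map to `𝔸`: it is linear
and sends the basis element `h_λ` to `𝐡_λ = 𝐡_{λ_1} 𝐡_{λ_2} ⋯`. -/
def toNil {n : ℕ} [NeZero n] (f : SymmH n) : NilCoxeter n :=
  ∑ e ∈ f.support, f.coeff e • ((partsOf e).map hElt).prod

/-- The noncommutative `k`-Schur function, `k = n - 1`. -/
def ncKSchur {n : ℕ} [NeZero n] (u : AffSym n) : NilCoxeter n := toNil (kSchur u)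

/-- The additional relations defining `𝔸_{m,n}`. -/
inductive QuotRel (m n : ℕ) [NeZero n] : NilCoxeter n → NilCoxeter n → Prop
  | up (i : ZMod n) : QuotRel m n (nilGen i * nilGen (i + 1) * nilGen i) 0
  | down (i : ZMod n) : QuotRel m n (nilGen (i + 1) * nilGen i * nilGen (i + 1)) 0
  | dec (J : Finset (ZMod n)) (hJ : J ≠ univ) (h : n - m < #J) : QuotRel m n (nilD J) 0
  | inc (J : Finset (ZMod n)) (hJ : J ≠ univ) (h : m < #J) : QuotRel m n (nilU J) 0

/-- The quotient algebra `𝔸_{m,n}` of `𝔸`. -/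
abbrev NilQuot (m n : ℕ) [NeZero n] : Type := RingQuot (QuotRel m n)

/-- The projection `𝔸 → 𝔸_{m,n}`. -/
def proj (m n : ℕ) [NeZero n] : NilCoxeter n →ₐ[ℤ] NilQuot m n :=
  RingQuot.mkAlgHom ℤ (QuotRel m n)

/-- The subalgebra `𝔹_{m,n}` of `𝔸_{m,n}` generated by the images of `𝐡_1, …, 𝐡_{n-m}`. -/
def BAlg (m n : ℕ) [NeZero n] : Subalgebra ℤ (NilQuot m n) :=
  Algebra.adjoin ℤ {x | ∃ i : ℕ, 1 ≤ i ∧ i ≤ n - m ∧ x = proj m n (hElt i)}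

/-- `𝐬_u^{(m,n)}`, the image of the noncommutative `k`-Schur function in `𝔸_{m,n}`. -/
def sMN (m n : ℕ) [NeZero n] (u : AffSym n) : NilQuot m n := proj m n (ncKSchur u)

end AffineNil

end

set_option linter.unusedSectionVars false

noncomputable section

namespace AffineNil

/-! The affine nilCoxeter algebra acts on configurations of `m` particles on a cycle of `n` sites:
`A_i` moves the particle at site `i` to `i + 1` if that site is empty, and is zero otherwise.
Configurations are lifted to strictly increasing maps `f : ℤ → ℤ` with `f (p + m) = f p + n`, so
that labels and winding are remembered. Then the words leading from `f` to `g` form one commutation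
class, and they are exactly the reduced words of one group element (`Path.commEq`,
`Path.of_wordProd_eq`).

The action detects enough: a word not vanishing in `𝔸_{m,n}` can be executed on some configuration,
and different commutation classes are told apart by matrix entries. Hence whatever acts as zero has
zero image in `𝔸_{m,n}` (`proj_eq_zero_of_action_eq_zero`).

The element `𝐡_r` sends `f` to the sum of the `g` with `f p ≤ g p < f (p + 1)` and weight larger by
`r`; a Bender–Knuth involution shows that these operators commute (`action_hElt_comm`). The entry of
`toNil F` from `x` to `y` is the Hall pairing of `F` with the affine Stanley function of the element
leading from `x` to `y` (`action_toNil_single_apply_of_path`). Only `0`-Grassmannian elements act on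
the vacuum, a block of adjacent particles ending at `0`, so by duality `s_u^{(k)}` sends the vacuum
to its image under `u`, or to `0` if `u` cannot be executed there. This requires the dual basis to
exist, which follows from the unitriangularity of factorization numbers with respect to a greedy
shape (`exists_isKSchur`).

Every configuration is a relabelling of one reachable from the vacuum, and relabelling commutes with
the action. By commutativity, an element of the subalgebra generated by the `𝐡_r` that kills the
vacuum therefore kills everything, and so vanishes in `𝔸_{m,n}` (`proj_eq_zero_of_action_vacuum`).
It remains to compare both sides of the identity on the vacuum. The ribbon `r_m` turns the vacuum
into itself with labels shifted by one, and a label shift passes through `w₀`; so both sides give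
the image of the vacuum under `w₀`, with labels shifted by `d`, or both give zero
(`action_ncKSchur_eq`). -/

/-! ## The action on the integers -/

section Perm

variable {n : ℕ}

/-- The map underlying the affine reflection exchanging the residue classes of `i` and `i + 1`. -/
def reflFun (i : ZMod n) (x : ℤ) : ℤ :=
  if (x : ZMod n) = i then x + 1 else if (x : ZMod n) = i + 1 then x - 1 else x

theorem reflFun_of_eq {i : ZMod n} {x : ℤ} (h : (x : ZMod n) = i) : reflFun i x = x + 1 := by
  simp [reflFun, h]

variable [Fact (1 < n)]

theorem add_one_ne (i : ZMod n) : i + 1 ≠ i := by simp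

theorem reflFun_of_eq_add_one {i : ZMod n} {x : ℤ} (h : (x : ZMod n) = i + 1) :
    reflFun i x = x - 1 := by
  simp [reflFun, h]

theorem reflFun_of_ne {i : ZMod n} {x : ℤ} (h : (x : ZMod n) ≠ i) (h' : (x : ZMod n) ≠ i + 1) :
    reflFun i x = x := by
  simp [reflFun, h, h']

theorem reflFun_reflFun (i : ZMod n) (x : ℤ) : reflFun i (reflFun i x) = x := by
  by_cases h : (x : ZMod n) = i
  · rw [reflFun_of_eq h, reflFun_of_eq_add_one (by push_cast; rw [h])]; ring
  by_cases h' : (x : ZMod n) = i + 1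
  · rw [reflFun_of_eq_add_one h', reflFun_of_eq (by push_cast; rw [h']; ring)]; ring
  rw [reflFun_of_ne h h', reflFun_of_ne h h']

/-- The affine reflection exchanging the residue classes of `i` and `i + 1`. -/
def refl (i : ZMod n) : Equiv.Perm ℤ where
  toFun := reflFun i
  invFun := reflFun i
  left_inv := reflFun_reflFun i
  right_inv := reflFun_reflFun i

theorem refl_apply (i : ZMod n) (x : ℤ) : refl i x = reflFun i x := rfl

theorem refl_mul_self (i : ZMod n) : refl i * refl i = 1 :=
  Equiv.ext fun x => reflFun_reflFun i x

theorem refl_comm {i j : ZMod n} (h₁ : i - j ≠ 1) (h₂ : i - j ≠ -1) :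
    refl i * refl j = refl j * refl i := by
  by_cases hij : i = j
  · rw [hij]
  have a1 : i ≠ j + 1 := fun h => h₁ (by rw [h]; ring)
  have a2 : j ≠ i + 1 := fun h => h₂ (by rw [h]; ring)
  have a3 : i + 1 ≠ j + 1 := fun h => hij (add_right_cancel h)
  have key : ∀ (i j : ZMod n), i ≠ j → i ≠ j + 1 → j ≠ i + 1 → ∀ x : ℤ,
      ((x : ZMod n) = i ∨ (x : ZMod n) = i + 1) →
      reflFun i (reflFun j x) = reflFun j (reflFun i x) := by
    intro i j hij a1 a2 x hx
    have a3 : i + 1 ≠ j + 1 := fun h => hij (add_right_cancel h)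
    rcases hx with h | h
    · rw [reflFun_of_ne (i := j) (by rw [h]; exact hij) (by rw [h]; exact a1), reflFun_of_eq h,
        reflFun_of_ne] <;> push_cast <;> rw [h]
      exacts [a2.symm, a3]
    · rw [reflFun_of_ne (i := j) (by rw [h]; exact a2.symm) (by rw [h]; exact a3),
        reflFun_of_eq_add_one h, reflFun_of_ne] <;> push_cast <;> rw [h, add_sub_cancel_right]
      exacts [hij, a1]
  ext x
  simp only [Equiv.Perm.mul_apply, refl_apply]
  by_cases hi : (x : ZMod n) = i ∨ (x : ZMod n) = i + 1
  · exact key i j hij a1 a2 x hi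
  by_cases hj : (x : ZMod n) = j ∨ (x : ZMod n) = j + 1
  · exact (key j i (Ne.symm hij) a2 a1 x hj).symm
  push Not at hi hj
  rw [reflFun_of_ne hi.1 hi.2, reflFun_of_ne hj.1 hj.2, reflFun_of_ne hi.1 hi.2]

theorem add_two_ne (hn : n ≠ 2) (i : ZMod n) : i + 1 + 1 ≠ i := by
  have h1 : 1 < n := Fact.out
  intro h
  have : ((2 : ℕ) : ZMod n) = 0 := by push_cast; linear_combination h
  rw [ZMod.natCast_eq_zero_iff] at this
  have := Nat.le_of_dvd (by norm_num) this
  omega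

theorem refl_braid (hn : n ≠ 2) (i : ZMod n) :
    refl i * refl (i + 1) * refl i = refl (i + 1) * refl i * refl (i + 1) := by
  have e1 := add_one_ne i
  have e2 := add_two_ne hn i
  ext x
  simp only [Equiv.Perm.mul_apply, refl_apply]
  by_cases h0 : (x : ZMod n) = i
  · rw [reflFun_of_eq h0, reflFun_of_eq (i := i + 1) (by push_cast; rw [h0]),
      reflFun_of_ne (i := i) (by push_cast; rw [h0]; exact e2)
        (by push_cast; rw [h0]; exact add_one_ne _),
      reflFun_of_ne (i := i + 1) (x := x) (by rw [h0]; exact e1.symm) (by rw [h0]; exact e2.symm),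
      reflFun_of_eq h0, reflFun_of_eq (by push_cast; rw [h0])]
  by_cases h1 : (x : ZMod n) = i + 1
  · rw [reflFun_of_eq_add_one h1,
      reflFun_of_ne (i := i + 1) (x := x - 1) (by push_cast; rw [h1]; simp)
        (by push_cast; rw [h1]; simpa using e2.symm),
      reflFun_of_eq (i := i) (by push_cast; rw [h1]; simp), reflFun_of_eq h1,
      reflFun_of_ne (i := i) (by push_cast; rw [h1]; exact e2)
        (by push_cast; rw [h1]; exact add_one_ne _),
      reflFun_of_eq_add_one (by push_cast; rw [h1])]
    ring
  by_cases h2 : (x : ZMod n) = i + 1 + 1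
  · rw [reflFun_of_ne h0 h1, reflFun_of_eq_add_one h2,
      reflFun_of_eq_add_one (i := i) (by push_cast; rw [h2]; ring),
      reflFun_of_ne (i := i + 1) (by push_cast; rw [h2]; simp)
        (by push_cast; rw [h2]; simpa using e2.symm)]
  rw [reflFun_of_ne h0 h1, reflFun_of_ne h1 h2, reflFun_of_ne h0 h1, reflFun_of_ne h1 h2]

theorem refl_isLiftable : (affineMatrix n).IsLiftable (refl (n := n)) := by
  intro i j
  change _ ^ (if i = j then 1 else if i = j + 1 ∨ j = i + 1 then (if n = 2 then 0 else 3) else 2)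
    = _
  have three : ∀ i : ZMod n, n ≠ 2 → (refl i * refl (i + 1)) ^ 3 = 1 := by
    intro i hn
    have : (refl i * refl (i + 1)) ^ 3 =
        (refl i * refl (i + 1) * refl i) * (refl (i + 1) * refl i * refl (i + 1)) := by
      simp only [pow_succ, pow_zero, one_mul, mul_assoc]
    rw [this, ← refl_braid hn]
    calc _ = refl i * refl (i + 1) * (refl i * refl i) * refl (i + 1) * refl i := by
          simp only [mul_assoc]
      _ = refl i * (refl (i + 1) * refl (i + 1)) * refl i := by
          rw [refl_mul_self]; simp only [mul_assoc, mul_one]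
      _ = 1 := by rw [refl_mul_self, mul_one, refl_mul_self]
  split_ifs with h1 h2 h3
  · rw [h1, refl_mul_self, one_pow]
  · exact pow_zero _
  · rcases h2 with h | h
    · have e : refl i * refl j = (refl j * refl i)⁻¹ := by
        rw [mul_inv_rev]
        congr 1
      rw [e, inv_pow, h, three _ h3, inv_one]
    · rw [h, three _ h3]
  · push Not at h2
    have hc := refl_comm (i := i) (j := j) (fun h => h2.1 (by rw [← h]; ring))
      (fun h => h2.2 (by linear_combination -h))
    rw [pow_two]
    nth_rewrite 2 [hc]
    rw [mul_assoc, ← mul_assoc (refl j), refl_mul_self, one_mul, refl_mul_self]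

variable (n) in
/-- The action of the affine symmetric group on `ℤ`. -/
def toPerm : AffSym n →* Equiv.Perm ℤ := (cs n).lift ⟨refl, refl_isLiftable⟩

theorem toPerm_simple (i : ZMod n) : toPerm n ((cs n).simple i) = refl i :=
  (cs n).lift_apply_simple refl_isLiftable i

theorem toPerm_simple_apply (i : ZMod n) (x : ℤ) :
    toPerm n ((cs n).simple i) x = reflFun i x := by rw [toPerm_simple]; rfl

theorem reflFun_add (i : ZMod n) (x : ℤ) : reflFun i (x + n) = reflFun i x + n := by
  simp only [reflFun, Int.cast_add, Int.cast_natCast, ZMod.natCast_self, add_zero]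
  split_ifs <;> ring

theorem toPerm_add (w : AffSym n) (x : ℤ) : toPerm n w (x + n) = toPerm n w x + n := by
  induction w using (cs n).simple_induction_left generalizing x with
  | one => simp
  | mul_simple_left w i h =>
    rw [map_mul, Equiv.Perm.mul_apply, Equiv.Perm.mul_apply, h, toPerm_simple_apply, reflFun_add,
      toPerm_simple_apply]

theorem simple_comm {i j : ZMod n} (h₁ : i - j ≠ 1) (h₂ : i - j ≠ -1) :
    (cs n).simple i * (cs n).simple j = (cs n).simple j * (cs n).simple i := by
  by_cases hij : i = j
  · rw [hij]
  have h := (cs n).simple_mul_simple_pow i j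
  change _ ^ (if i = j then 1 else if i = j + 1 ∨ j = i + 1 then (if n = 2 then 0 else 3) else 2)
    = _ at h
  rw [if_neg hij, if_neg, pow_two] at h
  · have := eq_inv_of_mul_eq_one_left h
    rwa [mul_inv_rev, (cs n).inv_simple, (cs n).inv_simple] at this
  · rintro (h | h)
    · exact h₁ (by rw [h]; ring)
    · exact h₂ (by rw [h]; ring)

theorem simple_braid (hn : n ≠ 2) (i : ZMod n) :
    (cs n).simple i * (cs n).simple (i + 1) * (cs n).simple i =
      (cs n).simple (i + 1) * (cs n).simple i * (cs n).simple (i + 1) := by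
  have h := (cs n).simple_mul_simple_pow i (i + 1)
  change _ ^ (if i = i + 1 then 1 else if i = i + 1 + 1 ∨ i + 1 = i + 1 then
    (if n = 2 then 0 else 3) else 2) = _ at h
  rw [if_neg (add_one_ne i).symm, if_pos (Or.inr rfl), if_neg hn] at h
  have h' : ((cs n).simple i * (cs n).simple (i + 1) * (cs n).simple i) *
      ((cs n).simple (i + 1) * (cs n).simple i * (cs n).simple (i + 1)) = 1 := by
    rw [← h]; simp only [pow_succ, pow_zero, one_mul, mul_assoc]
  have := eq_inv_of_mul_eq_one_left h'
  rwa [mul_inv_rev, mul_inv_rev, (cs n).inv_simple, (cs n).inv_simple, ← mul_assoc] at this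

/-- An ascent of the length function on the right is an ascent of the permutation. -/
theorem toPerm_lt_of_length_lt (w : AffSym n) (x : ℤ)
    (h : (cs n).length w < (cs n).length (w * (cs n).simple (x : ZMod n))) :
    toPerm n w x < toPerm n w (x + 1) := by
  -- A right descent `i` is split off, `w = u s_i`. The problem then lives in a coset of the
  -- dihedral subgroup generated by `s_i` and `s_x`, with cases according to how `x` and `i` are
  -- placed.
  induction hN : (cs n).length w using Nat.strong_induction_on generalizing w x with
  | _ N ih =>
  subst hN
  by_cases hw : w = 1
  · simp [hw]
  obtain ⟨i, hi⟩ := (cs n).exists_rightDescent_of_ne_one hw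
  obtain ⟨u, rfl⟩ : ∃ u, w = u * (cs n).simple i := ⟨w * (cs n).simple i, ((cs n).simple_mul_simple_cancel_right _).symm⟩
  rw [(cs n).isRightDescent_iff] at hi
  simp only [(cs n).simple_mul_simple_cancel_right] at hi
  have hu : (cs n).length u < (cs n).length (u * (cs n).simple i) := by omega
  have hxi : (x : ZMod n) ≠ i := by
    rintro rfl
    simp only [(cs n).simple_mul_simple_cancel_right] at h
    omega
  have ihu : ∀ y : ℤ, (y : ZMod n) = i → toPerm n u y < toPerm n u (y + 1) := by
    rintro y rfl
    exact ih _ hu u y hu rfl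
  have happ : ∀ y, toPerm n (u * (cs n).simple i) y = toPerm n u (reflFun i y) := by
    intro y; rw [map_mul, Equiv.Perm.mul_apply, toPerm_simple_apply]
  rw [happ, happ]
  -- Here no braid relation is available, but periodicity suffices: `u (x - 1) < u x < u x + 2 = u
  -- (x + 2)`.
  by_cases hn : n = 2
  · subst hn
    have hx : (x : ZMod 2) = i + 1 := by
      have key : ∀ a b : ZMod 2, a ≠ b → a = b + 1 := by decide
      exact key _ _ hxi
    have e : ((x - 1 : ℤ) : ZMod 2) = i := by push_cast; rw [hx]; ring
    rw [reflFun_of_eq_add_one hx, reflFun_of_eq (i := i)]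
    · have := ihu (x - 1) e
      have h2 := toPerm_add u x
      rw [sub_add_cancel] at this
      rw [show x + 1 + 1 = x + (2 : ℕ) by push_cast; ring, h2]
      push_cast
      omega
    · push_cast; rw [hx, add_assoc, CharTwo.add_self_eq_zero, add_zero]
  by_cases hx1 : (x : ZMod n) = i + 1
  · have e : ((x - 1 : ℤ) : ZMod n) = i := by push_cast; rw [hx1]; ring
    have hr1 : reflFun i (x + 1) = x + 1 := by
      apply reflFun_of_ne <;> push_cast <;> rw [hx1]
      · exact add_two_ne hn i
      · exact add_one_ne _
    rw [reflFun_of_eq_add_one hx1, hr1]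
    rcases lt_or_ge ((cs n).length u) ((cs n).length (u * (cs n).simple (x : ZMod n))) with h3 | h3
    · have a := ih _ hu u x h3 rfl
      have b := ihu (x - 1) e
      rw [sub_add_cancel] at b
      omega
    · obtain ⟨v, rfl⟩ : ∃ v, u = v * (cs n).simple (x : ZMod n) :=
        ⟨u * (cs n).simple (x : ZMod n), ((cs n).simple_mul_simple_cancel_right _).symm⟩
      simp only [(cs n).simple_mul_simple_cancel_right] at h3
      have h4 := (cs n).length_mul_simple v (x : ZMod n)
      have h3' : (cs n).length (v * (cs n).simple (x : ZMod n)) = (cs n).length v + 1 := by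
        rcases h4 with h | h <;> omega
      have h5 : (cs n).length v < (cs n).length (v * (cs n).simple i) := by
        -- Otherwise `v = z s_i`, and the braid relation turns `w s_x = z s_i s_x s_i s_x` into `z
        -- s_x s_i`, which is too short for `x` to be an ascent of `w`.
        by_contra hcon
        have h6 := (cs n).length_mul_simple v i
        obtain ⟨z, rfl⟩ : ∃ z, v = z * (cs n).simple i := ⟨v * (cs n).simple i, ((cs n).simple_mul_simple_cancel_right _).symm⟩
        simp only [(cs n).simple_mul_simple_cancel_right] at hcon h6
        have h7 : z * (cs n).simple i * (cs n).simple (x : ZMod n) * (cs n).simple i *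
            (cs n).simple (x : ZMod n) = z * (cs n).simple (x : ZMod n) * (cs n).simple i := by
          have := simple_braid hn i
          rw [← hx1] at this
          calc _ = z * ((cs n).simple i * (cs n).simple (x : ZMod n) * (cs n).simple i) *
                (cs n).simple (x : ZMod n) := by simp only [mul_assoc]
            _ = _ := by rw [this]; simp only [mul_assoc]; rw [(cs n).simple_mul_simple_self, mul_one]
        rw [h7] at h
        have h8 := (cs n).length_mul_simple z (x : ZMod n)
        have h9 := (cs n).length_mul_simple (z * (cs n).simple (x : ZMod n)) i
        omega
      have a := ih _ (by omega) v (x - 1) (by rw [e]; exact h5) rfl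
      rw [sub_add_cancel] at a
      simp only [map_mul, Equiv.Perm.mul_apply, toPerm_simple_apply]
      rw [reflFun_of_ne (i := (x : ZMod n)) (x := x - 1), reflFun_of_eq_add_one (x := x + 1)]
      · simpa using a
      · push_cast; rfl
      · rw [e]; exact hxi.symm
      · rw [e, hx1]; exact (add_two_ne hn i).symm
  by_cases hx2 : i = (x : ZMod n) + 1
  · have hr1 : reflFun i x = x := reflFun_of_ne hxi hx1
    have hr2 : reflFun i (x + 1) = x + 1 + 1 := reflFun_of_eq (by push_cast; rw [hx2])
    rw [hr1, hr2]
    have hb := ihu (x + 1) (by push_cast; rw [hx2])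
    rcases lt_or_ge ((cs n).length u) ((cs n).length (u * (cs n).simple (x : ZMod n))) with h3 | h3
    · have a := ih _ hu u x h3 rfl
      omega
    · obtain ⟨v, rfl⟩ : ∃ v, u = v * (cs n).simple (x : ZMod n) :=
        ⟨u * (cs n).simple (x : ZMod n), ((cs n).simple_mul_simple_cancel_right _).symm⟩
      simp only [(cs n).simple_mul_simple_cancel_right] at h3
      have h4 := (cs n).length_mul_simple v (x : ZMod n)
      have h3' : (cs n).length (v * (cs n).simple (x : ZMod n)) = (cs n).length v + 1 := by
        rcases h4 with h | h <;> omega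
      have h5 : (cs n).length v < (cs n).length (v * (cs n).simple i) := by
        by_contra hcon
        have h6 := (cs n).length_mul_simple v i
        obtain ⟨z, rfl⟩ : ∃ z, v = z * (cs n).simple i := ⟨v * (cs n).simple i, ((cs n).simple_mul_simple_cancel_right _).symm⟩
        simp only [(cs n).simple_mul_simple_cancel_right] at hcon h6
        have h7 : z * (cs n).simple i * (cs n).simple (x : ZMod n) * (cs n).simple i *
            (cs n).simple (x : ZMod n) = z * (cs n).simple (x : ZMod n) * (cs n).simple i := by
          have := simple_braid hn (x : ZMod n)
          rw [← hx2] at this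
          calc _ = z * ((cs n).simple i * (cs n).simple (x : ZMod n) * (cs n).simple i) *
                (cs n).simple (x : ZMod n) := by simp only [mul_assoc]
            _ = _ := by rw [← this]; simp only [mul_assoc]; rw [(cs n).simple_mul_simple_self, mul_one]
        rw [h7] at h
        have h8 := (cs n).length_mul_simple z (x : ZMod n)
        have h9 := (cs n).length_mul_simple (z * (cs n).simple (x : ZMod n)) i
        omega
      have a := ih _ (by omega) v (x + 1) (by push_cast; rw [← hx2]; exact h5) rfl
      simp only [map_mul, Equiv.Perm.mul_apply, toPerm_simple_apply]
      rw [reflFun_of_eq (i := (x : ZMod n)) (x := x) rfl, reflFun_of_ne (x := x + 1 + 1)]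
      · exact a
      · push_cast; exact add_two_ne hn _
      · push_cast; exact add_one_ne _
  · have c1 : i - (x : ZMod n) ≠ 1 := fun h => hx2 (by rw [← h]; ring)
    have c2 : i - (x : ZMod n) ≠ -1 := fun h => hx1 (by linear_combination -h)
    rw [reflFun_of_ne hxi hx1, reflFun_of_ne]
    · apply ih _ hu u x _ rfl
      by_contra hcon
      have h8 := (cs n).length_mul_simple u (x : ZMod n)
      have h9 := (cs n).length_mul_simple (u * (cs n).simple (x : ZMod n)) i
      rw [mul_assoc, simple_comm c1 c2, ← mul_assoc] at h
      omega
    · push_cast; exact fun h => hx2 h.symm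
    · push_cast; exact fun h => hxi (add_right_cancel h)

/-- If `s_x` is not an ascent of `w` then it is one of `w s_x`, whose values at `x` and `x + 1` are
those of `w` exchanged; this gives the converse direction. -/
theorem length_lt_mul_simple_iff (w : AffSym n) (x : ℤ) :
    (cs n).length w < (cs n).length (w * (cs n).simple (x : ZMod n)) ↔
      toPerm n w x < toPerm n w (x + 1) := by
  refine ⟨toPerm_lt_of_length_lt w x, fun h => ?_⟩
  by_contra hcon
  have h1 := (cs n).length_mul_simple w (x : ZMod n)
  have := toPerm_lt_of_length_lt (w * (cs n).simple (x : ZMod n)) x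
    (by rw [(cs n).simple_mul_simple_cancel_right]; omega)
  simp only [map_mul, Equiv.Perm.mul_apply, toPerm_simple_apply] at this
  rw [reflFun_of_eq rfl, reflFun_of_eq_add_one (by push_cast; rfl)] at this
  simp only [add_sub_cancel_right] at this
  omega

theorem length_lt_simple_mul_iff (w : AffSym n) (x : ℤ) :
    (cs n).length w < (cs n).length ((cs n).simple (x : ZMod n) * w) ↔
      (toPerm n w)⁻¹ x < (toPerm n w)⁻¹ (x + 1) := by
  rw [← map_inv, ← length_lt_mul_simple_iff, ← (cs n).length_inv w,
    ← (cs n).length_inv (_ * w), mul_inv_rev, (cs n).inv_simple]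

theorem toPerm_add_mul (w : AffSym n) (x k : ℤ) :
    toPerm n w (x + n * k) = toPerm n w x + n * k := by
  induction k using Int.induction_on with
  | zero => simp
  | succ k ih => rw [mul_add, mul_one, ← add_assoc, toPerm_add, ih]; ring
  | pred k ih =>
    have := toPerm_add w (x + n * (-(k : ℤ) - 1))
    rw [show x + (n : ℤ) * (-(k : ℤ) - 1) + n = x + n * -(k : ℤ) by ring, ih] at this
    linarith

end Perm

/-! ## Periodic particle configurations -/

section PeriodicMap

variable {m n : ℕ}

/-- Injective maps `F : ℤ → ℤ` with `F (p + m) = F p + n`. -/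
structure IsPeriodicMap (m n : ℕ) (F : ℤ → ℤ) : Prop where
  inj : Function.Injective F
  add : ∀ p, F (p + m) = F p + n

/-- The sum of the values of `F` over one period. -/
def weight (m : ℕ) (F : ℤ → ℤ) : ℤ := ∑ p ∈ range m, F p

/-- The residue class `i` meets the image of `F`. -/
def Occ {n : ℕ} (F : ℤ → ℤ) (i : ZMod n) : Prop := ∃ p, (F p : ZMod n) = i

theorem IsPeriodicMap.add_mul {F : ℤ → ℤ} (hF : IsPeriodicMap m n F) (p k : ℤ) :
    F (p + m * k) = F p + n * k := by
  induction k using Int.induction_on with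
  | zero => simp
  | succ k ih => rw [mul_add, mul_one, ← add_assoc, hF.add, ih]; ring
  | pred k ih =>
    have := hF.add (p + m * (-(k : ℤ) - 1))
    rw [show p + (m : ℤ) * (-(k : ℤ) - 1) + m = p + m * -(k : ℤ) by ring, ih] at this
    linarith

theorem IsPeriodicMap.exists_of_cast_eq {F : ℤ → ℤ} (hF : IsPeriodicMap m n F) {p q : ℤ}
    (h : (F p : ZMod n) = F q) : ∃ k : ℤ, q = p + m * k := by
  rw [ZMod.intCast_eq_intCast_iff_dvd_sub] at h
  obtain ⟨k, hk⟩ := h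
  refine ⟨k, hF.inj ?_⟩
  rw [hF.add_mul]
  linarith

theorem IsPeriodicMap.cast_add_mul {F : ℤ → ℤ} (hF : IsPeriodicMap m n F) (p k : ℤ) :
    (F (p + m * k) : ZMod n) = F p := by
  rw [hF.add_mul]; simp

theorem IsPeriodicMap.exists_range [NeZero m] {F : ℤ → ℤ} (hF : IsPeriodicMap m n F) {i : ZMod n}
    (h : Occ F i) : ∃ p ∈ range m, (F p : ZMod n) = i := by
  obtain ⟨p, hp⟩ := h
  have hm : (0 : ℤ) < m := by exact_mod_cast Nat.pos_of_ne_zero (NeZero.ne m)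
  have h0 := Int.emod_nonneg p hm.ne'
  have h1 := Int.emod_lt_of_pos p hm
  refine ⟨(p % m).toNat, by rw [mem_range]; omega, ?_⟩
  rw [Int.toNat_of_nonneg h0, ← hp, ← hF.cast_add_mul (p % m) (p / m), Int.emod_add_mul_ediv]

-- By injectivity and periodicity, each residue class contains at most one value per period.
open Classical in
theorem IsPeriodicMap.sum_ite [NeZero m] {F : ℤ → ℤ} (hF : IsPeriodicMap m n F) (i : ZMod n) :
    ∑ p ∈ range m, (if (F (p : ℕ) : ZMod n) = i then (1 : ℤ) else 0) =
      if Occ F i then 1 else 0 := by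
  split_ifs with h
  · obtain ⟨p, hp, hpi⟩ := hF.exists_range h
    rw [sum_eq_single p, if_pos hpi]
    · intro q hq hqp
      refine if_neg fun hqi => hqp ?_
      obtain ⟨k, hk⟩ := hF.exists_of_cast_eq (hpi.trans hqi.symm)
      rw [mem_range] at hp hq
      have e := congrArg (· % (m : ℤ)) hk
      simp only [Int.add_mul_emod_self_left] at e
      rw [Int.emod_eq_of_lt (by omega) (by omega), Int.emod_eq_of_lt (by omega) (by omega)] at e
      exact_mod_cast e
    · exact fun h => absurd hp h
  · exact sum_eq_zero fun p _ => if_neg fun hp => h ⟨p, hp⟩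

variable [Fact (1 < n)]

theorem reflFun_eq_ite (i : ZMod n) (x : ℤ) :
    reflFun i x = x + (if (x : ZMod n) = i then 1 else 0) -
      (if (x : ZMod n) = i + 1 then 1 else 0) := by
  by_cases h : (x : ZMod n) = i
  · rw [reflFun_of_eq h, if_pos h, if_neg]
    · ring
    · rw [h]; exact (add_one_ne i).symm
  by_cases h' : (x : ZMod n) = i + 1
  · rw [reflFun_of_eq_add_one h', if_neg h, if_pos h']; ring
  · rw [reflFun_of_ne h h', if_neg h, if_neg h']; ring

-- The reflection raises the value in class `i` and lowers the one in class `i + 1`. So a letter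
-- gains at most one unit of weight, and gains it only if class `i` is occupied and class `i + 1` is
-- empty.
open Classical in
theorem IsPeriodicMap.weight_reflFun [NeZero m] {F : ℤ → ℤ} (hF : IsPeriodicMap m n F)
    (i : ZMod n) : weight m (fun p => reflFun i (F p)) =
      weight m F + (if Occ F i then 1 else 0) - (if Occ F (i + 1) then 1 else 0) := by
  simp only [weight, reflFun_eq_ite, sum_sub_distrib, sum_add_distrib]
  rw [hF.sum_ite, hF.sum_ite]

theorem IsPeriodicMap.toPerm {F : ℤ → ℤ} (hF : IsPeriodicMap m n F) (w : AffSym n) :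
    IsPeriodicMap m n (fun p => toPerm n w (F p)) where
  inj := (AffineNil.toPerm n w).injective.comp hF.inj
  add p := by rw [hF.add, toPerm_add]

end PeriodicMap

/-- Configurations of particles on the cycle `ZMod n`, with `m` particles per period, lifted to
`ℤ`; the particles are labelled in increasing order. -/
@[ext]
structure Config (m n : ℕ) where
  toFun : ℤ → ℤ
  mono : StrictMono toFun
  add : ∀ p, toFun (p + m) = toFun p + n

namespace Config

variable {m n : ℕ}

instance : CoeFun (Config m n) fun _ => ℤ → ℤ := ⟨toFun⟩

theorem isPeriodicMap (f : Config m n) : IsPeriodicMap m n f := ⟨f.mono.injective, f.add⟩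

@[ext] theorem ext' {f g : Config m n} (h : ∀ p, f p = g p) : f = g :=
  Config.ext (funext h)

variable [Fact (1 < n)]

/-- `Step i f g`: the configuration `g` is obtained from `f` by moving the particles in residue
class `i` to the residue class `i + 1`, which has to be empty in `f`. -/
def Step (i : ZMod n) (f g : Config m n) : Prop :=
  Occ f i ∧ ¬ Occ f (i + 1) ∧ ∀ p, g p = reflFun i (f p)

/-- `Path l f g`: the letters of `l`, read from right to left, lead from `f` to `g`. -/
def Path : List (ZMod n) → Config m n → Config m n → Prop
  | [], f, g => g = f
  | i :: t, f, g => ∃ h, Path t f h ∧ Step i h g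

theorem path_nil {f g : Config m n} : Path [] f g ↔ g = f := Iff.rfl

theorem path_cons {i : ZMod n} {t : List (ZMod n)} {f g : Config m n} :
    Path (i :: t) f g ↔ ∃ h, Path t f h ∧ Step i h g := Iff.rfl

theorem path_append {s t : List (ZMod n)} {f g : Config m n} :
    Path (s ++ t) f g ↔ ∃ h, Path t f h ∧ Path s h g := by
  induction s generalizing g with
  | nil => simp [path_nil]
  | cons i s ih =>
    simp only [List.cons_append, path_cons, ih]
    exact ⟨fun ⟨h, ⟨k, a, b⟩, c⟩ => ⟨k, a, h, b, c⟩, fun ⟨k, a, h, b, c⟩ => ⟨h, ⟨k, a, b⟩, c⟩⟩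

theorem Step.apply_of_eq {i : ZMod n} {f g : Config m n} (h : Step i f g) {p : ℤ}
    (hp : (f p : ZMod n) = i) : g p = f p + 1 := by rw [h.2.2, reflFun_of_eq hp]

theorem Step.apply_of_ne {i : ZMod n} {f g : Config m n} (h : Step i f g) {p : ℤ}
    (hp : (f p : ZMod n) ≠ i) : g p = f p := by
  rw [h.2.2, reflFun_of_ne hp fun e => h.2.1 ⟨p, e⟩]

theorem Step.apply {i : ZMod n} {f g : Config m n} (h : Step i f g) (p : ℤ) :
    g p = f p + if (f p : ZMod n) = i then 1 else 0 := by
  split_ifs with hp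
  · exact h.apply_of_eq hp
  · rw [h.apply_of_ne hp, add_zero]

theorem Step.le {i : ZMod n} {f g : Config m n} (h : Step i f g) (p : ℤ) : f p ≤ g p := by
  rw [h.apply]; split_ifs <;> omega

theorem Path.le {l : List (ZMod n)} {f g : Config m n} (h : Path l f g) (p : ℤ) : f p ≤ g p := by
  induction l generalizing g with
  | nil => rw [path_nil.1 h]
  | cons i t ih => obtain ⟨k, hk, hs⟩ := h; exact (ih hk).trans (hs.le p)

theorem Step.right_unique {i : ZMod n} {f g g' : Config m n} (h : Step i f g) (h' : Step i f g') :
    g = g' := by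
  ext p; rw [h.2.2, h'.2.2]

theorem Step.left_unique {i : ZMod n} {f f' g : Config m n} (h : Step i f g) (h' : Step i f' g) :
    f = f' := by
  ext p
  have := (h.2.2 p).symm.trans (h'.2.2 p)
  rw [← reflFun_reflFun i (f p), this, reflFun_reflFun]

theorem Path.right_unique {l : List (ZMod n)} {f g g' : Config m n} (h : Path l f g)
    (h' : Path l f g') : g = g' := by
  induction l generalizing g g' with
  | nil => rw [path_nil.1 h, path_nil.1 h']
  | cons i t ih =>
    obtain ⟨k, hk, hs⟩ := h
    obtain ⟨k', hk', hs'⟩ := h'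
    obtain rfl := ih hk hk'
    exact hs.right_unique hs'

/-- Any step is possible from a configuration in which `i` is occupied and `i + 1` is empty. -/
theorem exists_step {i : ZMod n} {f : Config m n} (h : Occ f i) (h' : ¬ Occ f (i + 1)) :
    ∃ g, Step i f g := by
  refine ⟨⟨fun p => reflFun i (f p), ?_, fun p => by rw [f.add, reflFun_add]⟩, h, h', fun p => rfl⟩
  intro p q hpq
  have hlt := f.mono hpq
  have hq : (f q : ZMod n) ≠ i + 1 := fun e => h' ⟨q, e⟩
  have hp : (f p : ZMod n) ≠ i + 1 := fun e => h' ⟨p, e⟩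
  simp only [reflFun, if_neg hp, if_neg hq]
  split_ifs with h1 h2 h3
  · omega
  · have : f q ≠ f p + 1 := fun e => hq (by rw [e]; push_cast; rw [h1])
    omega
  · omega
  · omega

/-- Any step is reversible. -/
theorem exists_step_left {i : ZMod n} {g : Config m n} (h : Occ g (i + 1)) (h' : ¬ Occ g i) :
    ∃ f, Step i f g := by
  have mono : StrictMono fun p => reflFun i (g p) := by
    intro p q hpq
    have hlt := g.mono hpq
    have hq : (g q : ZMod n) ≠ i := fun e => h' ⟨q, e⟩
    have hp : (g p : ZMod n) ≠ i := fun e => h' ⟨p, e⟩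
    simp only [reflFun, if_neg hp, if_neg hq]
    split_ifs with h1 h2 h3
    · omega
    · omega
    · have : g p ≠ g q - 1 := fun e => hp (by rw [e]; push_cast; rw [h3]; ring)
      omega
    · omega
  refine ⟨⟨fun p => reflFun i (g p), mono, fun p => by rw [g.add, reflFun_add]⟩, ?_, ?_,
    fun p => (reflFun_reflFun i (g p)).symm⟩
  · obtain ⟨p, hp⟩ := h
    exact ⟨p, by simp only [reflFun_of_eq_add_one hp]; push_cast; rw [hp]; ring⟩
  · rintro ⟨p, hp⟩
    dsimp only at hp
    apply h'
    refine ⟨p, ?_⟩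
    by_cases h2 : (g p : ZMod n) = i + 1
    · rw [reflFun_of_eq_add_one h2] at hp
      push_cast at hp
      rw [h2, add_sub_cancel_right] at hp
      exact absurd hp.symm (add_one_ne i)
    · rw [reflFun_of_ne (fun e => h' ⟨p, e⟩) h2] at hp
      exact absurd hp h2

theorem Step.occ_iff {i : ZMod n} {f g : Config m n} (h : Step i f g) (j : ZMod n) :
    Occ g j ↔ j = i + 1 ∨ (j ≠ i ∧ Occ f j) := by
  constructor
  · rintro ⟨p, rfl⟩
    by_cases hp : (f p : ZMod n) = i
    · left; rw [h.apply_of_eq hp]; push_cast; rw [hp]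
    · right; rw [h.apply_of_ne hp]; exact ⟨hp, p, rfl⟩
  · rintro (rfl | ⟨hj, p, rfl⟩)
    · obtain ⟨p, hp⟩ := h.1
      exact ⟨p, by rw [h.apply_of_eq hp]; push_cast; rw [hp]⟩
    · exact ⟨p, by rw [h.apply_of_ne hj]⟩

theorem Step.not_occ {i : ZMod n} {f g : Config m n} (h : Step i f g) : ¬ Occ g i := by
  rw [h.occ_iff]
  rintro (e | e)
  · exact add_one_ne i e.symm
  · exact e.1 rfl

theorem Path.apply {l : List (ZMod n)} {f g : Config m n} (h : Path l f g) (p : ℤ) :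
    g p = toPerm n ((cs n).wordProd l) (f p) := by
  induction l generalizing g with
  | nil => rw [path_nil.1 h, (cs n).wordProd_nil]; simp
  | cons i t ih =>
    obtain ⟨k, hk, hs⟩ := h
    rw [(cs n).wordProd_cons, map_mul, Equiv.Perm.mul_apply, toPerm_simple_apply, ← ih hk, hs.2.2]

section Weight

variable [NeZero m]

theorem Step.weight {i : ZMod n} {f g : Config m n} (h : Step i f g) :
    weight m g = weight m f + 1 := by
  have := f.isPeriodicMap.weight_reflFun i
  rw [if_pos h.1, if_neg h.2.1, sub_zero] at this
  rw [← this]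
  exact sum_congr rfl fun p _ => h.2.2 p

theorem Path.weight {l : List (ZMod n)} {f g : Config m n} (h : Path l f g) :
    weight m g = weight m f + l.length := by
  induction l generalizing g with
  | nil => rw [path_nil.1 h]; simp
  | cons i t ih =>
    obtain ⟨k, hk, hs⟩ := h
    rw [hs.weight, ih hk, List.length_cons]; push_cast; ring

/-- A word of length `r` gains weight `r` only if each of its letters is a legal move. Since the
gain depends only on the group element, executable words are reduced, and executability is the same
for all words of that length for the element. -/
theorem weight_toPerm_le (f : Config m n) (l : List (ZMod n)) :
    AffineNil.weight m (fun p => toPerm n ((cs n).wordProd l) (f p)) ≤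
      AffineNil.weight m f + l.length ∧
    (AffineNil.weight m (fun p => toPerm n ((cs n).wordProd l) (f p)) =
      AffineNil.weight m f + l.length → ∃ g, Path l f g) := by
  induction l with
  | nil => simp [(cs n).wordProd_nil, path_nil]
  | cons i t ih =>
    set w := (cs n).wordProd t with hw
    have e : (fun p => toPerm n ((cs n).wordProd (i :: t)) (f p)) =
        fun p => reflFun i (toPerm n w (f p)) := by
      funext p
      rw [(cs n).wordProd_cons, map_mul, Equiv.Perm.mul_apply, toPerm_simple_apply]
    rw [e, (f.isPeriodicMap.toPerm w).weight_reflFun, List.length_cons]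
    push_cast
    constructor
    · split_ifs <;> linarith [ih.1]
    · intro h
      by_cases h1 : Occ (fun p => toPerm n w (f p)) i
      · by_cases h2 : Occ (fun p => toPerm n w (f p)) (i + 1)
        · rw [if_pos h1, if_pos h2] at h; linarith [ih.1]
        · rw [if_pos h1, if_neg h2] at h
          obtain ⟨k, hk⟩ := ih.2 (by linarith)
          have ek : (fun p => toPerm n w (f p)) = k := funext fun p => (hk.apply p).symm
          rw [ek] at h1 h2
          obtain ⟨g, hg⟩ := exists_step h1 h2
          exact ⟨g, k, hk, hg⟩
      · rw [if_neg h1] at h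
        split_ifs at h <;> linarith [ih.1]

theorem Path.length_le {l l' : List (ZMod n)} {f g : Config m n} (h : Path l f g)
    (hl : (cs n).wordProd l' = (cs n).wordProd l) : l.length ≤ l'.length := by
  have h1 := (weight_toPerm_le f l').1
  rw [hl] at h1
  have h2 : (fun p => toPerm n ((cs n).wordProd l) (f p)) = g := funext fun p => (h.apply p).symm
  rw [h2, h.weight] at h1
  omega

theorem Path.isReduced {l : List (ZMod n)} {f g : Config m n} (h : Path l f g) :
    (cs n).IsReduced l := by
  obtain ⟨l', hl', e⟩ := (cs n).exists_isReduced ((cs n).wordProd l)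
  have h1 := h.length_le e.symm
  have h2 := (cs n).length_wordProd_le l
  have h3 := hl'.eq
  rw [← e] at h3
  exact le_antisymm h2 (by omega)

/-- Two words of the same length for the same element lead to the same configuration as soon as
one of them is applicable. -/
theorem Path.of_wordProd_eq {l l' : List (ZMod n)} {f g : Config m n} (h : Path l f g)
    (hl : (cs n).wordProd l' = (cs n).wordProd l) (hlen : l'.length = l.length) :
    Path l' f g := by
  have h2 : (fun p => toPerm n ((cs n).wordProd l) (f p)) = g := funext fun p => (h.apply p).symm
  obtain ⟨g', hg'⟩ := (weight_toPerm_le f l').2 (by rw [hl, h2, h.weight, hlen])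
  have : g' = g := by
    ext p; rw [hg'.apply, h.apply, hl]
  rwa [← this]

end Weight

end Config

/-! ## Commutation equivalence of words -/

/-- Two words have the same product in every monoid generated by elements satisfying the
commutation relations. -/
def CommEq {n : ℕ} (l l' : List (ZMod n)) : Prop :=
  ∀ (M : Type) [Monoid M] (φ : ZMod n → M),
    (∀ i j, i - j ≠ 1 → i - j ≠ -1 → φ i * φ j = φ j * φ i) →
      (l.map φ).prod = (l'.map φ).prod

namespace CommEq

variable {n : ℕ}

theorem refl (l : List (ZMod n)) : CommEq l l := fun _ _ _ _ => rfl

theorem symm {l l' : List (ZMod n)} (h : CommEq l l') : CommEq l' l :=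
  fun M _ φ hφ => (h M φ hφ).symm

theorem trans {l l' l'' : List (ZMod n)} (h : CommEq l l') (h' : CommEq l' l'') : CommEq l l'' :=
  fun M _ φ hφ => (h M φ hφ).trans (h' M φ hφ)

theorem append {l l' s s' : List (ZMod n)} (h : CommEq l l') (h' : CommEq s s') :
    CommEq (l ++ s) (l' ++ s') := by
  intro M _ φ hφ
  simp only [List.map_append, List.prod_append]
  rw [h M φ hφ, h' M φ hφ]

theorem cons (i : ZMod n) {l l' : List (ZMod n)} (h : CommEq l l') : CommEq (i :: l) (i :: l') :=
  append (refl [i]) h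

theorem swap {i j : ZMod n} (h₁ : i - j ≠ 1) (h₂ : i - j ≠ -1) (l : List (ZMod n)) :
    CommEq (i :: j :: l) (j :: i :: l) := by
  intro M _ φ hφ
  simp only [List.map_cons, List.prod_cons, ← mul_assoc, hφ i j h₁ h₂]

/-- A letter commutes with a word all of whose letters commute with it. -/
theorem cons_comm {i : ZMod n} {s : List (ZMod n)} (h : ∀ k ∈ s, k - i ≠ 1 ∧ k - i ≠ -1)
    (t : List (ZMod n)) : CommEq (i :: (s ++ t)) (s ++ i :: t) := by
  induction s with
  | nil => exact refl _
  | cons k s ih =>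
    have hk := h k (by simp)
    have : CommEq (i :: k :: (s ++ t)) (k :: i :: (s ++ t)) := by
      refine swap (fun e => hk.2 ?_) (fun e => hk.1 ?_) _
      · linear_combination -e
      · linear_combination -e
    exact this.trans (cons k (ih fun k' hk' => h k' (by simp [hk'])))

theorem perm {l l' : List (ZMod n)} (h : CommEq l l') : l.Perm l' := by
  -- The free commutative monoid on the letters serves as test monoid.
  have := h (Multiplicative (Multiset (ZMod n))) (fun i => Multiplicative.ofAdd {i})
    (fun i j _ _ => mul_comm _ _)
  have key : ∀ l : List (ZMod n), (l.map fun i => Multiplicative.ofAdd ({i} : Multiset (ZMod n))).prod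
      = Multiplicative.ofAdd (l : Multiset (ZMod n)) := by
    intro l
    induction l with
    | nil => rfl
    | cons i t ih => rw [List.map_cons, List.prod_cons, ih, ← ofAdd_add]; rfl
  rw [key, key] at this
  exact Multiset.coe_eq_coe.1 (Multiplicative.ofAdd.injective this)

variable (n) in
/-- Commutation equivalence as a setoid. -/
def setoid : Setoid (List (ZMod n)) where
  r := CommEq
  iseqv := ⟨refl, symm, trans⟩

theorem wordProd_eq {l l' : List (ZMod n)} [Fact (1 < n)] (h : CommEq l l') :
    (cs n).wordProd l = (cs n).wordProd l' :=
  h _ (cs n).simple fun _ _ => simple_comm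

end CommEq

namespace Config

variable {m n : ℕ} [Fact (1 < n)]

theorem sub_ne_of_ne {i k : ZMod n} (h₁ : k ≠ i + 1) (h₂ : i ≠ k + 1) :
    k - i ≠ 1 ∧ k - i ≠ -1 :=
  ⟨fun e => h₁ (by rw [← e]; ring), fun e => h₂ (by linear_combination -e)⟩

/-- If the last step into `g` can be `i`, along a particle that has moved since `f`, then the
letter `i` can be moved to the front of any word leading from `f` to `g`. -/
theorem Path.exists_commEq_cons {l : List (ZMod n)} {f g h : Config m n} {i : ZMod n}
    (hl : Path l f g) (hs : Step i h g) {p : ℤ} (hp : (h p : ZMod n) = i) (hlt : f p < g p) :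
    ∃ t, CommEq l (i :: t) ∧ Path t f h := by
  induction l generalizing g h with
  | nil => rw [path_nil.1 hl] at hlt; exact absurd hlt (lt_irrefl _)
  | cons k s ih =>
    obtain ⟨h', hs', hk⟩ := hl
    by_cases hki : k = i
    · subst hki
      obtain rfl := hk.left_unique hs
      exact ⟨s, CommEq.refl _, hs'⟩
    have hgp : (g p : ZMod n) = i + 1 := by rw [hs.apply_of_eq hp]; push_cast; rw [hp]
    have hpk : (h' p : ZMod n) ≠ k := by
      intro e
      rw [hk.apply_of_eq e] at hgp
      push_cast at hgp
      rw [e] at hgp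
      exact hki (add_right_cancel hgp)
    have hg' : g p = h' p := hk.apply_of_ne hpk
    -- The front letter `k` is no neighbour of `i`: `k = i + 1` would have moved `p` out of the
    -- class where `g` finds it, and `k = i - 1` would have filled class `i`, which is empty in `g`.
    have hk1 : k ≠ i + 1 := by
      rintro rfl
      exact hpk (by rw [← hg', hgp])
    have hk2 : i ≠ k + 1 := by
      rintro rfl
      exact hs.not_occ ((hk.occ_iff _).2 (Or.inl rfl))
    have ho : Occ h' (i + 1) := ⟨p, by rw [← hg', hgp]⟩
    have hno : ¬ Occ h' i := by
      intro e
      exact hs.not_occ ((hk.occ_iff _).2 (Or.inr ⟨fun e => hki e.symm, e⟩))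
    -- The fourth corner of a square: from `h''`, the letter `i` leads to `h'` and the letter `k` to
    -- `h`.
    obtain ⟨h'', hh⟩ := exists_step_left ho hno
    have hcomm := sub_ne_of_ne hk1 hk2
    have hp'' : (h'' p : ZMod n) = i := by
      have e := hh.apply p
      by_contra hcon
      rw [if_neg hcon] at e
      apply hcon
      have := hs.apply_of_eq hp
      have h2 := hh.occ_iff (i + 1)
      exfalso
      exact hh.2.1 ⟨p, by rw [← add_zero (h'' p), ← e, ← hg', hgp]⟩
    obtain ⟨t, ht, ht'⟩ := ih hs' hh hp'' (by rw [← hg']; exact hlt)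
    refine ⟨k :: t, ?_, h'', ht', ?_⟩
    · refine (CommEq.cons k ht).trans (CommEq.swap hcomm.1 hcomm.2 _)
    · refine ⟨?_, ?_, ?_⟩
      · have := hk.1
        rw [hh.occ_iff] at this
        exact (this.resolve_left hk1).2
      · intro e
        exact hk.2.1 ((hh.occ_iff _).2 (Or.inr ⟨hk2.symm, e⟩))
      · intro q
        have e1 := hs.2.2 q
        have e2 := hk.2.2 q
        have e3 := hh.2.2 q
        have hc := congrArg (fun σ : Equiv.Perm ℤ => σ (h'' q)) (refl_comm hcomm.1 hcomm.2)
        simp only [Equiv.Perm.mul_apply, refl_apply] at hc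
        rw [← reflFun_reflFun i (h q), ← e1, e2, e3, hc, reflFun_reflFun]

/-- Two words leading from `f` to `g` are equal up to commutations. -/
theorem Path.commEq [NeZero m] {l l' : List (ZMod n)} {f g : Config m n} (hl : Path l f g)
    (hl' : Path l' f g) : CommEq l l' := by
  induction l generalizing g l' with
  | nil =>
    have h1 := hl.weight
    have h2 := hl'.weight
    have : l' = [] := by
      rw [← List.length_eq_zero_iff]
      simp only [List.length_nil] at h1
      omega
    rw [this]
    exact CommEq.refl _
  | cons i t ih =>
    obtain ⟨h, ht, hs⟩ := hl
    obtain ⟨p, hp⟩ := hs.1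
    have hlt : f p < g p := by
      have := ht.le p
      rw [hs.apply_of_eq hp]
      omega
    obtain ⟨t', ht', hp'⟩ := hl'.exists_commEq_cons hs hp hlt
    exact (CommEq.cons i (ih ht hp')).trans ht'.symm

/-- Applicability of a word is invariant under commutations. -/
theorem Path.of_commEq [NeZero m] {l l' : List (ZMod n)} {f g : Config m n} (hl : Path l f g)
    (h : CommEq l l') : Path l' f g :=
  hl.of_wordProd_eq h.symm.wordProd_eq h.perm.length_eq.symm

end Config

/-! ## Cyclically ordered words -/

section CycWord

variable {n : ℕ}

/-- A word without repetitions in which no letter `i` stands to the left of `i + ε`: cyclically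
decreasing for `ε = 1` and cyclically increasing for `ε = -1`. -/
def CycWord (ε : ZMod n) (l : List (ZMod n)) : Prop :=
  l.Nodup ∧ l.Pairwise fun a b => b ≠ a + ε

theorem cycWord_nil (ε : ZMod n) : CycWord ε [] := ⟨List.nodup_nil, List.Pairwise.nil⟩

theorem cycWord_cons {ε i : ZMod n} {l : List (ZMod n)} :
    CycWord ε (i :: l) ↔ i ∉ l ∧ i + ε ∉ l ∧ CycWord ε l := by
  simp only [CycWord, List.nodup_cons, List.pairwise_cons]
  constructor
  · rintro ⟨⟨a, b⟩, c, d⟩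
    exact ⟨a, fun h => c _ h rfl, b, d⟩
  · rintro ⟨a, b, c, d⟩
    exact ⟨⟨a, c⟩, fun x hx e => b (e ▸ hx), d⟩

theorem CycWord.reverse {ε : ZMod n} {l : List (ZMod n)} (h : CycWord ε l) :
    CycWord (-ε) l.reverse := by
  refine ⟨List.nodup_reverse.2 h.1, List.pairwise_reverse.2 (h.2.imp ?_)⟩
  intro a b hab e
  exact hab (by rw [e]; ring)

theorem CycWord.sublist {ε : ZMod n} {l l' : List (ZMod n)} (h : CycWord ε l) (hl : l'.Sublist l) :
    CycWord ε l' := ⟨h.1.sublist hl, h.2.sublist hl⟩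

theorem IsCycDecWord.cycWord [Fact (1 < n)] {l : List (ZMod n)} (h : IsCycDecWord l) :
    CycWord 1 l := by
  refine ⟨h.1, ?_⟩
  rw [List.pairwise_iff_getElem]
  intro a b ha hb hab e
  have := h.2 l[a] (List.getElem_mem ha) (e ▸ List.getElem_mem hb)
  rw [← e, h.1.idxOf_getElem, h.1.idxOf_getElem] at this
  omega

theorem CycWord.toFinset_ne_univ [Fact (1 < n)] [NeZero n] {ε : ZMod n} (hε : ε ≠ 0)
    {l : List (ZMod n)} (h : CycWord ε l) : l.toFinset ≠ univ := by
  intro e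
  have hmem : ∀ i, i ∈ l := fun i => by rw [← List.mem_toFinset, e]; exact mem_univ i
  cases l with
  | nil => simpa using hmem 0
  | cons i t =>
    rw [cycWord_cons] at h
    have := hmem (i + ε)
    rw [List.mem_cons] at this
    rcases this with h1 | h1
    · exact hε (by simpa using h1)
    · exact h.2.1 h1

/-- A cyclically ordered word is determined by its letters, up to commutations. -/
theorem CycWord.commEq [Fact (1 < n)] {ε : ZMod n} (hε : ε = 1 ∨ ε = -1) {l l' : List (ZMod n)}
    (h : CycWord ε l) (h' : CycWord ε l') (hm : ∀ i, i ∈ l ↔ i ∈ l') : CommEq l l' := by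
  induction l generalizing l' with
  | nil =>
    cases l' with
    | nil => exact CommEq.refl _
    | cons i t => simpa using hm i
  | cons i t ih =>
    obtain ⟨s, t', rfl⟩ := List.append_of_mem ((hm i).1 (by simp))
    rw [cycWord_cons] at h
    have hsub : (s ++ t').Sublist (s ++ i :: t') :=
      List.Sublist.append_left (List.sublist_cons_self _ _) _
    have hnd := h'.1
    rw [List.nodup_middle, List.nodup_cons] at hnd
    have h1 : CommEq t (s ++ t') := by
      refine ih h.2.2 (h'.sublist hsub) fun k => ?_
      by_cases hk : k = i
      · subst hk; exact ⟨fun e => absurd e h.1, fun e => absurd e hnd.1⟩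
      · have := hm k
        simp only [List.mem_cons, List.mem_append, hk, false_or] at this ⊢
        exact this
    -- No letter before `i` in `l'` is a neighbour of `i`: `i - ε` is excluded by the order of `l'`,
    -- and `i + ε` by that of the other word, where `i` comes first.
    refine (CommEq.cons i h1).trans (CommEq.cons_comm (fun k hk => ?_) t')
    have hki : k ≠ i := by
      rintro rfl
      exact hnd.1 (by simp [hk])
    have a1 : i ≠ k + ε := (List.pairwise_append.1 h'.2).2.2 k hk i (by simp)
    have a2 : k ≠ i + ε := by
      rintro rfl
      have := (hm (i + ε)).2 (by simp [hk])
      rw [List.mem_cons] at this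
      exact this.elim hki h.2.1
    rcases hε with rfl | rfl
    · exact Config.sub_ne_of_ne a2 a1
    · exact Config.sub_ne_of_ne (fun e => a1 (by rw [e]; ring)) (fun e => a2 (by rw [e]; ring))

variable [Fact (1 < n)] [NeZero n]

theorem cycWord_cycDecWord {J : Finset (ZMod n)} (hJ : J ≠ univ) : CycWord 1 (cycDecWord J) :=
  (cycDecWord_spec J hJ).1.cycWord

theorem mem_cycDecWord {J : Finset (ZMod n)} (hJ : J ≠ univ) {i : ZMod n} :
    i ∈ cycDecWord J ↔ i ∈ J := by
  rw [← List.mem_toFinset, (cycDecWord_spec J hJ).2]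

theorem length_cycDecWord {J : Finset (ZMod n)} (hJ : J ≠ univ) : (cycDecWord J).length = #J := by
  rw [← List.toFinset_card_of_nodup (cycDecWord_spec J hJ).1.1, (cycDecWord_spec J hJ).2]

theorem CycWord.commEq_cycDecWord {l : List (ZMod n)} (h : CycWord 1 l) :
    CommEq l (cycDecWord l.toFinset) := by
  have hJ := h.toFinset_ne_univ one_ne_zero
  exact h.commEq (Or.inl rfl) (cycWord_cycDecWord hJ) fun i => by
    rw [mem_cycDecWord hJ, List.mem_toFinset]

theorem CycWord.commEq_cycDecWord_reverse {l : List (ZMod n)} (h : CycWord (-1) l) :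
    CommEq l (cycDecWord l.toFinset).reverse := by
  have hJ := h.toFinset_ne_univ (neg_ne_zero.2 one_ne_zero)
  exact h.commEq (Or.inr rfl) (cycWord_cycDecWord hJ).reverse fun i => by
    rw [List.mem_reverse, mem_cycDecWord hJ, List.mem_toFinset]

end CycWord

/-! ## Locally admissible words -/

section Admissible

variable {n : ℕ}

/-- Between any two consecutive occurrences of a letter `j` there are letters `j + 1` and
`j - 1`. -/
def Admissible (l : List (ZMod n)) : Prop :=
  ∀ a j b c, l = a ++ j :: (b ++ j :: c) → j ∉ b → j + 1 ∈ b ∧ j - 1 ∈ b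

theorem Admissible.tail {i : ZMod n} {l : List (ZMod n)} (h : Admissible (i :: l)) :
    Admissible l := fun a j b c e hj => h (i :: a) j b c (by rw [e]; rfl) hj

theorem admissible_of_nodup {l : List (ZMod n)} (h : l.Nodup) : Admissible l := by
  rintro a j b c rfl hj
  have := (List.nodup_append.1 h).2.1
  simp at this

open Classical in
/-- The letters `i` of a word whose first occurrence (from the right) precedes that of `i + ε`. -/
def initials (ε : ZMod n) : List (ZMod n) → Finset (ZMod n)
  | [] => ∅
  | i :: t => if i ∉ t ∧ i + ε ∉ t then insert i (initials ε t) else initials ε t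

theorem initials_cons_of_mem {ε i : ZMod n} {t : List (ZMod n)} (h : i ∉ t ∧ i + ε ∉ t) :
    initials ε (i :: t) = insert i (initials ε t) := by
  rw [initials, if_pos h]

theorem initials_subset_cons (ε i : ZMod n) (t : List (ZMod n)) :
    initials ε t ⊆ initials ε (i :: t) := by
  rw [initials]
  split_ifs
  · exact subset_insert _ _
  · exact Subset.rfl

theorem mem_initials_of_mem {ε i : ZMod n} {t : List (ZMod n)} (h : i ∈ t) (h' : i + ε ∉ t) :
    i ∈ initials ε t := by
  induction t with
  | nil => simp at h
  | cons k t ih =>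
    rw [List.mem_cons, not_or] at h'
    by_cases hi : i ∈ t
    · exact initials_subset_cons _ _ _ (ih hi h'.2)
    · obtain rfl : i = k := by simpa [hi] using h
      rw [initials_cons_of_mem ⟨hi, h'.2⟩]
      exact mem_insert_self _ _

theorem mem_of_mem_initials {ε i : ZMod n} {t : List (ZMod n)} (h : i ∈ initials ε t) : i ∈ t := by
  induction t with
  | nil => simp [initials] at h
  | cons k t ih =>
    rw [initials] at h
    split_ifs at h
    · rcases mem_insert.1 h with rfl | h
      · simp
      · simp [ih h]
    · simp [ih h]

/-- The first set wants `i` to appear before `i + 1`, the second `i + 1` before `i`. Hence the sites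
that must be empty at the start never clash with those that must be occupied. -/
theorem disjoint_initials {i : ZMod n} {t : List (ZMod n)} [Fact (1 < n)] (h : i ∈ initials 1 t) :
    i + 1 ∉ initials (-1) t := by
  induction t with
  | nil => simp [initials]
  | cons k t ih =>
    intro h'
    rw [initials] at h h'
    split_ifs at h with h1
    · rcases mem_insert.1 h with rfl | h
      · have : i + 1 ∈ i :: t := by
          split_ifs at h' with h2
          · exact mem_of_mem_initials (by rw [initials, if_pos h2]; exact h')
          · exact List.mem_cons_of_mem _ (mem_of_mem_initials h')
        rw [List.mem_cons] at this
        exact this.elim (add_one_ne i) h1.2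
      · split_ifs at h' with h2
        · rcases mem_insert.1 h' with e | h'
          · rw [← e] at h2
            exact h2.2 (by simpa using mem_of_mem_initials h)
          · exact ih h h'
        · exact ih h h'
    · split_ifs at h' with h2
      · rcases mem_insert.1 h' with e | h'
        · rw [← e] at h2
          exact h2.2 (by simpa using mem_of_mem_initials h)
        · exact ih h h'
      · exact ih h h'

/-- Words are executed from right to left, so the leftmost letter with property `P` is the most
recent one. -/
theorem exists_split {P : ZMod n → Prop} {t : List (ZMod n)} (h : ∃ k ∈ t, P k) :
    ∃ b k c, t = b ++ k :: c ∧ P k ∧ ∀ x ∈ b, ¬ P x := by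
  induction t with
  | nil => simp at h
  | cons i t ih =>
    by_cases hi : P i
    · exact ⟨[], i, t, rfl, hi, by simp⟩
    · obtain ⟨k, hk, hPk⟩ := h
      rw [List.mem_cons] at hk
      rcases hk with rfl | hk
      · exact absurd hPk hi
      · obtain ⟨b, k, c, rfl, hk, hb⟩ := ih ⟨k, hk, hPk⟩
        refine ⟨i :: b, k, c, rfl, hk, fun x hx => ?_⟩
        rw [List.mem_cons] at hx
        rcases hx with rfl | hx
        · exact hi
        · exact hb x hx

namespace Config

variable {m : ℕ} [Fact (1 < n)]

theorem Path.occ_iff {t : List (ZMod n)} {f h : Config m n} (hp : Path t f h) {j : ZMod n}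
    (h1 : ∀ x ∈ t, ¬ (x = j ∨ x + 1 = j)) : Occ h j ↔ Occ f j := by
  induction t generalizing h with
  | nil => rw [path_nil.1 hp]
  | cons i t ih =>
    obtain ⟨k, hk, hs⟩ := hp
    have := h1 i (by simp)
    push Not at this
    rw [hs.occ_iff, ih hk fun x hx => h1 x (by simp [hx])]
    exact ⟨fun e => (e.resolve_left this.2.symm).2, fun e => Or.inr ⟨this.1.symm, e⟩⟩

/-- An admissible word is applicable to every configuration with the necessary vacant and occupied
positions. -/
theorem exists_path {l : List (ZMod n)} (hl : Admissible l) {f : Config m n}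
    (h₁ : ∀ j ∈ initials 1 l, ¬ Occ f (j + 1)) (h₂ : ∀ j ∈ initials (-1) l, Occ f j) :
    ∃ g, Path l f g := by
  induction l with
  | nil => exact ⟨f, rfl⟩
  | cons i t ih =>
    obtain ⟨h, hh⟩ := ih hl.tail (fun j hj => h₁ j (initials_subset_cons _ _ _ hj))
      (fun j hj => h₂ j (initials_subset_cons _ _ _ hj))
    -- The most recent letter among `i` and `i - 1` decides. It is not `i`, since admissibility
    -- would put an `i - 1` after it. If it is `i - 1`, it has just filled class `i`; if there is
    -- none, `i` is initial for `-1` and class `i` was occupied from the start.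
    have ho : Occ h i := by
      by_cases hex : ∃ k ∈ t, k = i ∨ k + 1 = i
      · obtain ⟨b, k, c, rfl, hk, hb⟩ := exists_split hex
        obtain ⟨h', hc, hb'⟩ := path_append.1 hh
        rw [hb'.occ_iff hb]
        rcases hk with rfl | hk
        · have hkb : k ∉ b := fun e => hb k e (Or.inl rfl)
          have := (hl [] k b c rfl hkb).2
          exact absurd (Or.inr (by ring)) (hb _ this)
        · obtain ⟨h'', _, hs⟩ := hc
          exact (hs.occ_iff _).2 (Or.inl hk.symm)
      · push Not at hex
        rw [hh.occ_iff fun x hx => not_or.2 (hex x hx)]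
        apply h₂
        rw [initials_cons_of_mem]
        · exact mem_insert_self _ _
        · exact ⟨fun e => (hex i e).1 rfl, fun e => (hex _ e).2 (by ring)⟩
    -- Dually, with the most recent letter among `i + 1`, which empties its class, and `i`, which
    -- admissibility forbids.
    have hno : ¬ Occ h (i + 1) := by
      by_cases hex : ∃ k ∈ t, k = i + 1 ∨ k + 1 = i + 1
      · obtain ⟨b, k, c, rfl, hk, hb⟩ := exists_split hex
        obtain ⟨h', hc, hb'⟩ := path_append.1 hh
        rw [hb'.occ_iff hb]
        rcases hk with rfl | hk
        · obtain ⟨h'', _, hs⟩ := hc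
          exact hs.not_occ
        · obtain rfl : k = i := add_right_cancel hk
          have hkb : k ∉ b := fun e => hb k e (Or.inr rfl)
          have := (hl [] k b c rfl hkb).1
          exact absurd (Or.inl rfl) (hb _ this)
      · push Not at hex
        rw [hh.occ_iff fun x hx => not_or.2 (hex x hx)]
        apply h₁
        rw [initials_cons_of_mem]
        · exact mem_insert_self _ _
        · exact ⟨fun e => (hex i e).2 rfl, fun e => (hex _ e).1 rfl⟩
    obtain ⟨g, hg⟩ := exists_step ho hno
    exact ⟨g, h, hh, hg⟩

/-- Any set of positions is the set of occupied positions of a configuration. -/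
theorem exists_occ_iff [NeZero n] [NeZero m] (S : Finset (ZMod n)) (hS : #S = m) :
    ∃ f : Config m n, ∀ i, Occ f i ↔ i ∈ S := by
  have hm : (0 : ℤ) < m := by exact_mod_cast Nat.pos_of_ne_zero (NeZero.ne m)
  have hR : #(S.image ZMod.val) = m := by
    rw [card_image_of_injective _ (ZMod.val_injective n), hS]
  set e := (S.image ZMod.val).orderEmbOfFin hR with he
  have hlt : ∀ p : ℤ, (p % m).toNat < m := by
    intro p
    have h0 := Int.emod_nonneg p hm.ne'
    have h1 := Int.emod_lt_of_pos p hm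
    omega
  have hen : ∀ a, e a < n := by
    intro a
    have := (S.image ZMod.val).orderEmbOfFin_mem hR a
    obtain ⟨x, _, hx⟩ := mem_image.1 this
    rw [he, ← hx]; exact ZMod.val_lt x
  -- The increasing enumeration of the representatives in `[0, n)`, continued periodically.
  refine ⟨⟨fun p => (e ⟨(p % m).toNat, hlt p⟩ : ℤ) + n * (p / m), ?_, ?_⟩, ?_⟩
  · intro p q hpq
    dsimp only
    rcases (Int.ediv_le_ediv hm hpq.le).lt_or_eq with h | h
    · have a1 := hen ⟨(p % m).toNat, hlt p⟩
      have : (n : ℤ) * (p / m) + n ≤ n * (q / m) := by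
        have : (n : ℤ) * (p / m + 1) ≤ n * (q / m) :=
          mul_le_mul_of_nonneg_left h (by positivity)
        linarith
      omega
    · rw [h]
      have a1 := Int.emod_add_mul_ediv p m
      have a2 := Int.emod_add_mul_ediv q m
      rw [h] at a1
      have h0 := Int.emod_nonneg p hm.ne'
      have : e ⟨(p % m).toNat, hlt p⟩ < e ⟨(q % m).toNat, hlt q⟩ := by
        apply e.strictMono
        rw [Fin.lt_def]
        change (p % m).toNat < (q % m).toNat
        omega
      omega
  · intro p
    have a : (p + (m : ℤ)) % m = p % m := by simp
    have b : (p + (m : ℤ)) / m = p / m + 1 := by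
      rw [Int.add_ediv_of_dvd_right (dvd_refl _), Int.ediv_self hm.ne']
    simp only [a, b]
    ring
  · intro i
    constructor
    · rintro ⟨p, hp⟩
      dsimp only at hp
      have := (S.image ZMod.val).orderEmbOfFin_mem hR ⟨(p % m).toNat, hlt p⟩
      obtain ⟨x, hx, hx'⟩ := mem_image.1 this
      rw [he, ← hx'] at hp
      push_cast at hp
      rw [ZMod.natCast_zmod_val, ZMod.natCast_self, zero_mul, add_zero] at hp
      rwa [← hp]
    · intro hi
      have : i.val ∈ Set.range e := by
        rw [he, range_orderEmbOfFin]
        exact_mod_cast mem_image_of_mem _ hi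
      obtain ⟨a, ha⟩ := this
      refine ⟨(a : ℕ), ?_⟩
      have a1 : (((a : ℕ) : ℤ) % m) = (a : ℕ) := Int.emod_eq_of_lt (by omega) (by omega)
      have a3 : (⟨(((a : ℕ) : ℤ) % m).toNat, hlt _⟩ : Fin m) = a := by
        apply Fin.ext
        change (((a : ℕ) : ℤ) % m).toNat = (a : ℕ)
        rw [a1]; simp
      simp only [a3]
      rw [ha]
      push_cast
      rw [ZMod.natCast_zmod_val, ZMod.natCast_self, zero_mul, add_zero]

end Config

variable [Fact (1 < n)]

/-- Two occurrences of a neighbour of `i` would have to enclose an `i`. -/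
theorem Admissible.count_le_one {t : List (ZMod n)} {i k : ZMod n} (h : Admissible t)
    (hk : k = i + 1 ∨ k = i - 1) (hi : i ∉ t) : t.count k ≤ 1 := by
  by_contra hcon
  have hmem : k ∈ t := List.count_pos_iff.1 (by omega)
  obtain ⟨a, c, rfl, ha⟩ := List.eq_append_cons_of_mem hmem
  have hc : k ∈ c := by
    rw [List.count_append, List.count_cons_self, List.count_eq_zero_of_not_mem ha] at hcon
    exact List.count_pos_iff.1 (by omega)
  obtain ⟨b, c, rfl, hb⟩ := List.eq_append_cons_of_mem hc
  have := h a k b c rfl hb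
  apply hi
  rcases hk with rfl | rfl
  · simp only [add_sub_cancel_right] at this; simp [this.2]
  · simp only [sub_add_cancel] at this; simp [this.1]

/-- In an admissible word the first occurrences of the initial letters can be moved to the right
end. -/
theorem Admissible.exists_commEq_append {ε : ZMod n} (hε : ε = 1 ∨ ε = -1) {l : List (ZMod n)}
    (hl : Admissible l) :
    ∃ t D, CommEq l (t ++ D) ∧ CycWord ε D ∧ ∀ i, i ∈ D ↔ i ∈ initials ε l := by
  induction l with
  | nil => exact ⟨[], [], CommEq.refl _, cycWord_nil _, by simp [initials]⟩
  | cons i s ih =>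
    obtain ⟨t, D, hc, hD, hm⟩ := ih hl.tail
    by_cases h : i ∉ s ∧ i + ε ∉ s
    · have hperm := hc.perm
      have hmem : ∀ x, x ∈ t ∨ x ∈ D → x ∈ s := fun x hx => by
        rw [hperm.mem_iff, List.mem_append]; exact hx
      refine ⟨t, i :: D, (CommEq.cons i hc).trans (CommEq.cons_comm (fun k hk => ?_) D), ?_, ?_⟩
      · have h1 : k ≠ i := by rintro rfl; exact h.1 (hmem _ (Or.inl hk))
        have h2 : k ≠ i + ε := by rintro rfl; exact h.2 (hmem _ (Or.inl hk))
        -- Since `i ∉ s`, the letter `i - ε` occurs at most once in `s` and is initial there; its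
        -- only copy therefore lies in `D`, not in `t`.
        have h3 : i ≠ k + ε := by
          intro e
          have hki : k = i - ε := by rw [e]; ring
          have hcount : s.count k ≤ 1 := by
            apply hl.tail.count_le_one _ h.1
            rcases hε with rfl | rfl
            · exact Or.inr hki
            · exact Or.inl (by rw [hki]; ring)
          have hkD : k ∈ D := by
            rw [hm]
            exact mem_initials_of_mem (hmem _ (Or.inl hk)) (by rw [← e]; exact h.1)
          rw [hperm.count_eq, List.count_append] at hcount
          have a1 := List.count_pos_iff.2 hk
          have a2 := List.count_pos_iff.2 hkD
          omega
        rcases hε with rfl | rfl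
        · exact Config.sub_ne_of_ne h2 h3
        · exact Config.sub_ne_of_ne (fun e => h3 (by rw [e]; ring)) (fun e => h2 (by rw [e]; ring))
      · rw [cycWord_cons]
        exact ⟨fun e => h.1 (hmem _ (Or.inr e)), fun e => h.2 (hmem _ (Or.inr e)), hD⟩
      · intro k
        rw [initials_cons_of_mem h, List.mem_cons, mem_insert, hm]
    · refine ⟨i :: t, D, CommEq.cons i hc, hD, fun k => ?_⟩
      rw [hm, initials, if_neg h]

/-- Count the occurrences of the other neighbour `j - ε` in `b`. If there are none, the two `j` can
be brought together and square to zero. If there is one, they can be brought next to it, giving a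
vanishing triple. If there are more, two consecutive ones have no `j` between them, which is a
shorter instance of the claim for `j - ε`. -/
theorem prod_eq_zero_of_not_mem {M : Type} [MonoidWithZero M] (φ : ZMod n → M)
    (hc : ∀ i j, i - j ≠ 1 → i - j ≠ -1 → φ i * φ j = φ j * φ i) (hs : ∀ i, φ i * φ i = 0)
    (hu : ∀ i, φ i * φ (i + 1) * φ i = 0) (hd : ∀ i, φ (i + 1) * φ i * φ (i + 1) = 0)
    (b : List (ZMod n)) (j ε : ZMod n) (hε : ε = 1 ∨ ε = -1) (hj : j ∉ b) (hj' : j + ε ∉ b) :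
    ((j :: (b ++ [j])).map φ).prod = 0 := by
  have comm : ∀ s : List (ZMod n), (∀ k ∈ s, k ≠ j ∧ k ≠ j + ε ∧ k ≠ j - ε) →
      ∀ k ∈ s, k - j ≠ 1 ∧ k - j ≠ -1 := by
    intro s hs k hk
    obtain ⟨_, h2, h3⟩ := hs k hk
    rcases hε with rfl | rfl
    · exact Config.sub_ne_of_ne h2 (fun e => h3 (by rw [e]; ring))
    · exact Config.sub_ne_of_ne (fun e => h3 (by rw [e]; ring)) (fun e => h2 (by rw [e]; ring))
  induction hN : b.length using Nat.strong_induction_on generalizing b j ε with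
  | _ N ih =>
  by_cases hk : j - ε ∈ b
  · obtain ⟨b₁, b₂, rfl, hb₁⟩ := List.eq_append_cons_of_mem hk
    simp only [List.mem_append, List.mem_cons, not_or] at hj hj'
    by_cases hk2 : j - ε ∈ b₂
    · obtain ⟨b₃, b₄, rfl, hb₃⟩ := List.eq_append_cons_of_mem hk2
      simp only [List.mem_append, List.mem_cons, not_or] at hj hj'
      have hcomm : ∀ s : List (ZMod n), (∀ k ∈ s, k ≠ j - ε ∧ k ≠ j - ε + ε ∧ k ≠ j - ε - ε) →
          ∀ k ∈ s, k - (j - ε) ≠ 1 ∧ k - (j - ε) ≠ -1 := by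
        intro s hs k hk
        obtain ⟨_, h2, h3⟩ := hs k hk
        rcases hε with rfl | rfl
        · exact Config.sub_ne_of_ne h2 (fun e => h3 (by rw [e]; ring))
        · exact Config.sub_ne_of_ne (fun e => h3 (by rw [e]; ring)) (fun e => h2 (by rw [e]; ring))
      have := ih b₃.length (by rw [← hN]; simp; omega) b₃ (j - ε) ε hε hb₃
        (by rw [sub_add_cancel]; exact hj.2.2.1) hcomm rfl
      have e : j :: (b₁ ++ (j - ε) :: (b₃ ++ (j - ε) :: b₄) ++ [j]) =
          (j :: b₁) ++ ((j - ε) :: (b₃ ++ [j - ε])) ++ (b₄ ++ [j]) := by simp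
      rw [e, List.map_append, List.map_append, List.prod_append, List.prod_append, this, mul_zero,
        zero_mul]
    · have c1 := CommEq.cons_comm (comm b₁ fun k hk => ⟨fun e => hj.1 (e ▸ hk),
        fun e => hj'.1 (e ▸ hk), fun e => hb₁ (e ▸ hk)⟩) ((j - ε) :: (b₂ ++ [j]))
      have c2 := CommEq.cons_comm (comm b₂ fun k hk => ⟨fun e => hj.2.2 (e ▸ hk),
        fun e => hj'.2.2 (e ▸ hk), fun e => hk2 (e ▸ hk)⟩) []
      have c3 : CommEq (j :: (b₁ ++ (j - ε) :: b₂ ++ [j])) (b₁ ++ j :: (j - ε) :: (j :: b₂)) := by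
        have c4 := (CommEq.refl b₁).append (CommEq.cons j (CommEq.cons (j - ε) c2.symm))
        have c5 := c1.trans c4
        simpa using c5
      rw [c3 M φ hc]
      have hz : φ j * (φ (j - ε) * φ j) = 0 := by
        rcases hε with rfl | rfl
        · have := hd (j - 1)
          rwa [sub_add_cancel, mul_assoc] at this
        · have := hu j
          rwa [mul_assoc, show j + 1 = j - -1 by ring] at this
      have hz' : ∀ x, φ j * (φ (j - ε) * (φ j * x)) = 0 := fun x => by
        rw [← mul_assoc (φ (j - ε)), ← mul_assoc (φ j), hz, zero_mul]
      simp only [List.map_append, List.map_cons, List.prod_append, List.prod_cons, hz', mul_zero]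
  · have c := CommEq.cons_comm (comm b fun k hk' => ⟨fun e => hj (e ▸ hk'),
      fun e => hj' (e ▸ hk'), fun e => hk (e ▸ hk')⟩) [j]
    rw [c M φ hc]
    simp [hs]

end Admissible

/-! ## The action of the affine nilCoxeter algebra on configurations -/

section Action

variable {m n : ℕ} [Fact (1 < n)]

open Config

variable (m) in
open Classical in
/-- The operator of a letter on the free module on configurations. -/
def stepOp (i : ZMod n) : Module.End ℤ (Config m n →₀ ℤ) :=
  Finsupp.linearCombination ℤ fun f =>
    if h : ∃ g, Step i f g then Finsupp.single h.choose 1 else 0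

theorem stepOp_single {i : ZMod n} {f g : Config m n} (h : Step i f g) :
    stepOp m i (Finsupp.single f 1) = Finsupp.single g 1 := by
  have hex : ∃ g, Step i f g := ⟨g, h⟩
  rw [stepOp, Finsupp.linearCombination_single, one_smul, dif_pos hex,
    hex.choose_spec.right_unique h]

theorem stepOp_single_eq_zero {i : ZMod n} {f : Config m n} (h : ¬ ∃ g, Step i f g) :
    stepOp m i (Finsupp.single f 1) = 0 := by
  rw [stepOp, Finsupp.linearCombination_single, one_smul, dif_neg h]

theorem prod_stepOp_single {l : List (ZMod n)} {f g : Config m n} (h : Path l f g) :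
    (l.map (stepOp m)).prod (Finsupp.single f 1) = Finsupp.single g 1 := by
  induction l generalizing g with
  | nil => rw [path_nil.1 h]; rfl
  | cons i t ih =>
    obtain ⟨k, hk, hs⟩ := h
    rw [List.map_cons, List.prod_cons, Module.End.mul_apply, ih hk, stepOp_single hs]

theorem prod_stepOp_single_eq_zero {l : List (ZMod n)} {f : Config m n}
    (h : ¬ ∃ g, Path l f g) : (l.map (stepOp m)).prod (Finsupp.single f 1) = 0 := by
  induction l with
  | nil => exact absurd ⟨f, rfl⟩ h
  | cons i t ih =>
    rw [List.map_cons, List.prod_cons, Module.End.mul_apply]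
    by_cases ht : ∃ k, Path t f k
    · obtain ⟨k, hk⟩ := ht
      rw [prod_stepOp_single hk, stepOp_single_eq_zero]
      rintro ⟨g, hg⟩
      exact h ⟨g, k, hk, hg⟩
    · rw [ih ht, map_zero]

theorem end_ext {a b : Module.End ℤ (Config m n →₀ ℤ)}
    (h : ∀ f, a (Finsupp.single f 1) = b (Finsupp.single f 1)) : a = b :=
  Finsupp.lhom_ext' fun f => LinearMap.ext_ring (h f)

theorem prod_stepOp_eq_zero {l : List (ZMod n)} (h : ∀ f g : Config m n, ¬ Path l f g) :
    (l.map (stepOp m)).prod = 0 :=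
  end_ext fun f => prod_stepOp_single_eq_zero fun ⟨g, hg⟩ => h f g hg

variable [NeZero m]

theorem prod_stepOp_congr {l l' : List (ZMod n)} (h : CommEq l l') :
    (l.map (stepOp m)).prod = (l'.map (stepOp m)).prod := by
  refine end_ext fun f => ?_
  by_cases hf : ∃ g, Path l f g
  · obtain ⟨g, hg⟩ := hf
    rw [prod_stepOp_single hg, prod_stepOp_single (hg.of_commEq h)]
  · rw [prod_stepOp_single_eq_zero hf, prod_stepOp_single_eq_zero]
    rintro ⟨g, hg⟩
    exact hf ⟨g, hg.of_commEq h.symm⟩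

theorem stepOp_rel {a b : FreeAlgebra ℤ (ZMod n)} (h : NilCoxeterRel n a b) :
    FreeAlgebra.lift ℤ (stepOp m) a = FreeAlgebra.lift ℤ (stepOp m) b := by
  cases h with
  | sq i =>
    have := prod_stepOp_eq_zero (m := m) (l := [i, i]) ?_
    · simpa using this
    · rintro f g ⟨k, ⟨k', _, h1⟩, h2⟩
      exact h1.not_occ h2.1
  -- Both sides act as zero: after `i` and then `i + 1` class `i` is empty, and after `i + 1` and
  -- then `i` class `i + 2` is full.
  | braid hn i =>
    have e1 := prod_stepOp_eq_zero (m := m) (l := [i, i + 1, i]) ?_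
    · have e2 := prod_stepOp_eq_zero (m := m) (l := [i + 1, i, i + 1]) ?_
      · simp only [List.map_cons, List.map_nil, List.prod_cons, List.prod_nil, mul_one] at e1 e2
        simp only [map_mul, FreeAlgebra.lift_ι_apply, mul_assoc, e1, e2]
      · rintro f g ⟨k, ⟨k', ⟨k'', _, h1⟩, h2⟩, h3⟩
        apply h3.2.1
        rw [h2.occ_iff]
        right
        exact ⟨add_two_ne hn i, (h1.occ_iff _).2 (Or.inl rfl)⟩
    · rintro f g ⟨k, ⟨k', ⟨k'', _, h1⟩, h2⟩, h3⟩
      have := h3.1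
      rw [h2.occ_iff] at this
      rcases this with h | h
      · exact add_two_ne hn i h.symm
      · exact h1.not_occ h.2
  | comm i j h₁ h₂ =>
    have := prod_stepOp_congr (m := m) (CommEq.swap h₁ h₂ [])
    simpa using this

variable (m n) in
/-- The action of the affine nilCoxeter algebra on the free module on configurations. -/
def action : NilCoxeter n →ₐ[ℤ] Module.End ℤ (Config m n →₀ ℤ) :=
  RingQuot.liftAlgHom ℤ ⟨FreeAlgebra.lift ℤ (stepOp m), fun _ _ => stepOp_rel⟩

theorem action_nilGen (i : ZMod n) : action m n (nilGen i) = stepOp m i := by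
  rw [action, nilGen, RingQuot.liftAlgHom_mkAlgHom_apply, FreeAlgebra.lift_ι_apply]

theorem action_nilWord (l : List (ZMod n)) :
    action m n (nilWord l) = (l.map (stepOp m)).prod := by
  rw [nilWord, map_list_prod, List.map_map]
  congr 1
  exact List.map_congr_left fun i _ => action_nilGen i

theorem action_nilWord_single {l : List (ZMod n)} {f g : Config m n} (h : Path l f g) :
    action m n (nilWord l) (Finsupp.single f 1) = Finsupp.single g 1 := by
  rw [action_nilWord, prod_stepOp_single h]

theorem action_nilWord_single_eq_zero {l : List (ZMod n)} {f : Config m n}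
    (h : ¬ ∃ g, Path l f g) : action m n (nilWord l) (Finsupp.single f 1) = 0 := by
  rw [action_nilWord, prod_stepOp_single_eq_zero h]

open Classical in
theorem action_nilWord_single_apply (l : List (ZMod n)) (f g : Config m n) :
    action m n (nilWord l) (Finsupp.single f 1) g = if Path l f g then 1 else 0 := by
  by_cases h : ∃ g', Path l f g'
  · obtain ⟨g', hg'⟩ := h
    rw [action_nilWord_single hg', Finsupp.single_apply]
    congr 1
    exact propext ⟨fun e => e ▸ hg', fun e => hg'.right_unique e⟩
  · rw [action_nilWord_single_eq_zero h, if_neg fun e => h ⟨g, e⟩]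
    rfl

end Action

/-! ## Faithfulness on the quotient algebra -/

section Faithful

variable {m n : ℕ} [Fact (1 < n)]

theorem nilGen_comm {i j : ZMod n} (h₁ : i - j ≠ 1) (h₂ : i - j ≠ -1) :
    nilGen i * nilGen j = nilGen j * nilGen i := by
  have := RingQuot.mkAlgHom_rel ℤ (NilCoxeterRel.comm i j h₁ h₂)
  rwa [map_mul, map_mul] at this

theorem nilGen_mul_self (i : ZMod n) : nilGen i * nilGen i = 0 := by
  have := RingQuot.mkAlgHom_rel ℤ (NilCoxeterRel.sq i)
  rwa [map_mul, map_zero] at this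

theorem CommEq.nilWord_eq {l l' : List (ZMod n)} (h : CommEq l l') : nilWord l = nilWord l' :=
  h _ nilGen fun _ _ => nilGen_comm

theorem nilWord_append (l l' : List (ZMod n)) : nilWord (l ++ l') = nilWord l * nilWord l' := by
  simp [nilWord]

variable [NeZero n]

theorem proj_eq_zero_of_rel {a : NilCoxeter n} (h : QuotRel m n a 0) : proj m n a = 0 := by
  rw [proj, RingQuot.mkAlgHom_rel ℤ h, map_zero]

theorem proj_nilWord_eq_zero_of_not_admissible {l : List (ZMod n)} (h : ¬ Admissible l) :
    proj m n (nilWord l) = 0 := by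
  unfold Admissible at h
  push Not at h
  obtain ⟨a, j, b, c, rfl, hj, hb⟩ := h
  obtain ⟨ε, hε, hb'⟩ : ∃ ε : ZMod n, (ε = 1 ∨ ε = -1) ∧ j + ε ∉ b := by
    by_cases h1 : j + 1 ∈ b
    · exact ⟨-1, Or.inr rfl, by rw [← sub_eq_add_neg]; exact hb h1⟩
    · exact ⟨1, Or.inl rfl, h1⟩
  have key := prod_eq_zero_of_not_mem (fun i => proj m n (nilGen i))
    (fun i j h₁ h₂ => by rw [← map_mul, nilGen_comm h₁ h₂, map_mul])
    (fun i => by rw [← map_mul, nilGen_mul_self, map_zero])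
    (fun i => by rw [← map_mul, ← map_mul]; exact proj_eq_zero_of_rel (QuotRel.up i))
    (fun i => by rw [← map_mul, ← map_mul]; exact proj_eq_zero_of_rel (QuotRel.down i))
    b j ε hε hj hb'
  have e : ∀ l : List (ZMod n), proj m n (nilWord l) =
      (l.map fun i => proj m n (nilGen i)).prod := by
    intro l
    rw [nilWord, map_list_prod, List.map_map]
    rfl
  rw [show a ++ j :: (b ++ j :: c) = a ++ ((j :: (b ++ [j])) ++ c) by simp, nilWord_append,
    nilWord_append, map_mul, map_mul, e (j :: (b ++ [j])), key, zero_mul, mul_zero]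

/-- A word which does not vanish in the quotient algebra is applicable to some configuration. -/
theorem proj_nilWord_eq_zero_or_exists_path [NeZero m] (hmn : m ≤ n) (l : List (ZMod n)) :
    proj m n (nilWord l) = 0 ∨ ∃ f g : Config m n, Config.Path l f g := by
  classical
  by_cases hl : Admissible l
  swap
  · exact Or.inl (proj_nilWord_eq_zero_of_not_admissible hl)
  obtain ⟨t, D, hc, hD, hm⟩ := hl.exists_commEq_append (Or.inl rfl)
  have hDl : D.toFinset = initials 1 l := by ext i; simp [hm]
  -- Too many initial letters collect at the right end into a cyclically decreasing factor that is
  -- zero in the quotient; the increasing case below is analogous.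
  by_cases h1 : n - m < #(initials 1 l)
  · left
    rw [hc.nilWord_eq, nilWord_append, map_mul, hD.commEq_cycDecWord.nilWord_eq, hDl]
    have := proj_eq_zero_of_rel
      (QuotRel.dec (m := m) (initials 1 l) (hDl ▸ hD.toFinset_ne_univ one_ne_zero) h1)
    rw [nilD] at this
    rw [this, mul_zero]
  obtain ⟨t', D', hc', hD', hm'⟩ := hl.exists_commEq_append (Or.inr rfl)
  have hDl' : D'.toFinset = initials (-1) l := by ext i; simp [hm']
  by_cases h2 : m < #(initials (-1) l)
  · left
    rw [hc'.nilWord_eq, nilWord_append, map_mul, hD'.commEq_cycDecWord_reverse.nilWord_eq, hDl']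
    have := proj_eq_zero_of_rel (QuotRel.inc (m := m) (initials (-1) l)
      (hDl' ▸ hD'.toFinset_ne_univ (neg_ne_zero.2 one_ne_zero)) h2)
    rw [nilU] at this
    rw [this, mul_zero]
  right
  have hcard : #((initials 1 l).image (· + 1)) = #(initials 1 l) :=
    card_image_of_injective _ (add_left_injective 1)
  have hdisj : initials (-1) l ⊆ ((initials 1 l).image (· + 1))ᶜ := by
    intro x hx
    rw [mem_compl, mem_image]
    rintro ⟨y, hy, rfl⟩
    exact disjoint_initials hy hx
  -- At most `m` sites have to be occupied and at most `n - m` others have to be empty, so `m`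
  -- particles can be placed accordingly.
  obtain ⟨S, hS1, hS2, hS3⟩ := exists_subsuperset_card_eq (n := m) hdisj (not_lt.1 h2)
    (by rw [card_compl, hcard, ZMod.card]; omega)
  obtain ⟨f, hf⟩ := Config.exists_occ_iff S hS3
  refine ⟨f, Config.exists_path hl (fun j hj => ?_) fun j hj => (hf _).2 (hS1 hj)⟩
  rw [hf]
  intro h
  exact mem_compl.1 (hS2 h) (mem_image_of_mem _ hj)

theorem mem_span_nilWord (a : NilCoxeter n) : a ∈ Submodule.span ℤ (Set.range (nilWord (n := n))) := by
  obtain ⟨a, rfl⟩ := RingQuot.mkAlgHom_surjective ℤ (NilCoxeterRel n) a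
  have hmul : ∀ x ∈ Submodule.span ℤ (Set.range (nilWord (n := n))),
      ∀ y ∈ Submodule.span ℤ (Set.range (nilWord (n := n))),
      x * y ∈ Submodule.span ℤ (Set.range (nilWord (n := n))) := by
    intro x hx y hy
    induction hx, hy using Submodule.span_induction₂ with
    | mem_mem x y hx hy =>
      obtain ⟨l, rfl⟩ := hx
      obtain ⟨l', rfl⟩ := hy
      exact Submodule.subset_span ⟨l ++ l', nilWord_append l l'⟩
    | zero_left y hy => rw [zero_mul]; exact Submodule.zero_mem _
    | zero_right x hx => rw [mul_zero]; exact Submodule.zero_mem _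
    | add_left x y z _ _ _ h₁ h₂ => rw [add_mul]; exact Submodule.add_mem _ h₁ h₂
    | add_right x y z _ _ _ h₁ h₂ => rw [mul_add]; exact Submodule.add_mem _ h₁ h₂
    | smul_left r x y _ _ h => rw [smul_mul_assoc]; exact Submodule.smul_mem _ r h
    | smul_right r x y _ _ h => rw [mul_smul_comm]; exact Submodule.smul_mem _ r h
  induction a using FreeAlgebra.induction with
  | grade0 r =>
    rw [AlgHom.commutes, Algebra.algebraMap_eq_smul_one]
    exact Submodule.smul_mem _ _ (Submodule.subset_span ⟨[], by simp [nilWord]⟩)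
  | grade1 i => exact Submodule.subset_span ⟨[i], by simp [nilWord, nilGen]⟩
  | mul a b ha hb => rw [map_mul]; exact hmul _ ha _ hb
  | add a b ha hb => rw [map_add]; exact Submodule.add_mem _ ha hb

/-- An element of the affine nilCoxeter algebra acting as zero on configurations vanishes in the
quotient algebra. -/
theorem proj_eq_zero_of_action_eq_zero [NeZero m] (hmn : m ≤ n) {a : NilCoxeter n}
    (ha : action m n a = 0) : proj m n a = 0 := by
  classical
  obtain ⟨c, rfl⟩ := Finsupp.mem_span_range_iff_exists_finsupp.1 (mem_span_nilWord a)
  rw [Finsupp.sum] at ha ⊢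
  -- The sum is organized by commutation classes of words, on each of which `nilWord` is constant;
  -- each class is shown to contribute zero.
  rw [map_sum, ← sum_fiberwise_of_maps_to (t := c.support.image (Quotient.mk (CommEq.setoid n)))
    (fun l hl => mem_image_of_mem _ hl)]
  refine sum_eq_zero fun κ _ => ?_
  induction κ using Quotient.inductionOn with
  | _ l₀ =>
  have hcls : ∀ l, (Quotient.mk (CommEq.setoid n) l = Quotient.mk (CommEq.setoid n) l₀) ↔
      CommEq l l₀ := fun l => Quotient.eq
  have e : ∀ l ∈ c.support.filter fun l => Quotient.mk (CommEq.setoid n) l =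
      Quotient.mk (CommEq.setoid n) l₀, proj m n (c l • nilWord l) = c l • proj m n (nilWord l₀) := by
    intro l hl
    rw [map_smul, CommEq.nilWord_eq ((hcls l).1 (mem_filter.1 hl).2)]
  rw [sum_congr rfl e]
  refine (sum_smul (R := ℤ)).symm.trans ?_
  -- If the class can be executed from `f` to `g`, it consists of all words doing so. The
  -- coefficient of `g` in the image of `f` is then the sum of the coefficients over the class, and
  -- it is zero by assumption.
  rcases proj_nilWord_eq_zero_or_exists_path (m := m) hmn l₀ with h | ⟨f, g, h⟩
  · rw [h, smul_zero]
  have h0 := congrArg (fun T : Module.End ℤ (Config m n →₀ ℤ) => T (Finsupp.single f 1) g) ha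
  have hz : ∀ (k : ℤ) (l : List (ZMod n)), action m n (k • nilWord l) (Finsupp.single f 1) g =
      if Config.Path l f g then k else 0 := by
    intro k l
    have : action m n (k • nilWord l) = k • action m n (nilWord l) := map_zsmul (action m n) k _
    rw [this, LinearMap.smul_apply, Finsupp.smul_apply, action_nilWord_single_apply, smul_eq_mul,
      mul_ite, mul_one, mul_zero]
  simp only [map_sum, LinearMap.sum_apply, Finsupp.finsetSum_apply, hz, LinearMap.zero_apply,
    Finsupp.zero_apply] at h0
  rw [← sum_filter] at h0
  have : ∀ l, Config.Path l f g ↔ Quotient.mk (CommEq.setoid n) l =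
      Quotient.mk (CommEq.setoid n) l₀ := fun l => by
    rw [hcls]
    exact ⟨fun e => e.commEq h, fun e => h.of_commEq e.symm⟩
  simp only [this] at h0
  rw [h0, zero_smul]

end Faithful

/-! ## Interlacing configurations and commutativity -/

namespace Config

variable {m n : ℕ}

/-- `f p ≤ g p < f (p + 1)` for all `p`. -/
def Interlaces (f g : Config m n) : Prop := ∀ p, f p ≤ g p ∧ g p < f (p + 1)

variable [Fact (1 < n)]

theorem Path.mem_of_ne {t : List (ZMod n)} {f h : Config m n} (hp : Path t f h) {p : ℤ}
    (hne : h p ≠ f p) : (f p : ZMod n) ∈ t := by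
  induction t generalizing h with
  | nil => rw [path_nil.1 hp] at hne; exact absurd rfl hne
  | cons i t ih =>
    obtain ⟨k, hk, hs⟩ := hp
    by_cases h1 : k p = f p
    · by_cases h2 : (k p : ZMod n) = i
      · rw [← h1, h2]; simp
      · exact absurd ((hs.apply_of_ne h2).trans h1) hne
    · exact List.mem_cons_of_mem _ (ih hk h1)

/-- A particle can enter the starting place of the next one, in class `i + 1`, only after the letter
`i + 1` has vacated it. The letter `i` would then stand to the left of `i + 1`, against the cyclic
order. -/
theorem Path.interlaces {l : List (ZMod n)} {f g : Config m n} (hl : CycWord 1 l)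
    (h : Path l f g) : Interlaces f g := by
  refine fun p => ⟨h.le p, ?_⟩
  induction l generalizing g p with
  | nil => rw [path_nil.1 h]; exact f.mono (by omega)
  | cons i t ih =>
    obtain ⟨k, hk, hs⟩ := h
    rw [cycWord_cons] at hl
    have h1 := ih hl.2.2 hk p
    by_cases h2 : (k p : ZMod n) = i
    · rw [hs.apply_of_eq h2]
      have : k p + 1 ≠ f (p + 1) := by
        intro e
        have hf : (f (p + 1) : ZMod n) = i + 1 := by rw [← e]; push_cast; rw [h2]
        have hne : k (p + 1) ≠ f (p + 1) := fun e' => hs.2.1 ⟨p + 1, by rw [e', hf]⟩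
        exact hl.2.1 (hf ▸ hk.mem_of_ne hne)
      omega
    · rw [hs.apply_of_ne h2]; exact h1

variable [NeZero m]

theorem weight_le {f g : Config m n} (h : ∀ p, f p ≤ g p) : weight m f ≤ weight m g :=
  sum_le_sum fun p _ => h p

theorem eq_of_weight_eq {f g : Config m n} (h : ∀ p, f p ≤ g p) (hw : weight m g = weight m f) :
    g = f := by
  have hm : (0 : ℤ) < m := by exact_mod_cast Nat.pos_of_ne_zero (NeZero.ne m)
  have h1 := (sum_eq_sum_iff_of_le (s := range m) fun p _ => h (p : ℤ)).1 hw.symm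
  ext p
  have h2 := h1 (p % m).toNat (by
    rw [mem_range]; have := Int.emod_nonneg p hm.ne'; have := Int.emod_lt_of_pos p hm; omega)
  rw [Int.toNat_of_nonneg (Int.emod_nonneg p hm.ne')] at h2
  rw [← Int.emod_add_mul_ediv p m, f.isPeriodicMap.add_mul, g.isPeriodicMap.add_mul, h2]

/-- Interlacing configurations are connected by a cyclically decreasing word. -/
theorem Interlaces.exists_path {f g : Config m n} (h : Interlaces f g) :
    ∃ D, CycWord 1 D ∧ Path D f g ∧
      ∀ i ∈ D, ∃ p y : ℤ, f p ≤ y ∧ y < g p ∧ (y : ZMod n) = i := by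
  induction hN : (weight m g - weight m f).toNat generalizing g with
  | zero =>
    have := weight_le (f := f) (g := g) fun p => (h p).1
    obtain rfl := eq_of_weight_eq (f := f) (g := g) (fun p => (h p).1) (by omega)
    exact ⟨[], cycWord_nil _, rfl, by simp⟩
  | succ N ih =>
    obtain ⟨p₀, hp₀⟩ : ∃ p, f p < g p := by
      by_contra hcon
      push Not at hcon
      have := weight_le hcon
      omega
    set i : ZMod n := ((g p₀ - 1 : ℤ) : ZMod n) with hi
    have hi1 : (g p₀ : ZMod n) = i + 1 := by rw [hi]; push_cast; ring
    -- The last hop of `p₀` can be undone: all earlier particles are still below `f p₀`, which is at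
    -- most `g p₀ - 1`.
    have hno : ¬ Occ g i := by
      rintro ⟨q, hq⟩
      rw [hi, ZMod.intCast_eq_intCast_iff_dvd_sub] at hq
      obtain ⟨k, hk⟩ := hq
      have e : g (q + m * k) = g p₀ - 1 := by rw [g.isPeriodicMap.add_mul]; linarith
      have hlt : q + m * k < p₀ := g.mono.lt_iff_lt.1 (by omega)
      have h1 := (h (q + m * k)).2
      have h2 := f.mono.monotone (show q + m * k + 1 ≤ p₀ by omega)
      omega
    obtain ⟨h', hs⟩ := exists_step_left ⟨p₀, hi1⟩ hno
    have hh : ∀ p, (h' p : ZMod n) = i → f p ≤ h' p := by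
      intro p hp
      have h1 := hs.apply_of_eq hp
      obtain ⟨k, rfl⟩ := g.isPeriodicMap.exists_of_cast_eq (p := p₀) (q := p) (by
        rw [hi1, h1]; push_cast; rw [hp])
      rw [g.isPeriodicMap.add_mul] at h1
      rw [f.isPeriodicMap.add_mul]
      omega
    have hp₀' : h' p₀ = g p₀ - 1 := by
      have := hs.apply p₀
      split_ifs at this with h1
      · omega
      · exact absurd ⟨p₀, by rw [← add_zero (h' p₀), ← this, hi1]⟩ hs.2.1
    have hint : Interlaces f h' := by
      intro p
      refine ⟨?_, (hs.le p).trans_lt (h p).2⟩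
      by_cases hp : (h' p : ZMod n) = i
      · exact hh p hp
      · rw [← hs.apply_of_ne hp]; exact (h p).1
    obtain ⟨D, hD, hpath, hmem⟩ := ih hint (by have := hs.weight; omega)
    have shift : ∀ (j x : ℤ), (j : ZMod n) ∈ D → ∃ q, f q ≤ j ∧ j < h' q := by
      intro j _ hj
      obtain ⟨q, y, hy1, hy2, hy3⟩ := hmem _ hj
      rw [ZMod.intCast_eq_intCast_iff_dvd_sub] at hy3
      obtain ⟨k, hk⟩ := hy3
      refine ⟨q + m * k, ?_, ?_⟩
      · rw [f.isPeriodicMap.add_mul]; linarith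
      · rw [h'.isPeriodicMap.add_mul]; linarith
    -- The clause on crossed places carries the induction: no particle leaves `g p₀ - 1` or `g p₀`
    -- between `f` and `h'`, so neither residue is a letter of `D`.
    refine ⟨i :: D, cycWord_cons.2 ⟨fun hiD => ?_, fun hiD => ?_, hD⟩, ⟨h', hpath, hs⟩, ?_⟩
    · rw [hi] at hiD
      obtain ⟨q, hq1, hq2⟩ := shift _ 0 hiD
      rcases lt_trichotomy q p₀ with hlt | rfl | hlt
      · have h1 := (hint q).2
        have h2 := f.mono.monotone (show q + 1 ≤ p₀ by omega)
        omega
      · omega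
      · have h1 := (h p₀).2
        have h2 := f.mono.monotone (show p₀ + 1 ≤ q by omega)
        omega
    · rw [← hi1] at hiD
      obtain ⟨q, hq1, hq2⟩ := shift _ 0 hiD
      rcases le_or_gt q p₀ with hle | hlt
      · have := h'.mono.monotone hle
        omega
      · have h1 := (h p₀).2
        have h2 := f.mono.monotone (show p₀ + 1 ≤ q by omega)
        omega
    · intro j hj
      rw [List.mem_cons] at hj
      rcases hj with rfl | hj
      · exact ⟨p₀, g p₀ - 1, by omega, by omega, rfl⟩
      · obtain ⟨p, y, hy1, hy2, hy3⟩ := hmem j hj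
        exact ⟨p, y, hy1, hy2.trans_le (hs.le p), hy3⟩

/-- The Bender–Knuth reflection of `g` between `f` and `z`. -/
def benderKnuth (f g z : Config m n) (h₁ : Interlaces f g) (h₂ : Interlaces g z) : Config m n where
  -- Given `f` and `z`, the two interlacing conditions confine each `g p` to an interval independent
  -- of the other values; `g p` is reflected in its midpoint.
  toFun p := max (f p) (z (p - 1) + 1) + min (z p) (f (p + 1) - 1) - g p
  mono := by
    apply strictMono_int_of_lt_succ
    intro p
    have a1 := h₁ p
    have a2 := h₁ (p + 1)
    have a3 := h₂ p
    have a4 := h₂ (p + 1)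
    have a5 := h₂ (p - 1)
    simp only [sub_add_cancel, add_sub_cancel_right] at *
    omega
  add p := by
    have e : p + (m : ℤ) - 1 = (p - 1) + m := by ring
    have e' : p + (m : ℤ) + 1 = (p + 1) + m := by ring
    rw [e, e', f.add, z.add, z.add, f.add, g.add]
    omega

theorem benderKnuth_apply {f g z : Config m n} (h₁ : Interlaces f g) (h₂ : Interlaces g z)
    (p : ℤ) : benderKnuth f g z h₁ h₂ p =
      max (f p) (z (p - 1) + 1) + min (z p) (f (p + 1) - 1) - g p := rfl

theorem interlaces_benderKnuth {f g z : Config m n} (h₁ : Interlaces f g) (h₂ : Interlaces g z) :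
    Interlaces f (benderKnuth f g z h₁ h₂) := by
  intro p
  rw [benderKnuth_apply]
  have a1 := h₁ p
  have a3 := h₂ p
  have a5 := h₂ (p - 1)
  simp only [sub_add_cancel] at *
  omega

theorem benderKnuth_interlaces {f g z : Config m n} (h₁ : Interlaces f g) (h₂ : Interlaces g z) :
    Interlaces (benderKnuth f g z h₁ h₂) z := by
  intro p
  rw [benderKnuth_apply, benderKnuth_apply]
  have a1 := h₁ p
  have a2 := h₁ (p + 1)
  have a3 := h₂ p
  have a4 := h₂ (p + 1)
  have a5 := h₂ (p - 1)
  simp only [sub_add_cancel, add_sub_cancel_right] at *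
  omega

theorem weight_benderKnuth {f g z : Config m n} (h₁ : Interlaces f g) (h₂ : Interlaces g z) :
    weight m (benderKnuth f g z h₁ h₂) = weight m f + weight m z - weight m g := by
  have tele : ∀ F : ℤ → ℤ, (∀ p, F (p + m) = F p + n) →
      ∑ p ∈ range m, F ((p : ℤ) + 1) = ∑ p ∈ range m, F p + n := by
    intro F hF
    have h1 := sum_range_succ' (fun k : ℕ => F k) m
    have h2 := sum_range_succ (fun k : ℕ => F k) m
    have h3 := hF 0
    push_cast at h1 h2
    rw [zero_add] at h3
    linarith
  have t1 := tele (fun p => z (p - 1)) fun p => by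
    rw [show p + (m : ℤ) - 1 = p - 1 + m by ring, z.add]
  have t2 := tele (fun p => min (z (p - 1) + 1) (f p)) fun p => by
    rw [show p + (m : ℤ) - 1 = p - 1 + m by ring, z.add, f.add]
    omega
  simp only [add_sub_cancel_right] at t1 t2
  -- Writing the maximum as sum minus minimum leaves the same minimum at `p` and at `p + 1`. Over a
  -- period these sums differ by `n`, which makes up for `z (p - 1)` in place of `z p`.
  have e : ∀ p : ℤ, benderKnuth f g z h₁ h₂ p + g p + min (z (p - 1) + 1) (f p) + 1 =
      f p + (z (p - 1) + 1) + min (z p + 1) (f (p + 1)) := by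
    intro p
    rw [benderKnuth_apply]
    omega
  have e' := sum_congr (rfl : range m = range m) fun (p : ℕ) _ => e p
  simp only [sum_add_distrib] at e'
  simp only [weight]
  linarith

/-- The covering relation of the operator `𝐡_r`. -/
def Covers (r : ℕ) (f g : Config m n) : Prop := Interlaces f g ∧ weight m g = weight m f + r

theorem card_covers_comm (r s : ℕ) (f z : Config m n) :
    Nat.card {g // Covers s f g ∧ Covers r g z} = Nat.card {g // Covers r f g ∧ Covers s g z} := by
  have key : ∀ r s : ℕ, ∀ g, ∀ h : Covers s f g ∧ Covers r g z,
      Covers r f (benderKnuth f g z h.1.1 h.2.1) ∧ Covers s (benderKnuth f g z h.1.1 h.2.1) z := by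
    intro r s g h
    have h1 := h.1.2
    have h2 := h.2.2
    refine ⟨⟨interlaces_benderKnuth _ _, ?_⟩, benderKnuth_interlaces _ _, ?_⟩ <;>
      rw [weight_benderKnuth] <;> linarith
  have invol : ∀ g h₁ h₂ h₁' h₂', benderKnuth f (benderKnuth f g z h₁ h₂) z h₁' h₂' = g := by
    intro g h₁ h₂ h₁' h₂'
    ext p
    rw [benderKnuth_apply, benderKnuth_apply]
    ring
  exact Nat.card_congr
    { toFun := fun g => ⟨_, key r s g.1 g.2⟩
      invFun := fun g => ⟨_, key s r g.1 g.2⟩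
      left_inv := fun g => Subtype.ext (invol g.1 g.2.1.1 g.2.2.1 (key _ _ g.1 g.2).1.1 (key _ _ g.1 g.2).2.1)
      right_inv := fun g => Subtype.ext (invol g.1 g.2.1.1 g.2.2.1 (key _ _ g.1 g.2).1.1 (key _ _ g.1 g.2).2.1) }

end Config

/-! ### Matrix entries and commutativity of the operators of `hElt` -/

section Commute

variable {m n : ℕ} [Fact (1 < n)] [NeZero m] [NeZero n]

open Config

-- An interlacing pair is joined by a cyclically decreasing word, and its set of letters is unique
-- because all words between two configurations are commutation equivalent. So at most one summand
-- contributes.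
open Classical in
theorem action_hElt_single_apply (r : ℕ) (f g : Config m n) :
    action m n (hElt r) (Finsupp.single f 1) g = if Covers r f g then 1 else 0 := by
  simp only [hElt, map_sum, LinearMap.sum_apply, Finsupp.finsetSum_apply, nilD,
    action_nilWord_single_apply]
  split_ifs with h
  · obtain ⟨D, hD, hpath, -⟩ := h.1.exists_path
    have hne := hD.toFinset_ne_univ one_ne_zero
    have hp := hpath.of_commEq hD.commEq_cycDecWord
    have hcard : #D.toFinset = r := by
      have h1 := hp.weight
      rw [h.2, length_cycDecWord hne] at h1
      omega
    rw [sum_eq_single D.toFinset, if_pos hp]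
    · intro J hJ hJD
      refine if_neg fun hJp => hJD ?_
      have := (hJp.commEq hp).perm
      ext i
      rw [← mem_cycDecWord (mem_filter.1 hJ).2.1, this.mem_iff, mem_cycDecWord hne]
    · intro hcon
      exact absurd (mem_filter.2 ⟨mem_univ _, hne, hcard⟩) hcon
  · refine sum_eq_zero fun J hJ => if_neg fun hp => h ?_
    rw [mem_filter] at hJ
    refine ⟨hp.interlaces (cycWord_cycDecWord hJ.2.1), ?_⟩
    rw [hp.weight, length_cycDecWord hJ.2.1, hJ.2.2]

theorem end_apply_eq_sum (T : Module.End ℤ (Config m n →₀ ℤ)) (v : Config m n →₀ ℤ)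
    (z : Config m n) : T v z = ∑ g ∈ v.support, v g * T (Finsupp.single g 1) z := by
  conv_lhs => rw [← Finsupp.sum_single v, Finsupp.sum]
  rw [map_sum, Finsupp.finsetSum_apply]
  refine sum_congr rfl fun g _ => ?_
  rw [← Finsupp.smul_single_one, map_smul, Finsupp.smul_apply, smul_eq_mul]

theorem action_hElt_mul_single_apply (r s : ℕ) (f z : Config m n) :
    action m n (hElt r * hElt s) (Finsupp.single f 1) z =
      Nat.card {g // Covers s f g ∧ Covers r g z} := by
  classical
  rw [map_mul, Module.End.mul_apply, end_apply_eq_sum]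
  simp only [action_hElt_single_apply, mul_ite, mul_one, mul_zero, ← ite_and]
  rw [← sum_filter, sum_const, nsmul_one]
  congr 1
  symm
  apply Nat.subtype_card
  intro g
  rw [mem_filter, Finsupp.mem_support_iff, action_hElt_single_apply]
  simp only [ne_eq, ite_eq_right_iff, one_ne_zero, imp_false, not_not]
  tauto

theorem action_hElt_comm (r s : ℕ) :
    Commute (action m n (hElt r)) (action m n (hElt s)) := by
  rw [commute_iff_eq, ← map_mul, ← map_mul]
  refine end_ext fun f => Finsupp.ext fun z => ?_
  rw [action_hElt_mul_single_apply, action_hElt_mul_single_apply, card_covers_comm]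

variable (n) in
/-- The subalgebra of the affine nilCoxeter algebra generated by the elements `𝐡_r`. -/
def fominStanley : Subalgebra ℤ (NilCoxeter n) := Algebra.adjoin ℤ (Set.range hElt)

theorem action_comm {a b : NilCoxeter n} (ha : a ∈ fominStanley n) (hb : b ∈ fominStanley n) :
    Commute (action m n a) (action m n b) := by
  induction ha, hb using Algebra.adjoin_induction₂ with
  | mem_mem x y hx hy =>
    obtain ⟨r, rfl⟩ := hx
    obtain ⟨s, rfl⟩ := hy
    exact action_hElt_comm r s
  | algebraMap_both r s =>
    rw [AlgHom.commutes, AlgHom.commutes]; exact Algebra.commute_algebraMap_left _ _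
  | algebraMap_left r x _ => rw [AlgHom.commutes]; exact Algebra.commute_algebraMap_left _ _
  | algebraMap_right r x _ => rw [AlgHom.commutes]; exact Algebra.commute_algebraMap_right _ _
  | add_left x y z _ _ _ h₁ h₂ => rw [map_add]; exact h₁.add_left h₂
  | add_right x y z _ _ _ h₁ h₂ => rw [map_add]; exact h₁.add_right h₂
  | mul_left x y z _ _ _ h₁ h₂ => rw [map_mul]; exact h₁.mul_left h₂
  | mul_right x y z _ _ _ h₁ h₂ => rw [map_mul]; exact h₁.mul_right h₂

theorem toNil_mem_fominStanley (f : SymmH n) : toNil f ∈ fominStanley n := by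
  refine sum_mem fun e _ => zsmul_mem (list_prod_mem fun x hx => ?_) _
  rw [List.mem_map] at hx
  obtain ⟨r, _, rfl⟩ := hx
  exact Algebra.subset_adjoin ⟨r, rfl⟩

end Commute

/-! ## Factorizations into cyclically decreasing elements -/

section Factorization

variable {n : ℕ} [Fact (1 < n)] [NeZero n]

theorem CycWord.mem_initials {l : List (ZMod n)} (h : CycWord 1 l) {i : ZMod n} (hi : i ∈ l) :
    i ∈ initials 1 l := by
  induction l with
  | nil => simp at hi
  | cons k t ih =>
    rw [cycWord_cons] at h
    rw [initials_cons_of_mem ⟨h.1, h.2.1⟩, mem_insert]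
    rw [List.mem_cons] at hi
    exact hi.imp_right (ih h.2.2)

theorem card_lt {J : Finset (ZMod n)} (hJ : J ≠ univ) : #J < n := by
  have := card_lt_card (ssubset_univ_iff.2 hJ)
  rwa [card_univ, ZMod.card] at this

/-- Cyclically decreasing words are applicable to some configuration. -/
theorem exists_path_cycDecWord {J : Finset (ZMod n)} (hJ : J ≠ univ) :
    ∃ f g : Config (n - #J) n, Config.Path (cycDecWord J) f g := by
  have hlt := card_lt hJ
  have : NeZero (n - #J) := ⟨by omega⟩
  -- Particles fill all classes outside `J + 1`. Being executable there certifies that the word is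
  -- reduced, which later yields the length of `dElt J` and recovers `J` from it.
  have hcard : #((J.image (· + 1))ᶜ) = n - #J := by
    rw [card_compl, card_image_of_injective _ (add_left_injective 1), ZMod.card]
  obtain ⟨f, hf⟩ := Config.exists_occ_iff (m := n - #J) _ hcard
  refine ⟨f, Config.exists_path (admissible_of_nodup (cycDecWord_spec J hJ).1.1)
    (fun j hj => ?_) fun j hj => ?_⟩
  · rw [hf, mem_compl, not_not]
    exact mem_image_of_mem _ ((mem_cycDecWord hJ).1 (mem_of_mem_initials hj))
  · rw [hf, mem_compl, mem_image]
    rintro ⟨k, hk, rfl⟩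
    exact disjoint_initials ((cycWord_cycDecWord hJ).mem_initials ((mem_cycDecWord hJ).2 hk)) hj

theorem length_dElt {J : Finset (ZMod n)} (hJ : J ≠ univ) : (cs n).length (dElt J) = #J := by
  have hlt := card_lt hJ
  have : NeZero (n - #J) := ⟨by omega⟩
  obtain ⟨f, g, h⟩ := exists_path_cycDecWord hJ
  rw [dElt, h.isReduced.eq, length_cycDecWord hJ]

theorem dElt_injective {J J' : Finset (ZMod n)} (hJ : J ≠ univ) (hJ' : J' ≠ univ)
    (h : dElt J = dElt J') : J = J' := by
  have hlt := card_lt hJ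
  have : NeZero (n - #J) := ⟨by omega⟩
  obtain ⟨f, g, hp⟩ := exists_path_cycDecWord hJ
  have hlen := congrArg (cs n).length h
  rw [length_dElt hJ, length_dElt hJ'] at hlen
  have hp' := hp.of_wordProd_eq (l' := cycDecWord J') h.symm
    (by rw [length_cycDecWord hJ, length_cycDecWord hJ', hlen])
  have := (hp.commEq hp').perm
  ext i
  rw [← mem_cycDecWord hJ, this.mem_iff, mem_cycDecWord hJ']

theorem isCycDec_iff {w : AffSym n} : IsCycDec w ↔ ∃ J : Finset (ZMod n), J ≠ univ ∧ dElt J = w := by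
  constructor
  · rintro ⟨l, hl, rfl⟩
    exact ⟨l.toFinset, hl.cycWord.toFinset_ne_univ one_ne_zero,
      hl.cycWord.commEq_cycDecWord.symm.wordProd_eq⟩
  · rintro ⟨J, hJ, rfl⟩
    exact ⟨_, (cycDecWord_spec J hJ).1, rfl⟩

theorem dElt_empty : dElt (∅ : Finset (ZMod n)) = 1 := by
  rw [← (cs n).length_eq_zero_iff, length_dElt (fun e => ?_), card_empty]
  exact absurd (mem_univ 0) (e ▸ notMem_empty (0 : ZMod n))

open Classical in
/-- The sequences of proper subsets with prescribed sizes. -/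
def subsetLists : List ℕ → Finset (List (Finset (ZMod n)))
  | [] => {[]}
  | r :: L => ((univ.filter fun J : Finset (ZMod n) => J ≠ univ ∧ #J = r) ×ˢ subsetLists L).image
      fun p => p.1 :: p.2

theorem mem_subsetLists_cons {r : ℕ} {L : List ℕ} {Js : List (Finset (ZMod n))} :
    Js ∈ subsetLists (r :: L) ↔
      ∃ J Js', (J ≠ univ ∧ #J = r) ∧ Js' ∈ subsetLists L ∧ Js = J :: Js' := by
  simp only [subsetLists, mem_image, mem_product, mem_filter, mem_univ, true_and, Prod.exists]
  constructor
  · rintro ⟨J, Js', ⟨h1, h2⟩, rfl⟩; exact ⟨J, Js', h1, h2, rfl⟩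
  · rintro ⟨J, Js', h1, h2, rfl⟩; exact ⟨J, Js', ⟨h1, h2⟩, rfl⟩

theorem mem_subsetLists {L : List ℕ} {Js : List (Finset (ZMod n))} :
    Js ∈ subsetLists L ↔ List.Forall₂ (fun J r => J ≠ univ ∧ #J = r) Js L := by
  induction L generalizing Js with
  | nil => simp [subsetLists]
  | cons r L ih =>
    rw [mem_subsetLists_cons]
    constructor
    · rintro ⟨J, Js', h1, h2, rfl⟩; exact .cons h1 (ih.1 h2)
    · rintro (_ | ⟨h1, h2⟩); exact ⟨_, _, h1, ih.2 h2, rfl⟩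

theorem prod_hElt (L : List ℕ) :
    (L.map (hElt (n := n))).prod = ∑ Js ∈ subsetLists L, nilWord (Js.flatMap cycDecWord) := by
  classical
  induction L with
  | nil => simp [subsetLists, nilWord]
  | cons r L ih =>
    rw [List.map_cons, List.prod_cons, ih, hElt, sum_mul_sum, subsetLists, sum_image, sum_product]
    · refine sum_congr (by congr) fun J _ => sum_congr rfl fun Js _ => ?_
      rw [List.flatMap_cons, nilWord_append, nilD]
    · rintro ⟨a, b⟩ _ ⟨c, d⟩ _ h
      simpa using h

theorem length_flatMap {L : List ℕ} {Js : List (Finset (ZMod n))} (h : Js ∈ subsetLists L) :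
    (Js.flatMap cycDecWord).length = L.sum := by
  induction L generalizing Js with
  | nil => simp [subsetLists] at h; simp [h]
  | cons r L ih =>
    obtain ⟨J, Js', h1, h2, rfl⟩ := mem_subsetLists_cons.1 h
    rw [List.flatMap_cons, List.length_append, ih h2, length_cycDecWord h1.1, h1.2, List.sum_cons]

theorem prod_dElt (Js : List (Finset (ZMod n))) :
    (Js.map dElt).prod = (cs n).wordProd (Js.flatMap cycDecWord) := by
  induction Js with
  | nil => simp [(cs n).wordProd_nil]
  | cons J Js ih => rw [List.map_cons, List.prod_cons, ih, List.flatMap_cons,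
      (cs n).wordProd_append, dElt]

open Classical in
/-- The factorizations of `v` into cyclically decreasing elements of prescribed lengths. -/
def factorizations (L : List ℕ) (v : AffSym n) : Finset (List (Finset (ZMod n))) :=
  (subsetLists L).filter fun Js => (Js.map dElt).prod = v ∧ (cs n).length v = L.sum

theorem mem_factorizations {L : List ℕ} {v : AffSym n} {Js : List (Finset (ZMod n))} :
    Js ∈ factorizations L v ↔ Js ∈ subsetLists L ∧ (Js.map dElt).prod = v ∧
      (cs n).length v = L.sum := by
  classical rw [factorizations, mem_filter]

/-- Positivity of the parts makes the support of the exponent an initial segment, so the product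
over the support runs through the whole list. -/
theorem affineStanley_toFinsupp {L : List ℕ} (hL : ∀ r ∈ L, 0 < r) (v : AffSym n) :
    MvPowerSeries.coeff L.toFinsupp (affineStanley v) = #(factorizations L v) := by
  change affineStanley v L.toFinsupp = _
  have hval : ∀ j (hj : j < L.length), L.toFinsupp j = L[j] := fun j hj => by
    rw [List.toFinsupp_apply, List.getD_eq_getElem _ _ hj]
  have hval' : ∀ j, L.length ≤ j → L.toFinsupp j = 0 := fun j hj => by
    rw [List.toFinsupp_apply, List.getD_eq_default _ _ hj]
  have hsupp : L.toFinsupp.support = range L.length := by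
    ext j
    rw [Finsupp.mem_support_iff, mem_range]
    constructor
    · intro h; by_contra hcon; exact h (hval' j (not_lt.1 hcon))
    · intro h; rw [hval j h]; exact (hL _ (List.getElem_mem h)).ne'
  have hsum : (L.toFinsupp.sum fun _ p => p) = L.sum := by
    rw [Finsupp.sum, hsupp, sum_range]
    conv_rhs => rw [← List.ofFn_getElem (xs := L), List.sum_ofFn]
    exact sum_congr rfl fun j _ => hval j j.2
  have hget : ∀ Js : List (Finset (ZMod n)), Js.length = L.length →
      ((List.range L.length).map fun j => dElt (Js.getD j ∅)) = Js.map dElt := by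
    intro Js hJs
    apply List.ext_getElem
    · simp [hJs]
    · intro j h1 h2
      simp at h1 h2
      simp only [List.getElem_map, List.getElem_range, List.getD_eq_getElem _ _ h2]
  rw [affineStanley, hsupp, hsum]
  rw [show (#(factorizations L v) : ℤ) = ((Nat.card {Js // Js ∈ factorizations L v} : ℕ) : ℤ) by
    rw [Nat.card_eq_fintype_card, Fintype.card_coe]]
  congr 1
  symm
  have hne : (∅ : Finset (ZMod n)) ≠ univ :=
    fun e => absurd (mem_univ 0) (e ▸ notMem_empty (0 : ZMod n))
  have hsort : (range L.length).sort (· ≤ ·) = List.range L.length := by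
    exact sort_range _
  refine Nat.card_congr (Equiv.ofBijective (fun Js => ⟨fun j => dElt (Js.1.getD j ∅), ?_, ?_, ?_⟩)
    ⟨?_, ?_⟩)
  · intro j
    have h := mem_subsetLists.1 (mem_factorizations.1 Js.2).1
    dsimp only
    rcases lt_or_ge j L.length with hj | hj
    · have hj' : j < Js.1.length := by rwa [h.length_eq]
      have := h.get hj' hj
      simp only [List.get_eq_getElem] at this
      rw [List.getD_eq_getElem _ _ hj', hval j hj, length_dElt this.1]
      exact ⟨isCycDec_iff.2 ⟨_, this.1, rfl⟩, this.2⟩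
    · rw [List.getD_eq_default _ _ (by rwa [h.length_eq]), hval' j hj, dElt_empty]
      exact ⟨isCycDec_iff.2 ⟨∅, hne, dElt_empty⟩, (cs n).length_one⟩
  · rw [hsort, hget _ (mem_subsetLists.1 (mem_factorizations.1 Js.2).1).length_eq]
    exact (mem_factorizations.1 Js.2).2.1
  · exact (mem_factorizations.1 Js.2).2.2
  · rintro ⟨Js, h⟩ ⟨Js', h'⟩ e
    simp only [Subtype.mk.injEq] at e
    have h1 := mem_subsetLists.1 (mem_factorizations.1 h).1
    have h2 := mem_subsetLists.1 (mem_factorizations.1 h').1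
    refine Subtype.ext (List.ext_getElem (h1.length_eq.trans h2.length_eq.symm) fun j hj hj' => ?_)
    have ej := congrFun e j
    rw [List.getD_eq_getElem _ _ hj, List.getD_eq_getElem _ _ hj'] at ej
    have a1 := h1.get hj (h1.length_eq ▸ hj)
    have a2 := h2.get hj' (h2.length_eq ▸ hj')
    exact dElt_injective a1.1 a2.1 ej
  · rintro ⟨c, hc1, hc2, hc3⟩
    have hex : ∀ j, ∃ J : Finset (ZMod n), J ≠ univ ∧ dElt J = c j := fun j =>
      isCycDec_iff.1 (hc1 j).1
    choose J hJ hJc using hex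
    have hcard : ∀ j, #(J j) = L.toFinsupp j := fun j => by
      rw [← length_dElt (hJ j), hJc, (hc1 j).2]
    have hc : (fun j => dElt (((List.range L.length).map J).getD j ∅)) = c := by
      funext j
      rcases lt_or_ge j L.length with hj | hj
      · rw [List.getD_eq_getElem _ _ (by simpa using hj)]
        simp [hJc]
      · rw [List.getD_eq_default _ _ (by simpa using hj), ← hJc]
        have := hcard j
        rw [hval' j hj, card_eq_zero] at this
        rw [this]
    refine ⟨⟨(List.range L.length).map J, mem_factorizations.2 ⟨mem_subsetLists.2 ?_, ?_, hc3⟩⟩,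
      Subtype.ext hc⟩
    · rw [List.forall₂_iff_get]
      refine ⟨by simp, fun j h1 h2 => ?_⟩
      simp only [List.get_eq_getElem, List.getElem_map, List.getElem_range]
      exact ⟨hJ j, (hcard j).trans (hval j h2)⟩
    · rw [← hget _ (by simp), hc, ← hsort]
      exact hc2

theorem partsOf_pos (e : Fin (n - 1) →₀ ℕ) : ∀ r ∈ partsOf e, 0 < r := by
  intro r hr
  simp only [partsOf, List.mem_flatMap] at hr
  obtain ⟨i, _, hi⟩ := hr
  rw [List.eq_of_mem_replicate hi]
  omega

theorem hallPairing_affineStanley (f : SymmH n) (v : AffSym n) :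
    hallPairing f (affineStanley v) =
      ∑ e ∈ f.support, f.coeff e * #(factorizations (partsOf e) v) := by
  rw [hallPairing]
  exact sum_congr rfl fun e _ => by rw [affineStanley_toFinsupp (partsOf_pos e)]

end Factorization

/-! ## The pairing in terms of the action -/

section Pairing

variable {m n : ℕ} [Fact (1 < n)] [NeZero m] [NeZero n]

open Config

theorem action_toNil_single_apply (f : SymmH n) (x y : Config m n) :
    action m n (toNil f) (Finsupp.single x 1) y =
      ∑ e ∈ f.support, f.coeff e *
        action m n ((partsOf e).map hElt).prod (Finsupp.single x 1) y := by
  rw [toNil, map_sum, LinearMap.sum_apply, Finsupp.finsetSum_apply]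
  refine sum_congr rfl fun e _ => ?_
  have : action m n (f.coeff e • ((partsOf e).map hElt).prod) =
    f.coeff e • action m n ((partsOf e).map hElt).prod := map_zsmul (action m n) _ _
  rw [this, LinearMap.smul_apply, Finsupp.smul_apply, smul_eq_mul]

/-- The words from `x` to `y` are exactly the reduced words of `wordProd l`. So the entry of `𝐡_λ`
counts length-additive factorizations into cyclically decreasing elements of lengths `λ_1, λ_2, …`,
which is the coefficient of `x ^ λ` in the affine Stanley function. -/
theorem action_toNil_single_apply_of_path (f : SymmH n) {x y : Config m n} {l : List (ZMod n)}
    (h : Path l x y) : action m n (toNil f) (Finsupp.single x 1) y =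
      hallPairing f (affineStanley ((cs n).wordProd l)) := by
  classical
  rw [action_toNil_single_apply, hallPairing_affineStanley]
  refine sum_congr rfl fun e _ => ?_
  congr 1
  rw [prod_hElt]
  simp only [map_sum, LinearMap.sum_apply, Finsupp.finsetSum_apply, action_nilWord_single_apply]
  rw [← sum_filter, sum_const, nsmul_one, factorizations]
  congr 2
  refine filter_congr fun Js hJs => ?_
  rw [prod_dElt, ← length_flatMap hJs]
  constructor
  · intro hp
    refine ⟨(hp.commEq h).wordProd_eq, ?_⟩
    rw [h.isReduced.eq, (hp.commEq h).perm.length_eq]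
  · rintro ⟨h1, h2⟩
    exact h.of_wordProd_eq h1 (by rw [← h2, h.isReduced.eq])

theorem action_toNil_single_apply_eq_zero (f : SymmH n) {x y : Config m n}
    (h : ∀ l, ¬ Path l x y) : action m n (toNil f) (Finsupp.single x 1) y = 0 := by
  classical
  rw [action_toNil_single_apply]
  refine sum_eq_zero fun e _ => ?_
  rw [prod_hElt]
  simp only [map_sum, LinearMap.sum_apply, Finsupp.finsetSum_apply, action_nilWord_single_apply, h,
    if_false, sum_const_zero, mul_zero]

/-- The configuration with particles at `-(m - 1), …, 0` modulo `n`. -/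
def vacuum (hmn : m ≤ n) : Config m n where
  -- The quotient is `p / m` rounded up, so label `0` is at `0` and the gaps follow the multiples of
  -- `m`.
  toFun p := p + (n - m) * ((p + m - 1) / m)
  mono := by
    intro p q hpq
    dsimp only
    have hm : (0 : ℤ) < m := by exact_mod_cast Nat.pos_of_ne_zero (NeZero.ne m)
    have h1 := Int.ediv_le_ediv hm (show p + m - 1 ≤ q + m - 1 by omega)
    have h2 : (0 : ℤ) ≤ n - m := by omega
    have := mul_le_mul_of_nonneg_left h1 h2
    omega
  add p := by
    have hm : (m : ℤ) ≠ 0 := by exact_mod_cast NeZero.ne m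
    have : (p + (m : ℤ) + m - 1) / m = (p + m - 1) / m + 1 := by
      rw [show p + (m : ℤ) + m - 1 = p + m - 1 + m by ring, Int.add_ediv_of_dvd_right (dvd_refl _),
        Int.ediv_self hm]
    rw [this]; ring

theorem vacuum_apply (hmn : m ≤ n) (p : ℤ) :
    vacuum hmn p = p + (n - m) * ((p + m - 1) / m) := rfl

theorem vacuum_apply_add_one (hmn : m ≤ n) {p : ℤ} (hp : ¬ (m : ℤ) ∣ p) :
    vacuum hmn (p + 1) = vacuum hmn p + 1 := by
  have hm : (0 : ℤ) < m := by exact_mod_cast Nat.pos_of_ne_zero (NeZero.ne m)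
  have h0 := Int.emod_nonneg p hm.ne'
  have h1 := Int.emod_lt_of_pos p hm
  have h2 : p % m ≠ 0 := fun e => hp (Int.dvd_of_emod_eq_zero e)
  have h3 := Int.emod_add_mul_ediv p m
  have e1 : (p + m - 1) / (m : ℤ) = p / m + 1 := by
    rw [show p + m - 1 = (p % m - 1) + m * (p / m + 1) by linarith,
      Int.add_mul_ediv_left _ _ hm.ne', Int.ediv_eq_zero_of_lt (by omega) (by omega), zero_add]
  have e2 : (p + 1 + m - 1) / (m : ℤ) = p / m + 1 := by
    rw [show p + 1 + m - 1 = p % m + m * (p / m + 1) by linarith,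
      Int.add_mul_ediv_left _ _ hm.ne', Int.ediv_eq_zero_of_lt (by omega) (by omega), zero_add]
  rw [vacuum_apply, vacuum_apply, e1, e2]
  ring

theorem vacuum_mul (hmn : m ≤ n) (k : ℤ) : vacuum (m := m) hmn (m * k) = n * k := by
  have hm : (0 : ℤ) < m := by exact_mod_cast Nat.pos_of_ne_zero (NeZero.ne m)
  rw [vacuum_apply, show (m : ℤ) * k + m - 1 = (m - 1) + m * k by ring,
    Int.add_mul_ediv_left _ _ hm.ne', Int.ediv_eq_zero_of_lt (by omega) (by omega)]
  ring

/-- A particle whose label is not a multiple of `m` is blocked by the next one. -/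
theorem Config.Step.eq_zero_of_vacuum {hmn : m ≤ n} {i : ZMod n} {g : Config m n}
    (h : Step i (vacuum hmn) g) : i = 0 := by
  obtain ⟨p, hp⟩ := h.1
  by_cases hd : (m : ℤ) ∣ p
  · obtain ⟨k, rfl⟩ := hd
    rw [vacuum_mul] at hp
    rw [← hp]; simp
  · exact absurd ⟨p + 1, by rw [vacuum_apply_add_one hmn hd]; push_cast; rw [hp]⟩ h.2.1

theorem Config.Path.isZeroGrassmannian {hmn : m ≤ n} {l : List (ZMod n)} {g : Config m n}
    (h : Path l (vacuum hmn) g) : IsZeroGrassmannian ((cs n).wordProd l) := by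
  rintro l' ⟨hr, hl'⟩ i hi
  have hlen : l'.length = l.length := by rw [← hr.eq, hl', h.isReduced.eq]
  have h' := h.of_wordProd_eq hl' hlen
  obtain ⟨s, rfl⟩ := List.getLast?_eq_some_iff.1 hi
  obtain ⟨k, ⟨k', hk', hs⟩, _⟩ := path_append.1 h'
  rw [path_nil.1 hk'] at hs
  exact Step.eq_zero_of_vacuum hs

/-- Each configuration reachable from the vacuum corresponds to one `0`-Grassmannian element, and
its coefficient is the pairing with that element's affine Stanley function. Duality leaves only `g`.
-/
theorem IsKSchur.action_single {hmn : m ≤ n} {l : List (ZMod n)} {g : Config m n} {f : SymmH n}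
    (hf : IsKSchur ((cs n).wordProd l) f) (h : Path l (vacuum hmn) g) :
    action m n (toNil f) (Finsupp.single (vacuum hmn) 1) = Finsupp.single g 1 := by
  classical
  ext y
  by_cases hy : ∃ l', Path l' (vacuum hmn) y
  · obtain ⟨l', hl'⟩ := hy
    rw [action_toNil_single_apply_of_path f hl', Finsupp.single_apply]
    have := hf _ hl'.isZeroGrassmannian
    split_ifs with hgy
    · subst hgy
      exact this.1 (hl'.commEq h).wordProd_eq
    · refine this.2 fun e => hgy ?_
      ext p
      rw [h.apply, hl'.apply, e]
  · push Not at hy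
    rw [action_toNil_single_apply_eq_zero f hy, Finsupp.single_apply, if_neg]
    rintro rfl
    exact hy _ h

theorem IsKSchur.action_single_eq_zero {hmn : m ≤ n} {u : AffSym n} {f : SymmH n}
    (hf : IsKSchur u f) (h : ∀ l g, (cs n).wordProd l = u → ¬ Path l (vacuum (m := m) hmn) g) :
    action m n (toNil f) (Finsupp.single (vacuum hmn) 1) = 0 := by
  ext y
  by_cases hy : ∃ l', Path l' (vacuum hmn) y
  · obtain ⟨l', hl'⟩ := hy
    rw [action_toNil_single_apply_of_path f hl']
    exact (hf _ hl'.isZeroGrassmannian).2 fun e => h _ _ e hl'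
  · push Not at hy
    exact action_toNil_single_apply_eq_zero f hy

end Pairing

/-! ## Codes of `0`-Grassmannian elements -/

section Code

variable {n : ℕ} [Fact (1 < n)] [NeZero n]

theorem isPeriodicMap_toPerm (v : AffSym n) : IsPeriodicMap n n (toPerm n v) :=
  ⟨(toPerm n v).injective, toPerm_add v⟩

variable (n) in
/-- The positions `1, …, n`. -/
def window : Finset ℤ := Icc 1 (n : ℤ)

theorem mem_window {j : ℤ} : j ∈ window n ↔ 1 ≤ j ∧ j ≤ n := mem_Icc

theorem eq_of_cast_eq (v : AffSym n) {i j : ℤ} (hi : i ∈ window n) (hj : j ∈ window n)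
    (h : (toPerm n v i : ZMod n) = toPerm n v j) : i = j := by
  obtain ⟨k, hk⟩ := (isPeriodicMap_toPerm v).exists_of_cast_eq h
  rw [mem_window] at hi hj
  have hn : (0 : ℤ) < n := by exact_mod_cast Nat.pos_of_ne_zero (NeZero.ne n)
  have : k = 0 := by
    have h1 : (n : ℤ) * k < n * 1 := by linarith
    have h2 : (n : ℤ) * (-1) < n * k := by linarith
    have := lt_of_mul_lt_mul_left h1 hn.le
    have := lt_of_mul_lt_mul_left h2 hn.le
    omega
  rw [hk, this]; ring

theorem exists_mem_window (v : AffSym n) (r : ZMod n) :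
    ∃ j ∈ window n, (toPerm n v j : ZMod n) = r := by
  obtain ⟨x, rfl⟩ := ZMod.intCast_surjective r
  have hn : (0 : ℤ) < n := by exact_mod_cast Nat.pos_of_ne_zero (NeZero.ne n)
  set y := (toPerm n v)⁻¹ x with hy
  refine ⟨(y - 1) % n + 1, ?_, ?_⟩
  · have := Int.emod_nonneg (y - 1) hn.ne'
    have := Int.emod_lt_of_pos (y - 1) hn
    rw [mem_window]
    omega
  · rw [← (isPeriodicMap_toPerm v).cast_add_mul _ ((y - 1) / n)]
    have := Int.emod_add_mul_ediv (y - 1) n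
    rw [show (y - 1) % (n : ℤ) + 1 + n * ((y - 1) / n) = y by linarith, hy]
    simp

theorem card_window_filter (v : AffSym n) (J : Finset (ZMod n)) :
    #((window n).filter fun j => (toPerm n v j : ZMod n) ∈ J) = #J := by
  refine card_nbij (fun j => (toPerm n v j : ZMod n)) (fun j hj => (mem_filter.1 hj).2) ?_ ?_
  · intro i hi j hj h
    exact eq_of_cast_eq v (mem_filter.1 hi).1 (mem_filter.1 hj).1 h
  · intro r hr
    obtain ⟨j, hj, rfl⟩ := exists_mem_window v r
    exact ⟨j, mem_filter.2 ⟨hj, hr⟩, rfl⟩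

theorem IsZeroGrassmannian.lt_succ {v : AffSym n} (hv : IsZeroGrassmannian v) {x : ℤ}
    (hx : (x : ZMod n) ≠ 0) : toPerm n v x < toPerm n v (x + 1) := by
  rw [← length_lt_mul_simple_iff]
  by_contra hcon
  have h1 := (cs n).length_mul_simple v (x : ZMod n)
  obtain ⟨l, hl, hl'⟩ := (cs n).exists_isReduced (v * (cs n).simple (x : ZMod n))
  refine hx (hv (l ++ [(x : ZMod n)]) ?_ (x : ZMod n) (by simp))
  have h2 : (cs n).wordProd (l ++ [(x : ZMod n)]) = v := by
    rw [(cs n).wordProd_append, (cs n).wordProd_singleton, ← hl',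
      (cs n).simple_mul_simple_cancel_right]
  refine ⟨?_, h2⟩
  have h3 := hl.eq
  rw [← hl'] at h3
  rw [CoxeterSystem.IsReduced, h2, List.length_append, List.length_singleton]
  omega

theorem IsZeroGrassmannian.lt {v : AffSym n} (hv : IsZeroGrassmannian v) {i j : ℤ}
    (hi : i ∈ window n) (hj : j ∈ window n) (hij : i < j) : toPerm n v i < toPerm n v j := by
  rw [mem_window] at hi hj
  obtain ⟨k, rfl⟩ : ∃ k : ℕ, j = i + (k + 1 : ℕ) := ⟨(j - i - 1).toNat, by omega⟩
  have hne : ∀ x : ℤ, 1 ≤ x → x < n → (x : ZMod n) ≠ 0 := by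
    intro x h1 h2 h
    rw [ZMod.intCast_zmod_eq_zero_iff_dvd] at h
    have := Int.le_of_dvd (by omega) h
    omega
  induction k with
  | zero => simpa using hv.lt_succ (hne i hi.1 (by push_cast at hij hj; omega))
  | succ k ih =>
    have h1 := ih (by push_cast at *; omega) (by push_cast; omega)
    have h2 := hv.lt_succ (hne (i + (k + 1 : ℕ)) (by push_cast; omega) (by push_cast at *; omega))
    rw [show i + ((k + 1 + 1 : ℕ) : ℤ) = i + (k + 1 : ℕ) + 1 by push_cast; ring]
    exact h1.trans h2

theorem IsZeroGrassmannian.of_simple_mul {u : AffSym n} {i : ZMod n}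
    (hv : IsZeroGrassmannian ((cs n).simple i * u))
    (hl : (cs n).length ((cs n).simple i * u) = (cs n).length u + 1) : IsZeroGrassmannian u := by
  rintro l ⟨hr, rfl⟩ j hj
  refine hv (i :: l) ⟨?_, (cs n).wordProd_cons i l⟩ j ?_
  · rw [CoxeterSystem.IsReduced, (cs n).wordProd_cons, hl, hr.eq, List.length_cons]
  · obtain ⟨s, rfl⟩ := List.getLast?_eq_some_iff.1 hj
    rw [← List.cons_append, List.getLast?_append]
    rfl

/-- The code of `v`: the number of inversions of the affine permutation `v` in which the value
at position `j` is the smaller one. -/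
def code (v : AffSym n) (j : ℤ) : ℕ :=
  ∑ i ∈ window n, ((toPerm n v i - toPerm n v j) / n).toNat

theorem ediv_add_one {t : ℤ} (h : ¬ (n : ℤ) ∣ t + 1) : (t + 1) / n = t / n := by
  have hn : (0 : ℤ) < n := by exact_mod_cast Nat.pos_of_ne_zero (NeZero.ne n)
  have h1 := Int.emod_add_mul_ediv t n
  have h2 := Int.emod_nonneg t hn.ne'
  have h3 := Int.emod_lt_of_pos t hn
  have h4 : t % n + 1 ≠ n := fun e => h ⟨t / n + 1, by linarith⟩
  rw [show t + 1 = (t % n + 1) + n * (t / n) by linarith, Int.add_mul_ediv_left _ _ hn.ne',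
    Int.ediv_eq_zero_of_lt (by omega) (by omega), zero_add]

theorem not_dvd_sub_of_cast_ne {x y : ℤ} (h : (x : ZMod n) ≠ y) : ¬ (n : ℤ) ∣ y - x := by
  rwa [← ZMod.intCast_eq_intCast_iff_dvd_sub]

/-- The effect of a length-increasing left multiplication by a simple reflection on a
`0`-Grassmannian element. -/
theorem IsZeroGrassmannian.exists_exchange {u : AffSym n} {i : ZMod n}
    (hv : IsZeroGrassmannian ((cs n).simple i * u))
    (hl : (cs n).length ((cs n).simple i * u) = (cs n).length u + 1) :
    ∃ a ∈ window n, ∃ b ∈ window n, (toPerm n u a : ZMod n) = i ∧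
      (toPerm n u b : ZMod n) = i + 1 ∧
      toPerm n ((cs n).simple i * u) a = toPerm n u a + 1 ∧
      toPerm n ((cs n).simple i * u) b = toPerm n u b - 1 ∧
      (∀ j ∈ window n, j ≠ a → j ≠ b → toPerm n ((cs n).simple i * u) j = toPerm n u j) ∧
      code ((cs n).simple i * u) b = code u b + 1 ∧
      ∀ j ∈ window n, j ≠ b → code ((cs n).simple i * u) j = code u j := by
  have hn : (0 : ℤ) < n := by exact_mod_cast Nat.pos_of_ne_zero (NeZero.ne n)
  have hn1 : (1 : ℤ) < n := by exact_mod_cast (Fact.out : 1 < n)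
  obtain ⟨a, ha, hai⟩ := exists_mem_window u i
  obtain ⟨b, hb, hbi⟩ := exists_mem_window u (i + 1)
  have happ : ∀ x, toPerm n ((cs n).simple i * u) x = reflFun i (toPerm n u x) := by
    intro x; rw [map_mul, Equiv.Perm.mul_apply, toPerm_simple_apply]
  have hva : toPerm n ((cs n).simple i * u) a = toPerm n u a + 1 := by
    rw [happ, reflFun_of_eq hai]
  have hvb : toPerm n ((cs n).simple i * u) b = toPerm n u b - 1 := by
    rw [happ, reflFun_of_eq_add_one hbi]
  have hvo : ∀ j ∈ window n, j ≠ a → j ≠ b →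
      toPerm n ((cs n).simple i * u) j = toPerm n u j := by
    intro j hj hja hjb
    rw [happ, reflFun_of_ne]
    · exact fun e => hja (eq_of_cast_eq u hj ha (e.trans hai.symm))
    · exact fun e => hjb (eq_of_cast_eq u hj hb (e.trans hbi.symm))
  have hab : a ≠ b := by
    rintro rfl
    exact add_one_ne i (hbi.symm.trans hai)
  have hu := hv.of_simple_mul hl
  -- the value that moves to the right is the larger one
  have hlt : toPerm n u b < toPerm n u a := by
    have hbw := mem_window.1 hb
    have haw := mem_window.1 ha
    obtain ⟨k, hk⟩ : (n : ℤ) ∣ (toPerm n u a + 1) - toPerm n u b := by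
      rw [← ZMod.intCast_eq_intCast_iff_dvd_sub]
      push_cast
      rw [hai, hbi]
    have hx := (length_lt_simple_mul_iff u (toPerm n u a)).1 (by rw [hai]; omega)
    have e1 : (toPerm n u)⁻¹ (toPerm n u a) = a := by simp
    have e2 : (toPerm n u)⁻¹ (toPerm n u a + 1) = b + n * k := by
      rw [Equiv.Perm.inv_eq_iff_eq, toPerm_add_mul]
      linarith
    rw [e1, e2] at hx
    by_contra hcon
    have hcon' : toPerm n u a < toPerm n u b :=
      lt_of_le_of_ne (not_lt.1 hcon) fun e => hab ((toPerm n u).injective e)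
    have hlab : a < b := by
      by_contra h
      exact absurd (hu.lt hb ha (lt_of_le_of_ne (not_lt.1 h) hab.symm)) (by omega)
    have hk0 : k = 0 := by
      have h1 : (n : ℤ) * k ≤ n * 0 := by rw [mul_zero, ← hk]; omega
      have h2 : (n : ℤ) * (-1) < n * k := by linarith
      have := le_of_mul_le_mul_left h1 hn
      have := lt_of_mul_lt_mul_left h2 hn.le
      omega
    rw [hk0, mul_zero] at hk
    have := hv.lt ha hb hlab
    rw [hva, hvb] at this
    omega
  have hdiv : ∀ j ∈ window n, j ≠ a → j ≠ b → ∀ x ∈ window n,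
      (toPerm n ((cs n).simple i * u) x - toPerm n u j) / n =
        (toPerm n u x - toPerm n u j) / n := by
    intro j hj hja hjb x hx
    by_cases hxa : x = a
    · rw [hxa, hva, show toPerm n u a + 1 - toPerm n u j = toPerm n u a - toPerm n u j + 1 by ring,
        ediv_add_one]
      rw [show toPerm n u a - toPerm n u j + 1 = (toPerm n u a + 1) - toPerm n u j by ring]
      apply not_dvd_sub_of_cast_ne
      push_cast
      rw [hai]
      exact fun e => hjb (eq_of_cast_eq u hj hb (e.trans hbi.symm))
    by_cases hxb : x = b
    · rw [hxb, hvb, ← ediv_add_one (t := toPerm n u b - 1 - toPerm n u j)]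
      · congr 1; ring
      · rw [show toPerm n u b - 1 - toPerm n u j + 1 = toPerm n u b - toPerm n u j by ring]
        apply not_dvd_sub_of_cast_ne
        exact fun e => hjb (eq_of_cast_eq u hj hb e)
    · rw [hvo x hx hxa hxb]
  refine ⟨a, ha, b, hb, hai, hbi, hva, hvb, hvo, ?_, ?_⟩
  -- Only the pair `a`, `b` gains: `u a - u b` is `-1` modulo `n`, and adding `2` crosses a multiple
  -- of `n`. The other differences change by at most one without crossing, so their quotients are
  -- unchanged.
  · have e : ∀ x ∈ window n, ((toPerm n ((cs n).simple i * u) x -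
        toPerm n ((cs n).simple i * u) b) / n).toNat =
        ((toPerm n u x - toPerm n u b) / n).toNat + if x = a then 1 else 0 := by
      intro x hx
      by_cases hxa : x = a
      · rw [if_pos hxa, hxa, hva, hvb]
        obtain ⟨k, hk⟩ : (n : ℤ) ∣ (toPerm n u a + 1) - toPerm n u b := by
          rw [← ZMod.intCast_eq_intCast_iff_dvd_sub]
          push_cast
          rw [hai, hbi]
        have hkpos : 0 < k := by
          have : (n : ℤ) * 0 < n * k := by rw [mul_zero, ← hk]; omega
          exact lt_of_mul_lt_mul_left this hn.le
        have e1 : (toPerm n u a + 1 - (toPerm n u b - 1)) / (n : ℤ) = k := by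
          rw [show toPerm n u a + 1 - (toPerm n u b - 1) = 1 + n * k by linarith,
            Int.add_mul_ediv_left _ _ hn.ne', Int.ediv_eq_zero_of_lt (by omega) hn1, zero_add]
        have e2 : (toPerm n u a - toPerm n u b) / (n : ℤ) = k - 1 := by
          rw [show toPerm n u a - toPerm n u b = (n - 1) + n * (k - 1) by linarith,
            Int.add_mul_ediv_left _ _ hn.ne', Int.ediv_eq_zero_of_lt (by omega) (by omega),
            zero_add]
        rw [e1, e2]
        omega
      · rw [if_neg hxa, add_zero]
        by_cases hxb : x = b
        · rw [hxb, sub_self, sub_self]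
        · rw [hvo x hx hxa hxb, hvb,
            show toPerm n u x - (toPerm n u b - 1) = toPerm n u x - toPerm n u b + 1 by ring,
            ediv_add_one]
          rw [show toPerm n u x - toPerm n u b + 1 = (toPerm n u x + 1) - toPerm n u b by ring]
          apply not_dvd_sub_of_cast_ne
          push_cast
          rw [hbi]
          exact fun e => hxa (eq_of_cast_eq u hx ha ((add_right_cancel e).symm.trans hai.symm))
    rw [code, sum_congr rfl e, sum_add_distrib, sum_ite_eq' (window n) a, if_pos ha, code]
  · intro j hj hjb
    by_cases hja : j = a
    · rw [hja]
      refine sum_congr rfl fun x hx => ?_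
      by_cases hxa : x = a
      · rw [hxa, sub_self, sub_self]
      by_cases hxb : x = b
      · rw [hxb, hva, hvb]
        have h1 : (toPerm n u b - 1 - (toPerm n u a + 1)) / (n : ℤ) < 0 :=
          Int.ediv_neg_of_neg_of_pos (by omega) hn
        have h2 : (toPerm n u b - toPerm n u a) / (n : ℤ) < 0 :=
          Int.ediv_neg_of_neg_of_pos (by omega) hn
        omega
      · rw [hvo x hx hxa hxb, hva, ← ediv_add_one (t := toPerm n u x - (toPerm n u a + 1))]
        · congr 2; ring
        · rw [show toPerm n u x - (toPerm n u a + 1) + 1 = toPerm n u x - toPerm n u a by ring]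
          apply not_dvd_sub_of_cast_ne
          exact fun e => hxa (eq_of_cast_eq u hx ha e.symm)
    · refine sum_congr rfl fun x hx => ?_
      rw [hvo j hj hja hjb, hdiv j hj hja hjb x hx]

/-- The effect of a length-additive cyclically decreasing factor on the code. -/
theorem IsZeroGrassmannian.code_wordProd_mul {D : List (ZMod n)} (hD : CycWord 1 D)
    {u v : AffSym n} (hv : IsZeroGrassmannian v) (huv : v = (cs n).wordProd D * u)
    (hl : (cs n).length v = (cs n).length u + D.length) :
    IsZeroGrassmannian u ∧ ∀ j ∈ window n,
      code v j = code u j + (if (toPerm n v j : ZMod n) ∈ D then 1 else 0) ∧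
      ((toPerm n v j : ZMod n) ∈ D → toPerm n v j = toPerm n u j - 1) ∧
      (toPerm n v j ≠ toPerm n u j →
        (toPerm n v j : ZMod n) ∈ D ∨ ((toPerm n v j - 1 : ℤ) : ZMod n) ∈ D) := by
  induction D generalizing v with
  | nil =>
    rw [(cs n).wordProd_nil, one_mul] at huv
    subst huv
    exact ⟨hv, fun j _ => ⟨by simp, by simp, by simp⟩⟩
  | cons i t ih =>
    rw [cycWord_cons] at hD
    set v₁ := (cs n).wordProd t * u with hv₁
    rw [(cs n).wordProd_cons, mul_assoc, ← hv₁] at huv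
    subst huv
    have h1 : (cs n).length v₁ ≤ (cs n).length u + t.length := by
      have h0 := (cs n).length_mul_le ((cs n).wordProd t) u
      rw [← hv₁] at h0
      have := (cs n).length_wordProd_le t
      omega
    have h2 := (cs n).length_simple_mul v₁ i
    rw [List.length_cons] at hl
    have h3 : (cs n).length ((cs n).simple i * v₁) = (cs n).length v₁ + 1 := by omega
    obtain ⟨hu, hall⟩ := ih hD.2.2 (hv.of_simple_mul h3) rfl (by omega)
    refine ⟨hu, fun j hj => ?_⟩
    obtain ⟨a, ha, b, hb, hai, hbi, hva, hvb, hvo, hcb, hco⟩ := hv.exists_exchange h3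
    obtain ⟨c1, c2, c3⟩ := hall j hj
    by_cases hjb : j = b
    · subst hjb
      rw [hbi, if_neg hD.2.1, add_zero] at c1
      have hvi : ((toPerm n v₁ j - 1 : ℤ) : ZMod n) = i := by
        push_cast; rw [hbi]; ring
      have hmem : ((toPerm n v₁ j - 1 : ℤ) : ZMod n) ∈ i :: t := by rw [hvi]; simp
      rw [hcb, hvb, if_pos hmem, c1]
      refine ⟨rfl, fun _ => ?_, fun _ => Or.inl hmem⟩
      -- By the third clause an earlier move of position `j` would put `i + 1` or `i` into `t`,
      -- which the cyclic order excludes.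
      by_contra hne
      rcases c3 (fun e => hne (by rw [e])) with h | h
      · rw [hbi] at h; exact hD.2.1 h
      · rw [hvi] at h; exact hD.1 h
    · rw [hco j hj hjb]
      by_cases hja : j = a
      · subst hja
        have hv1 : ((toPerm n v₁ j + 1 : ℤ) : ZMod n) = i + 1 := by push_cast; rw [hai]
        have hnm : ((toPerm n v₁ j + 1 : ℤ) : ZMod n) ∉ i :: t := by
          rw [hv1, List.mem_cons, not_or]
          exact ⟨add_one_ne i, hD.2.1⟩
        rw [hva, if_neg hnm, c1, hai, if_neg hD.1]
        refine ⟨rfl, fun h => absurd h hnm, fun _ => Or.inr ?_⟩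
        rw [add_sub_cancel_right, hai]; simp
      · have hne : (toPerm n v₁ j : ZMod n) ≠ i := fun e =>
          hja (eq_of_cast_eq v₁ hj ha (e.trans hai.symm))
        rw [hvo j hj hja hjb, c1]
        refine ⟨by simp [hne], fun h => c2 (by simpa [hne] using h), fun h => ?_⟩
        exact (c3 h).imp (List.mem_cons_of_mem _) (List.mem_cons_of_mem _)

theorem code_antitone {v : AffSym n} (hv : IsZeroGrassmannian v) {i j : ℤ} (hi : i ∈ window n)
    (hj : j ∈ window n) (hij : i ≤ j) : code v j ≤ code v i := by
  have hn : (0 : ℤ) < n := by exact_mod_cast Nat.pos_of_ne_zero (NeZero.ne n)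
  rcases hij.eq_or_lt with rfl | hij
  · exact le_rfl
  have := hv.lt hi hj hij
  refine sum_le_sum fun x _ => Int.toNat_le_toNat (Int.ediv_le_ediv hn (by omega))

theorem code_last {v : AffSym n} (hv : IsZeroGrassmannian v) : code v n = 0 := by
  have hn : (0 : ℤ) < n := by exact_mod_cast Nat.pos_of_ne_zero (NeZero.ne n)
  have hnw : (n : ℤ) ∈ window n := mem_window.2 ⟨by omega, le_rfl⟩
  refine sum_eq_zero fun x hx => ?_
  rcases (mem_window.1 hx).2.eq_or_lt with rfl | h
  · simp
  · have := hv.lt hx hnw h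
    have : (toPerm n v x - toPerm n v n) / (n : ℤ) < 0 :=
      Int.ediv_neg_of_neg_of_pos (by omega) hn
    omega

/-- A nontrivial `0`-Grassmannian element has its only descent at `0`. There the value at `n`
exceeds the value at `1` by at least `n`, which the code at position `1` records. -/
theorem eq_one_of_code_eq_zero {v : AffSym n} (hv : IsZeroGrassmannian v)
    (h : ∀ j ∈ window n, code v j = 0) : v = 1 := by
  have hn : (0 : ℤ) < n := by exact_mod_cast Nat.pos_of_ne_zero (NeZero.ne n)
  by_contra hcon
  obtain ⟨i, hi⟩ := (cs n).exists_rightDescent_of_ne_one hcon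
  obtain ⟨x, rfl⟩ := ZMod.intCast_surjective i
  rw [CoxeterSystem.IsRightDescent] at hi
  have h1 : ¬ toPerm n v x < toPerm n v (x + 1) := by
    rw [← length_lt_mul_simple_iff]; omega
  have hx : (x : ZMod n) = 0 := by
    by_contra hx
    exact h1 (hv.lt_succ hx)
  rw [ZMod.intCast_zmod_eq_zero_iff_dvd] at hx
  obtain ⟨k, rfl⟩ := hx
  have e1 : toPerm n v (n * k) = toPerm n v n + n * (k - 1) := by
    rw [← toPerm_add_mul]; congr 1; ring
  have e2 : toPerm n v (n * k + 1) = toPerm n v 1 + n * k := by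
    rw [← toPerm_add_mul]; congr 1; ring
  rw [e1, e2] at h1
  have hw1 : (1 : ℤ) ∈ window n := mem_window.2 ⟨le_rfl, by omega⟩
  have hwn : (n : ℤ) ∈ window n := mem_window.2 ⟨by omega, le_rfl⟩
  have h2 := (sum_eq_zero_iff.1 (h 1 hw1)) n hwn
  have h3 : 1 ≤ (toPerm n v n - toPerm n v 1) / (n : ℤ) := by
    rw [Int.le_ediv_iff_mul_le hn]
    linarith
  omega

/-- The positions with nonzero code. -/
def codeSupport (v : AffSym n) : Finset ℤ := (window n).filter fun j => 0 < code v j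

theorem mem_codeSupport {v : AffSym n} {j : ℤ} :
    j ∈ codeSupport v ↔ j ∈ window n ∧ 0 < code v j := mem_filter

/-- A cyclically decreasing word can be split off from a `0`-Grassmannian element if its letters
are residues of values with nonzero code, chosen compatibly. -/
theorem IsZeroGrassmannian.exists_eq_wordProd_mul {D : List (ZMod n)} (hD : CycWord 1 D)
    {v : AffSym n} (hv : IsZeroGrassmannian v)
    (h₁ : ∀ j ∈ window n, (toPerm n v j : ZMod n) ∈ D → 0 < code v j)
    (h₂ : ∀ j ∈ window n, (toPerm n v j : ZMod n) ∉ D →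
      ((toPerm n v j - 1 : ℤ) : ZMod n) ∈ D → code v j = 0) :
    ∃ u, v = (cs n).wordProd D * u ∧ (cs n).length v = (cs n).length u + D.length := by
  have hn : (0 : ℤ) < n := by exact_mod_cast Nat.pos_of_ne_zero (NeZero.ne n)
  induction D generalizing v with
  | nil => exact ⟨v, by rw [(cs n).wordProd_nil, one_mul], rfl⟩
  | cons i t ih =>
    rw [cycWord_cons] at hD
    obtain ⟨a, ha, hai⟩ := exists_mem_window v i
    obtain ⟨b, hb, hbi⟩ := exists_mem_window v (i + 1)
    have hca := h₁ a ha (by rw [hai]; simp)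
    have hcb := h₂ b hb (by
      rw [hbi, List.mem_cons, not_or]; exact ⟨add_one_ne i, hD.2.1⟩) (by
      push_cast; rw [hbi]; simp)
    obtain ⟨k, hk⟩ : (n : ℤ) ∣ toPerm n v b - (toPerm n v a + 1) := by
      rw [← ZMod.intCast_eq_intCast_iff_dvd_sub]
      push_cast
      rw [hai, hbi]
    -- the value at `b` exceeds the value at `a` by more than `n`
    have hkpos : 0 < k := by
      by_contra hcon
      -- Nonzero code at `a` gives `v c ≥ v a + n`, and zero code at `b` gives `v c < v b + n`. If
      -- `v b ≤ v a + 1`, then `v c = v a + n`, which contradicts the distinctness of residues in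
      -- the window.
      obtain ⟨c, hc, hc0⟩ : ∃ c ∈ window n, 0 < ((toPerm n v c - toPerm n v a) / n).toNat := by
        by_contra hcon2
        push Not at hcon2
        have : code v a = 0 := sum_eq_zero fun x hx => Nat.le_zero.1 (hcon2 x hx)
        omega
      have hc1 : 1 * (n : ℤ) ≤ toPerm n v c - toPerm n v a := by
        rw [← Int.le_ediv_iff_mul_le hn]; omega
      have hc2 := (sum_eq_zero_iff.1 hcb) c hc
      have hc3 : toPerm n v c - toPerm n v b < 1 * n := by
        rw [← Int.ediv_lt_iff_lt_mul hn]; omega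
      have hk0 : (n : ℤ) * k ≤ n * 0 := mul_le_mul_of_nonneg_left (by omega) hn.le
      have hca' : toPerm n v c = toPerm n v a + n := by omega
      have : c = a := eq_of_cast_eq v hc ha (by rw [hca']; simp)
      rw [this] at hca'
      omega
    set v₁ := (cs n).simple i * v with hv₁
    have hv₁' : v = (cs n).simple i * v₁ := by
      rw [hv₁, (cs n).simple_mul_simple_cancel_left]
    have hlen : (cs n).length v = (cs n).length v₁ + 1 := by
      have h3 := (cs n).length_simple_mul v i
      have h4 : ¬ (cs n).length v < (cs n).length ((cs n).simple (toPerm n v a : ZMod n) * v) := by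
        rw [length_lt_simple_mul_iff]
        have e1 : (toPerm n v)⁻¹ (toPerm n v a) = a := by simp
        have e2 : (toPerm n v)⁻¹ (toPerm n v a + 1) = b + n * (-k) := by
          rw [Equiv.Perm.inv_eq_iff_eq, toPerm_add_mul]
          linarith
        rw [e1, e2]
        rw [mem_window] at ha hb
        have : (n : ℤ) * 1 ≤ n * k := mul_le_mul_of_nonneg_left (by omega) hn.le
        linarith
      rw [hai, ← hv₁] at h4
      rw [← hv₁] at h3
      omega
    rw [hv₁'] at hv hlen
    obtain ⟨a', ha', b', hb', ha'i, hb'i, hva', hvb', hvo, hcb', hco⟩ := hv.exists_exchange hlen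
    rw [← hv₁'] at hva' hvb' hvo hcb' hco
    obtain rfl : a = b' := eq_of_cast_eq v ha hb' (by
      rw [hai, hvb']; push_cast; rw [hb'i]; ring)
    obtain rfl : b = a' := eq_of_cast_eq v hb ha' (by
      rw [hbi, hva']; push_cast; rw [ha'i])
    have main : ∀ u, v₁ = (cs n).wordProd t * u ∧ (cs n).length v₁ = (cs n).length u + t.length →
        ∃ u, v = (cs n).wordProd (i :: t) * u ∧
          (cs n).length v = (cs n).length u + (i :: t).length := by
      rintro u ⟨hu, hul⟩
      refine ⟨u, ?_, ?_⟩
      · rw [hv₁', hu, (cs n).wordProd_cons, mul_assoc]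
      · rw [hv₁', hlen, hul, List.length_cons]; omega
    refine (ih hD.2.2 (hv.of_simple_mul hlen) ?_ ?_).elim main
    · intro j hj hjt
      have hja : j ≠ a := by rintro rfl; rw [hb'i] at hjt; exact hD.2.1 hjt
      have hjb : j ≠ b := by rintro rfl; rw [ha'i] at hjt; exact hD.1 hjt
      rw [← hco j hj hja]
      exact h₁ j hj (by rw [hvo j hj hjb hja]; exact List.mem_cons_of_mem _ hjt)
    · intro j hj hjt hjt'
      by_cases hja : j = a
      · subst hja
        push_cast at hjt'
        rw [hb'i, add_sub_cancel_right] at hjt'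
        exact absurd hjt' hD.1
      rw [← hco j hj hja]
      by_cases hjb : j = b
      · subst hjb; exact hcb
      have hne : (toPerm n v j : ZMod n) ≠ i := fun e =>
        hja (eq_of_cast_eq v hj ha (e.trans hai.symm))
      refine h₂ j hj ?_ ?_
      · rw [hvo j hj hjb hja, List.mem_cons, not_or]
        refine ⟨fun e => hne ?_, hjt⟩
        rw [hvo j hj hjb hja, e]
      · rw [hvo j hj hjb hja]; exact List.mem_cons_of_mem _ hjt'

end Code

/-! ## Shapes and the existence of `k`-Schur functions -/

section Shape

variable {n : ℕ} [Fact (1 < n)] [NeZero n]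

theorem IsZeroGrassmannian.code_dElt_mul {J : Finset (ZMod n)} (hJ : J ≠ univ)
    {u v : AffSym n} (hv : IsZeroGrassmannian v) (huv : v = dElt J * u)
    (hl : (cs n).length v = (cs n).length u + #J) :
    IsZeroGrassmannian u ∧ ∀ j ∈ window n,
      code v j = code u j + (if (toPerm n v j : ZMod n) ∈ J then 1 else 0) ∧
      ((toPerm n v j : ZMod n) ∈ J → toPerm n v j = toPerm n u j - 1) := by
  obtain ⟨hu, h⟩ := hv.code_wordProd_mul (cycWord_cycDecWord hJ) huv
    (by rw [length_cycDecWord hJ]; exact hl)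
  refine ⟨hu, fun j hj => ?_⟩
  obtain ⟨h1, h2, -⟩ := h j hj
  simp only [mem_cycDecWord hJ] at h1 h2
  exact ⟨h1, h2⟩

/-- A length-additive cyclically decreasing left factor of a `0`-Grassmannian element has at most
as many letters as there are nonzero entries of the code. -/
theorem IsZeroGrassmannian.filter_subset_codeSupport {J : Finset (ZMod n)} (hJ : J ≠ univ)
    {u v : AffSym n} (hv : IsZeroGrassmannian v) (huv : v = dElt J * u)
    (hl : (cs n).length v = (cs n).length u + #J) :
    ((window n).filter fun j => (toPerm n v j : ZMod n) ∈ J) ⊆ codeSupport v := by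
  intro j hj
  rw [mem_filter] at hj
  have := ((hv.code_dElt_mul hJ huv hl).2 j hj.1).1
  rw [if_pos hj.2] at this
  exact mem_codeSupport.2 ⟨hj.1, by omega⟩

theorem IsZeroGrassmannian.card_le {J : Finset (ZMod n)} (hJ : J ≠ univ)
    {u v : AffSym n} (hv : IsZeroGrassmannian v) (huv : v = dElt J * u)
    (hl : (cs n).length v = (cs n).length u + #J) : #J ≤ #(codeSupport v) := by
  rw [← card_window_filter v J]
  exact card_le_card (hv.filter_subset_codeSupport hJ huv hl)

theorem IsZeroGrassmannian.filter_eq_codeSupport {J : Finset (ZMod n)} (hJ : J ≠ univ)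
    {u v : AffSym n} (hv : IsZeroGrassmannian v) (huv : v = dElt J * u)
    (hl : (cs n).length v = (cs n).length u + #J) (hc : #J = #(codeSupport v)) :
    ((window n).filter fun j => (toPerm n v j : ZMod n) ∈ J) = codeSupport v :=
  eq_of_subset_of_card_le (hv.filter_subset_codeSupport hJ huv hl)
    (by rw [card_window_filter, hc])

theorem eq_image_of_filter_eq {v : AffSym n} {J : Finset (ZMod n)} {S : Finset ℤ}
    (h : ((window n).filter fun j => (toPerm n v j : ZMod n) ∈ J) = S) :
    J = S.image fun j => (toPerm n v j : ZMod n) := by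
  ext r
  rw [mem_image]
  constructor
  · intro hr
    obtain ⟨j, hj, rfl⟩ := exists_mem_window v r
    exact ⟨j, h ▸ mem_filter.2 ⟨hj, hr⟩, rfl⟩
  · rintro ⟨j, hj, rfl⟩
    rw [← h] at hj
    exact (mem_filter.1 hj).2

/-- The bound of `IsZeroGrassmannian.card_le` is attained by the residues of all values with nonzero
code. They form a proper subset because the code vanishes at position `n`. -/
theorem IsZeroGrassmannian.exists_dElt_mul {v : AffSym n} (hv : IsZeroGrassmannian v) :
    ∃ (J : Finset (ZMod n)) (u : AffSym n), J ≠ univ ∧ #J = #(codeSupport v) ∧ v = dElt J * u ∧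
      (cs n).length v = (cs n).length u + #J := by
  have hn : (0 : ℤ) < n := by exact_mod_cast Nat.pos_of_ne_zero (NeZero.ne n)
  set J := (codeSupport v).image fun j => (toPerm n v j : ZMod n) with hJdef
  have hmem : ∀ j ∈ window n, (toPerm n v j : ZMod n) ∈ J ↔ 0 < code v j := by
    intro j hj
    rw [hJdef, mem_image]
    constructor
    · rintro ⟨k, hk, e⟩
      rw [mem_codeSupport] at hk
      rw [← eq_of_cast_eq v hk.1 hj e]
      exact hk.2
    · exact fun h => ⟨j, mem_codeSupport.2 ⟨hj, h⟩, rfl⟩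
  have hJ : J ≠ univ := by
    intro e
    have := (hmem n (mem_window.2 ⟨by omega, le_rfl⟩)).1 (e ▸ mem_univ _)
    rw [code_last hv] at this
    omega
  have hcard : #J = #(codeSupport v) := card_image_of_injOn fun i hi j hj e =>
    eq_of_cast_eq v (mem_codeSupport.1 hi).1 (mem_codeSupport.1 hj).1 e
  obtain ⟨u, hu, hl⟩ := hv.exists_eq_wordProd_mul (cycWord_cycDecWord hJ)
    (fun j hj h => (hmem j hj).1 ((mem_cycDecWord hJ).1 h))
    (fun j hj h _ => by
      rw [mem_cycDecWord hJ, hmem j hj] at h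
      omega)
  exact ⟨J, u, hJ, hcard, hu, by rw [hl, length_cycDecWord hJ]⟩

/-- The shape of a `0`-Grassmannian element: the sizes of the cyclically decreasing left factors
obtained by splitting off, again and again, a factor of the largest possible size. -/
inductive IsShape : AffSym n → List ℕ → Prop
  | one : IsShape 1 []
  | cons (J : Finset (ZMod n)) (u v : AffSym n) (L : List ℕ) (hJ : J ≠ univ) (hJ' : 0 < #J)
      (hv : IsZeroGrassmannian v) (hcard : #J = #(codeSupport v)) (huv : v = dElt J * u)
      (hl : (cs n).length v = (cs n).length u + #J) (hu : IsShape u L) : IsShape v (#J :: L)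

theorem exists_isShape {v : AffSym n} (hv : IsZeroGrassmannian v) : ∃ L, IsShape v L := by
  induction hN : (cs n).length v using Nat.strong_induction_on generalizing v with
  | _ N ih =>
  subst hN
  obtain ⟨J, u, hJ, hcard, huv, hl⟩ := hv.exists_dElt_mul
  rcases Nat.eq_zero_or_pos #J with h0 | hpos
  · have : v = 1 := by
      apply eq_one_of_code_eq_zero hv
      intro j hj
      by_contra h
      rw [h0] at hcard
      have := card_eq_zero.1 hcard.symm
      exact absurd (mem_codeSupport.2 ⟨hj, Nat.pos_of_ne_zero h⟩) (by rw [this]; exact notMem_empty _)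
    exact ⟨[], this ▸ .one⟩
  · obtain ⟨L, hL⟩ := ih _ (by omega) (hv.code_dElt_mul hJ huv hl).1 rfl
    exact ⟨_, .cons J u v L hJ hpos hv hcard huv hl hL⟩

theorem IsShape.isZeroGrassmannian {v : AffSym n} {L : List ℕ} (h : IsShape v L) :
    IsZeroGrassmannian v := by
  cases h with
  | one =>
    rintro l ⟨hr, hl⟩ i hi
    have h1 := hr.eq
    rw [hl, (cs n).length_one] at h1
    rw [List.length_eq_zero_iff.1 h1.symm] at hi
    simp at hi
  | cons J u v L hJ hJ' hv => exact hv

theorem IsShape.sum_eq {v : AffSym n} {L : List ℕ} (h : IsShape v L) :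
    L.sum = (cs n).length v := by
  induction h with
  | one => simp [(cs n).length_one]
  | cons J u v L _ _ _ _ _ hl _ ih => rw [List.sum_cons, ih, hl, add_comm]

theorem IsShape.mem_bounds {v : AffSym n} {L : List ℕ} (h : IsShape v L) :
    ∀ r ∈ L, 1 ≤ r ∧ r < n := by
  induction h with
  | one => simp
  | cons J u v L hJ hJ' _ _ _ _ _ ih =>
    intro r hr
    rw [List.mem_cons] at hr
    rcases hr with rfl | hr
    · exact ⟨hJ', card_lt hJ⟩
    · exact ih r hr

theorem IsShape.le_card {v : AffSym n} {L : List ℕ} (h : IsShape v L) :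
    ∀ r ∈ L, r ≤ #(codeSupport v) := by
  induction h with
  | one => simp
  | cons J u v L hJ hJ' hv hcard huv hl _ ih =>
    intro r hr
    rw [List.mem_cons] at hr
    rcases hr with rfl | hr
    · exact hcard.le
    · refine (ih r hr).trans (card_le_card fun j hj => ?_)
      rw [mem_codeSupport] at hj ⊢
      have := ((hv.code_dElt_mul hJ huv hl).2 j hj.1).1
      exact ⟨hj.1, by omega⟩

theorem IsShape.pairwise {v : AffSym n} {L : List ℕ} (h : IsShape v L) :
    L.Pairwise (· ≥ ·) := by
  induction h with
  | one => simp
  | cons J u v L hJ hJ' hv hcard huv hl hu ih =>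
    refine List.pairwise_cons.2 ⟨fun r hr => ?_, ih⟩
    refine (hu.le_card r hr).trans ?_
    rw [hcard]
    refine card_le_card fun j hj => ?_
    rw [mem_codeSupport] at hj ⊢
    have := ((hv.code_dElt_mul hJ huv hl).2 j hj.1).1
    exact ⟨hj.1, by omega⟩

/-- Splitting off a factor of the largest possible size is unique. -/
theorem eq_of_card_eq {v u u' : AffSym n} {J J' : Finset (ZMod n)} (hv : IsZeroGrassmannian v)
    (hJ : J ≠ univ) (hJ' : J' ≠ univ) (huv : v = dElt J * u) (huv' : v = dElt J' * u')
    (hl : (cs n).length v = (cs n).length u + #J) (hl' : (cs n).length v = (cs n).length u' + #J')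
    (hc : #J = #(codeSupport v)) (hc' : #J' = #(codeSupport v)) : J = J' ∧ u = u' := by
  have h1 := eq_image_of_filter_eq (hv.filter_eq_codeSupport hJ huv hl hc)
  have h2 := eq_image_of_filter_eq (hv.filter_eq_codeSupport hJ' huv' hl' hc')
  obtain rfl : J = J' := h1.trans h2.symm
  exact ⟨rfl, mul_left_cancel (huv.symm.trans huv')⟩

/-- The code decreases weakly along the window, so its support is an initial segment. -/
theorem codeSupport_eq_of_card_eq {u v : AffSym n} (hu : IsZeroGrassmannian u)
    (hv : IsZeroGrassmannian v) (h : #(codeSupport u) = #(codeSupport v)) :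
    codeSupport u = codeSupport v := by
  have low : ∀ {v : AffSym n}, IsZeroGrassmannian v → ∀ i ∈ window n, ∀ j ∈ codeSupport v, i ≤ j →
      i ∈ codeSupport v := by
    intro v hv i hi j hj hij
    rw [mem_codeSupport] at hj ⊢
    have := code_antitone hv hi hj.1 hij
    exact ⟨hi, by omega⟩
  by_cases hs : codeSupport u ⊆ codeSupport v
  · exact eq_of_subset_of_card_le hs h.ge
  · obtain ⟨s, hsu, hsv⟩ := not_subset.1 hs
    refine (eq_of_subset_of_card_le (fun t ht => ?_) h.le).symm
    have hts : t ≤ s := by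
      by_contra hcon
      exact hsv (low hv s (mem_codeSupport.1 hsu).1 t ht (by omega))
    exact low hu t (mem_codeSupport.1 ht).1 s hsu hts

/-- A `0`-Grassmannian element is determined by its shape. -/
theorem IsShape.injective {u v : AffSym n} {L : List ℕ} (hu : IsShape u L) (hv : IsShape v L) :
    u = v := by
  induction hu generalizing v with
  | one =>
    have := hv.sum_eq
    rw [List.sum_nil] at this
    exact ((cs n).length_eq_zero_iff.1 this.symm).symm
  | cons J u u' L hJ hJ' hg hcard huv hl hu ih =>
    generalize hL : #J :: L = L₂ at hv
    cases hv with
    | one => simp at hL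
    | cons J₂ u₂ _ L₂ hJ₂ hJ₂' hg₂ hcard₂ huv₂ hl₂ hu₂ =>
      obtain ⟨hJJ, rfl⟩ := List.cons.inj hL
      obtain rfl := ih hu₂
      have f1 := hg.filter_eq_codeSupport hJ huv hl hcard
      have f2 := hg₂.filter_eq_codeSupport hJ₂ huv₂ hl₂ hcard₂
      have e1 := eq_image_of_filter_eq f1
      have e2 := eq_image_of_filter_eq f2
      have hS := codeSupport_eq_of_card_eq hg hg₂ (by rw [← hcard, ← hcard₂, hJJ])
      -- On the common support both elements take the values of the common quotient `u` lowered by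
      -- one, and these values determine the factor split off.
      have key : ∀ j ∈ codeSupport u', toPerm n u' j = toPerm n v j := by
        intro j hj
        have hj1 := mem_filter.1 (f1.symm ▸ hj)
        have hj2 := mem_filter.1 (f2.symm ▸ hS ▸ hj)
        rw [((hg.code_dElt_mul hJ huv hl).2 j hj1.1).2 hj1.2,
          ((hg₂.code_dElt_mul hJ₂ huv₂ hl₂).2 j hj1.1).2 hj2.2]
      have : J = J₂ := by
        rw [e1, e2, ← hS]
        exact image_congr fun j hj => by simp only [key j hj]
      rw [huv, huv₂, this]

theorem mem_factorizations_cons {r : ℕ} {L : List ℕ} {v : AffSym n}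
    {Js : List (Finset (ZMod n))} (h : Js ∈ factorizations (r :: L) v) :
    ∃ J Js' u, J ≠ univ ∧ #J = r ∧ Js = J :: Js' ∧ v = dElt J * u ∧
      (cs n).length v = (cs n).length u + #J ∧ Js' ∈ factorizations L u := by
  obtain ⟨h1, h2, h3⟩ := mem_factorizations.1 h
  obtain ⟨J, Js', ⟨hJ, hr⟩, hJs', rfl⟩ := mem_subsetLists_cons.1 h1
  rw [List.map_cons, List.prod_cons] at h2
  have h4 : (cs n).length (Js'.map dElt).prod ≤ L.sum := by
    rw [prod_dElt, ← length_flatMap hJs']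
    exact (cs n).length_wordProd_le _
  have h5 := (cs n).length_mul_le (dElt J) (Js'.map dElt).prod
  rw [h2, length_dElt hJ, h3, List.sum_cons] at h5
  rw [List.sum_cons] at h3
  exact ⟨J, Js', (Js'.map dElt).prod, hJ, hr, rfl, h2.symm, by omega,
    mem_factorizations.2 ⟨hJs', rfl, by omega⟩⟩

/-- Triangularity: the sizes of a factorization are lexicographically bounded by the shape. -/
theorem IsShape.le_of_mem_factorizations {v : AffSym n} {L L' : List ℕ} (hv : IsShape v L)
    {Js : List (Finset (ZMod n))} (h : Js ∈ factorizations L' v) (hL' : ∀ r ∈ L', 0 < r) :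
    L' ≤ L := by
  induction L' generalizing v L Js with
  | nil =>
    cases L with
    | nil => exact le_rfl
    | cons a L => exact le_of_lt List.Lex.nil
  | cons r L' ih =>
    obtain ⟨J, Js', u, hJ, hr, rfl, huv, hl, hJs'⟩ := mem_factorizations_cons h
    have hg := hv.isZeroGrassmannian
    have hle := hg.card_le hJ huv hl
    cases hv with
    | one =>
      rw [(cs n).length_one] at hl
      have := hL' r List.mem_cons_self
      omega
    | cons J₂ u₂ _ L₂ hJ₂ hJ₂' hg₂ hcard₂ huv₂ hl₂ hu₂ =>
      rcases hle.lt_or_eq with hlt | heq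
      · exact le_of_lt (List.Lex.rel (by omega))
      · obtain ⟨rfl, rfl⟩ := eq_of_card_eq hg hJ hJ₂ huv huv₂ hl hl₂ heq hcard₂
        subst hr
        rcases (ih hu₂ hJs' fun r hr => hL' r (List.mem_cons_of_mem _ hr)).lt_or_eq with h' | h'
        · exact le_of_lt (List.Lex.cons h')
        · rw [h']

/-- Every greedy factor is unique. These are the diagonal entries of the triangular matrix that
`exists_isKSchur` inverts. -/
theorem IsShape.card_factorizations {v : AffSym n} {L : List ℕ} (hv : IsShape v L) :
    #(factorizations L v) = 1 := by
  rw [card_eq_one]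
  induction hv with
  | one =>
    refine ⟨[], ?_⟩
    ext Js
    rw [mem_factorizations, mem_singleton]
    simp only [subsetLists, mem_singleton]
    exact ⟨fun h => h.1, fun h => by subst h; simp [(cs n).length_one]⟩
  | cons J u v L hJ hJ' hg hcard huv hl hu ih =>
    obtain ⟨Js, hJs⟩ := ih
    refine ⟨J :: Js, ?_⟩
    have hmem : Js ∈ factorizations L u := by rw [hJs]; exact mem_singleton_self _
    ext Js'
    rw [mem_singleton]
    constructor
    · intro h
      obtain ⟨J', Js'', u', hJ', hr, rfl, huv', hl', hJs''⟩ := mem_factorizations_cons h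
      obtain ⟨rfl, rfl⟩ := eq_of_card_eq hg hJ hJ' huv huv' hl hl' hcard (by rw [hr, hcard])
      rw [hJs, mem_singleton] at hJs''
      rw [hJs'']
    · rintro rfl
      obtain ⟨h1, h2, h3⟩ := mem_factorizations.1 hmem
      refine mem_factorizations.2 ⟨mem_subsetLists_cons.2 ⟨J, Js, ⟨hJ, rfl⟩, h1, rfl⟩, ?_, ?_⟩
      · rw [List.map_cons, List.prod_cons, h2, huv]
      · rw [hl, h3, List.sum_cons, add_comm]

/-- Every weakly decreasing list of positive numbers less than `n` comes from a monomial. -/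
theorem exists_partsOf_eq {L : List ℕ} (h : ∀ r ∈ L, 1 ≤ r ∧ r < n) (hL : L.Pairwise (· ≥ ·)) :
    ∃ e : Fin (n - 1) →₀ ℕ, partsOf e = L := by
  refine ⟨Finsupp.equivFunOnFinite.symm fun i => L.count (i.val + 1), ?_⟩
  apply List.Perm.eq_of_pairwise (le := (· ≥ ·)) (fun a b _ _ h1 h2 => le_antisymm h2 h1) _ hL
  · rw [List.perm_iff_count]
    intro a
    rw [partsOf, List.count_flatMap]
    simp only [Function.comp_def, List.count_replicate, Finsupp.equivFunOnFinite_symm_apply_apply]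
    rw [List.map_reverse, List.sum_reverse, ← List.ofFn_eq_map, List.sum_ofFn]
    by_cases ha : a ∈ L
    · obtain ⟨h1, h2⟩ := h a ha
      rw [Finset.sum_eq_single ⟨a - 1, by omega⟩]
      · have : a - 1 + 1 = a := by omega
        simp [this]
      · rintro ⟨b, hb⟩ _ hne
        have : b + 1 ≠ a := fun e => hne (Fin.ext (by simp only; omega))
        simp [this]
      · simp
    · rw [List.count_eq_zero_of_not_mem ha]
      refine Finset.sum_eq_zero fun i _ => ?_
      split_ifs with hi
      · rw [beq_iff_eq] at hi
        rw [hi, List.count_eq_zero_of_not_mem ha]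
      · rfl
  · rw [partsOf, List.pairwise_flatMap]
    refine ⟨fun i _ => List.pairwise_replicate.2 (Or.inr le_rfl), ?_⟩
    rw [List.pairwise_reverse]
    refine (List.pairwise_lt_finRange _).imp fun {i j} hij x hx y hy => ?_
    rw [List.eq_of_mem_replicate hx, List.eq_of_mem_replicate hy]
    have : i.val < j.val := hij
    omega

theorem hallPairing_eq_sum {f : SymmH n} {S : Finset (Fin (n - 1) →₀ ℕ)} (h : f.support ⊆ S)
    (F : MvPowerSeries ℕ ℤ) :
    hallPairing f F = ∑ e ∈ S, f.coeff e * MvPowerSeries.coeff (partsOf e).toFinsupp F :=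
  sum_subset h fun e _ he => by rw [MvPolynomial.notMem_support_iff.1 he, zero_mul]

/-- The Hall pairing with a fixed symmetric function as a linear map. -/
def hallPairingHom (F : MvPowerSeries ℕ ℤ) : SymmH n →+ ℤ where
  toFun f := hallPairing f F
  map_zero' := by simp [hallPairing]
  map_add' f g := by
    classical
    have h1 := MvPolynomial.support_add (p := f) (q := g)
    rw [hallPairing_eq_sum h1, hallPairing_eq_sum (f := f) subset_union_left,
      hallPairing_eq_sum (f := g) subset_union_right, ← sum_add_distrib]
    exact sum_congr rfl fun e _ => by rw [MvPolynomial.coeff_add, add_mul]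

theorem hallPairingHom_monomial (e : Fin (n - 1) →₀ ℕ) (v : AffSym n) :
    hallPairingHom (affineStanley v) (MvPolynomial.monomial e 1) =
      #(factorizations (partsOf e) v) := by
  classical
  change hallPairing _ _ = _
  rw [hallPairing_eq_sum (S := {e}) MvPolynomial.support_monomial_subset, sum_singleton,
    MvPolynomial.coeff_monomial, if_pos rfl, one_mul, affineStanley_toFinsupp (partsOf_pos e)]

theorem finite_length_eq (N : ℕ) : {v : AffSym n | (cs n).length v = N}.Finite := by
  refine ((List.finite_length_eq (ZMod n) N).image (cs n).wordProd).subset ?_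
  rintro v hv
  obtain ⟨l, hl, rfl⟩ := (cs n).exists_isReduced v
  exact ⟨l, hl.eq.symm.trans hv, rfl⟩

/-- The `k`-Schur functions exist. -/
theorem exists_isKSchur {u : AffSym n} (hu : IsZeroGrassmannian u) : ∃ f, IsKSchur u f := by
  classical
  choose! shape hshape using fun (v : AffSym n) (hv : IsZeroGrassmannian v) => exists_isShape hv
  set N := (cs n).length u with hN
  have hfin : {v : AffSym n | IsZeroGrassmannian v ∧ (cs n).length v = N}.Finite :=
    (finite_length_eq N).subset fun v hv => hv.2
  set G := hfin.toFinset with hG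
  have hmemG : ∀ v, v ∈ G ↔ IsZeroGrassmannian v ∧ (cs n).length v = N := fun v => by
    rw [hG, Set.Finite.mem_toFinset]; rfl
  clear_value N
  have huG : u ∈ G := (hmemG u).2 ⟨hu, hN.symm⟩
  clear hu hN
  -- A unitriangular system is solved from the largest shape downwards: `h_λ` with `λ = shape u` is
  -- corrected by the functions already found for the larger shapes of the same length.
  induction hk : #(G.filter fun v => shape u < shape v) using Nat.strong_induction_on
    generalizing u with
  | _ k ih =>
  subst hk
  have hex : ∀ v ∈ G.filter fun v => shape u < shape v, ∃ f, IsKSchur v f := by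
    intro v hv
    rw [mem_filter] at hv
    refine ih _ (card_lt_card ?_) hv.1 rfl
    rw [ssubset_iff_of_subset]
    · exact ⟨v, mem_filter.2 hv, fun h => lt_irrefl _ (mem_filter.1 h).2⟩
    · intro x hx
      rw [mem_filter] at hx ⊢
      exact ⟨hx.1, hv.2.trans hx.2⟩
  choose! g hg using hex
  have hu := (hmemG u).1 huG
  have hsu := hshape u hu.1
  obtain ⟨e, he⟩ := exists_partsOf_eq hsu.mem_bounds hsu.pairwise
  refine ⟨MvPolynomial.monomial e 1 - ∑ v ∈ G.filter (fun v => shape u < shape v),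
    (#(factorizations (shape u) v) : ℤ) • g v, fun v hv => ?_⟩
  have hval : hallPairing (MvPolynomial.monomial e 1 - ∑ v ∈ G.filter (fun v => shape u < shape v),
      (#(factorizations (shape u) v) : ℤ) • g v) (affineStanley v) =
      #(factorizations (shape u) v) - ∑ x ∈ G.filter (fun v => shape u < shape v),
        (#(factorizations (shape u) x) : ℤ) * if v = x then 1 else 0 := by
    change hallPairingHom _ _ = _
    rw [map_sub, map_sum, hallPairingHom_monomial, he]
    congr 1
    refine sum_congr rfl fun x hx => ?_
    rw [map_zsmul, smul_eq_mul]
    congr 1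
    split_ifs with h
    · exact (hg x hx v hv).1 h
    · exact (hg x hx v hv).2 h
  rw [hval]
  simp only [mul_ite, mul_one, mul_zero, sum_ite_eq, mem_filter]
  constructor
  · rintro rfl
    rw [if_neg fun h => lt_irrefl _ h.2, sub_zero, hsu.card_factorizations]
    rfl
  · intro hvu
    split_ifs with h
    · exact sub_self _
    · rw [sub_zero]
      -- A nonzero entry forces `shape u ≤ shape v` by triangularity. Since strict inequality is
      -- excluded, the shapes agree, and then so do the elements.
      by_contra hne
      have hne' : (factorizations (shape u) v).Nonempty := by
        rw [nonempty_iff_ne_empty]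
        intro h0
        exact hne (by rw [h0]; rfl)
      obtain ⟨Js, hJs⟩ := hne'
      have hle := (hshape v hv).le_of_mem_factorizations hJs
        fun r hr => (hsu.mem_bounds r hr).1
      have hlen := (mem_factorizations.1 hJs).2.2
      rw [hsu.sum_eq, hu.2] at hlen
      have hvG : v ∈ G := (hmemG v).2 ⟨hv, hlen⟩
      have : shape u = shape v := le_antisymm hle (not_lt.1 fun hlt => h ⟨hvG, hlt⟩)
      exact hvu (IsShape.injective (hshape v hv) (this ▸ hsu))

end Shape

/-! ## Translations and reachability -/

namespace Config

section Shift

variable {m n : ℕ}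

/-- Relabelling the particles by a translation. -/
def shift (k : ℤ) (f : Config m n) : Config m n where
  toFun p := f (p + k)
  mono p q h := f.mono (by omega)
  add p := by rw [add_right_comm, f.add]

theorem shift_apply (k : ℤ) (f : Config m n) (p : ℤ) : shift k f p = f (p + k) := rfl

theorem shift_zero (f : Config m n) : shift 0 f = f := by
  ext p
  rw [shift_apply, add_zero]

theorem shift_shift (j k : ℤ) (f : Config m n) : shift j (shift k f) = shift (j + k) f := by
  ext p
  rw [shift_apply, shift_apply, shift_apply, add_assoc]

theorem occ_shift {k : ℤ} {f : Config m n} {i : ZMod n} : Occ (shift k f) i ↔ Occ f i :=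
  ⟨fun ⟨p, hp⟩ => ⟨p + k, hp⟩, fun ⟨p, hp⟩ => ⟨p - k, by rwa [shift_apply, sub_add_cancel]⟩⟩

variable [Fact (1 < n)]

theorem Step.shift {i : ZMod n} {f g : Config m n} (h : Step i f g) (k : ℤ) :
    Step i (shift k f) (shift k g) :=
  ⟨occ_shift.2 h.1, fun h' => h.2.1 (occ_shift.1 h'), fun p => h.2.2 (p + k)⟩

theorem Path.shift {l : List (ZMod n)} {f g : Config m n} (h : Path l f g) (k : ℤ) :
    Path l (Config.shift k f) (Config.shift k g) := by
  induction l generalizing g with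
  | nil => rw [path_nil.1 h]; rfl
  | cons i t ih =>
    obtain ⟨x, hx, hs⟩ := h
    exact ⟨Config.shift k x, ih hx, Step.shift hs k⟩

theorem Path.of_shift {l : List (ZMod n)} {f g : Config m n} {k : ℤ} (h : Path l (Config.shift k f) g) :
    Path l f (Config.shift (-k) g) := by
  have := h.shift (-k)
  rwa [shift_shift, neg_add_cancel, shift_zero] at this

/-- Moves depend on places only, not on labels; the claim is checked on words, which span. -/
theorem action_single_shift [NeZero m] (a : NilCoxeter n) (k : ℤ) (f : Config m n) :
    action m n a (Finsupp.single (Config.shift k f) 1) =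
      Finsupp.lmapDomain ℤ ℤ (Config.shift k) (action m n a (Finsupp.single f 1)) := by
  refine Submodule.span_induction (p := fun a _ => action m n a (Finsupp.single (Config.shift k f) 1) =
      Finsupp.lmapDomain ℤ ℤ (Config.shift k) (action m n a (Finsupp.single f 1))) ?_ ?_ ?_ ?_
      (mem_span_nilWord a)
  · rintro _ ⟨l, rfl⟩
    by_cases h : ∃ g, Path l f g
    · obtain ⟨g, hg⟩ := h
      rw [action_nilWord_single hg, action_nilWord_single (hg.shift k), Finsupp.lmapDomain_apply,
        Finsupp.mapDomain_single]
    · rw [action_nilWord_single_eq_zero h, action_nilWord_single_eq_zero, map_zero]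
      exact fun ⟨g, hg⟩ => h ⟨_, hg.of_shift⟩
  · simp
  · intro x y _ _ hx hy
    rw [map_add, LinearMap.add_apply, hx, hy, LinearMap.add_apply, map_add]
  · intro c x _ hx
    have e : action m n (c • x) = c • action m n x := map_zsmul _ c x
    rw [e]
    change c • action m n x _ = Finsupp.lmapDomain ℤ ℤ (Config.shift k) (c • action m n x _)
    rw [hx, map_zsmul]

/-- If every particle that lags behind were blocked, the one blocking it would lag as well. Going
once around, `f (p + m) = f p + m`, which is impossible as `m < n`. -/
theorem exists_lt_add_one_lt (hmn : m < n) {f g : Config m n} (hfg : ∀ p, f p ≤ g p)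
    (hne : f ≠ g) : ∃ p, f p < g p ∧ f p + 1 < f (p + 1) := by
  by_contra! hcon
  obtain ⟨p, hp⟩ : ∃ p, f p < g p := by
    by_contra! h
    exact hne (ext' fun p => le_antisymm (hfg p) (h p))
  have key : ∀ j : ℕ, f (p + j) = f p + j ∧ f (p + j) < g (p + j) := by
    intro j
    induction j with
    | zero => simpa using hp
    | succ j ih =>
      obtain ⟨h1, h2⟩ := ih
      have h3 := hcon _ h2
      have h4 := f.mono (lt_add_one (p + (j : ℤ)))
      have h5 := g.mono (lt_add_one (p + (j : ℤ)))
      push_cast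
      rw [← add_assoc]
      omega
  have := (key m).1
  rw [f.add] at this
  omega

theorem exists_path_of_le [NeZero m] (hmn : m < n) {f g : Config m n} (hfg : ∀ p, f p ≤ g p) :
    ∃ l, Path l f g := by
  have hw : ∀ {f : Config m n}, (∀ p, f p ≤ g p) → AffineNil.weight m f ≤ AffineNil.weight m g :=
    fun h => sum_le_sum fun p _ => h p
  induction hN : (AffineNil.weight m g - AffineNil.weight m f).toNat generalizing f with
  | zero =>
    refine ⟨[], path_nil.2 (by_contra fun hne => ?_)⟩
    obtain ⟨p, hp, -⟩ := exists_lt_add_one_lt hmn hfg (Ne.symm hne)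
    have hm : (0 : ℤ) < m := by exact_mod_cast Nat.pos_of_ne_zero (NeZero.ne m)
    have e := Int.emod_add_mul_ediv p m
    have h0 := Int.emod_nonneg p hm.ne'
    have h1 := Int.emod_lt_of_pos p hm
    rw [← e, f.isPeriodicMap.add_mul, g.isPeriodicMap.add_mul] at hp
    have : AffineNil.weight m f < AffineNil.weight m g :=
      sum_lt_sum (fun p _ => hfg p) ⟨(p % m).toNat, mem_range.2 (by omega), by
        rw [Int.toNat_of_nonneg h0]; omega⟩
    omega
  | succ N ih =>
    have hne : f ≠ g := by
      rintro rfl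
      omega
    obtain ⟨p, hp, hp'⟩ := exists_lt_add_one_lt hmn hfg hne
    have hfree : ¬ Occ f ((f p : ZMod n) + 1) := by
      rintro ⟨q, hq⟩
      have hq' : ((f p + 1 : ℤ) : ZMod n) = f q := by push_cast; exact hq.symm
      rw [ZMod.intCast_eq_intCast_iff_dvd_sub] at hq'
      obtain ⟨c, hc⟩ := hq'
      have h1 : f (q + m * (-c)) = f p + 1 := by rw [f.isPeriodicMap.add_mul]; linarith
      have h2 := f.mono.lt_iff_lt.1 (show f p < f (q + m * (-c)) by omega)
      have h3 := f.mono.lt_iff_lt.1 (show f (q + m * (-c)) < f (p + 1) by omega)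
      omega
    obtain ⟨h, hs⟩ := exists_step ⟨p, rfl⟩ hfree
    have hle : ∀ q, h q ≤ g q := by
      intro q
      by_cases hq : (f q : ZMod n) = f p
      · obtain ⟨c, rfl⟩ := f.isPeriodicMap.exists_of_cast_eq hq.symm
        rw [hs.apply_of_eq hq, f.isPeriodicMap.add_mul, g.isPeriodicMap.add_mul]
        omega
      · rw [hs.apply_of_ne hq]
        exact hfg q
    obtain ⟨l, hl⟩ := ih hle (by
      have := hs.weight
      have := hw hle
      omega)
    exact ⟨l ++ [(f p : ZMod n)], path_append.2 ⟨h, ⟨f, rfl, hs⟩, hl⟩⟩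

theorem exists_path_shift_vacuum [NeZero m] (hmn : m < n) (f : Config m n) :
    ∃ k l g, Path l (vacuum hmn.le) g ∧ f = Config.shift k g := by
  have hm : (0 : ℤ) < m := by exact_mod_cast Nat.pos_of_ne_zero (NeZero.ne m)
  have hn : (0 : ℤ) < n := by omega
  -- Moving down by `n * K` takes care of `f 0`, and the summand `1` covers the period lost in
  -- rounding `p` to multiples of `m`.
  set K : ℤ := 1 + |f 0|
  have hle : ∀ p, Config.shift (-(m * K)) (vacuum hmn.le) p ≤ f p := by
    intro p
    have h0 : f (m * (p / m)) = f 0 + n * (p / m) := by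
      have := f.isPeriodicMap.add_mul 0 (p / m)
      rwa [zero_add] at this
    have h1 : f (m * (p / m)) ≤ f p := f.mono.monotone (Int.mul_ediv_self_le hm.ne')
    have h2 : vacuum hmn.le p ≤ vacuum hmn.le (m * (p / m + 1)) := by
      refine (vacuum hmn.le).mono.monotone ?_
      have := Int.lt_ediv_add_one_mul_self p hm
      linarith [mul_comm (p / (m : ℤ) + 1) m]
    rw [vacuum_mul] at h2
    have h3 : Config.shift (-(m * K)) (vacuum hmn.le) p = vacuum hmn.le p - n * K := by
      rw [shift_apply, ← mul_neg, (vacuum hmn.le).isPeriodicMap.add_mul]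
      ring
    have h4 := neg_abs_le (f 0)
    have h5 : |f 0| ≤ n * |f 0| := le_mul_of_one_le_left (abs_nonneg _) (by omega)
    have h6 : (n : ℤ) * K = n + n * |f 0| := by ring
    rw [h3]
    linarith
  obtain ⟨l, hl⟩ := exists_path_of_le hmn hle
  refine ⟨-(m * K), l, _, hl.of_shift, ?_⟩
  rw [shift_shift, add_neg_cancel, shift_zero]

end Shift

end Config

/-! ## The ribbon as a translation -/

section Ribbon

variable {m n : ℕ} [Fact (1 < n)]

open Config

theorem intCast_ne_of_lt {x y : ℤ} (h : x < y) (h' : y < x + n) : (x : ZMod n) ≠ y := by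
  rw [Ne, ZMod.intCast_eq_intCast_iff_dvd_sub]
  intro hd
  have := Int.le_of_dvd (by omega) hd
  omega

/-- The word `-j, …, -1`. -/
def negWord (n j : ℕ) : List (ZMod n) := (List.range j).map fun k : ℕ => -(j : ZMod n) + (k : ZMod n)

/-- The word `j - 1, …, 1, 0`. -/
def posWord (n j : ℕ) : List (ZMod n) := ((List.range j).map fun k : ℕ => (k : ZMod n)).reverse

theorem negWord_succ (j : ℕ) : negWord n (j + 1) = ((-(j + 1 : ℤ) : ℤ) : ZMod n) :: negWord n j := by
  rw [negWord, negWord, List.range_succ_eq_map, List.map_cons, List.map_map]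
  congr 1
  · push_cast; ring
  · refine List.map_congr_left fun k _ => ?_
    simp only [Function.comp_apply, Nat.succ_eq_add_one]
    push_cast; ring

theorem posWord_succ (j : ℕ) : posWord n (j + 1) = ((j : ℤ) : ZMod n) :: posWord n j := by
  rw [posWord, posWord, List.range_succ, List.map_append, List.reverse_append]
  simp

theorem toPerm_wordProd_cons (i : ZMod n) (l : List (ZMod n)) (x : ℤ) :
    toPerm n ((cs n).wordProd (i :: l)) x = reflFun i (toPerm n ((cs n).wordProd l) x) := by
  rw [(cs n).wordProd_cons, map_mul, Equiv.Perm.mul_apply, toPerm_simple_apply]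

theorem toPerm_negWord {j : ℕ} (hj : j < n) {x : ℤ} (hx : -(n : ℤ) < x) (hx' : x < 0) :
    toPerm n ((cs n).wordProd (negWord n j)) x = if -x ≤ j then x + 1 else x := by
  induction j with
  | zero => rw [if_neg (by push_cast; omega)]; simp [negWord, (cs n).wordProd_nil]
  | succ j ih =>
    rw [negWord_succ, toPerm_wordProd_cons, ih (by omega)]
    have e : (((-(j + 1 : ℤ) : ℤ) : ZMod n) + 1) = ((-j : ℤ) : ZMod n) := by push_cast; ring
    rcases lt_trichotomy (-x) (j + 1) with h | h | h
    · rw [if_pos (by omega), if_pos (by push_cast; omega), reflFun_of_ne]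
      · exact (intCast_ne_of_lt (by omega) (by omega)).symm
      · rw [e]
        exact (intCast_ne_of_lt (by omega) (by omega)).symm
    · rw [if_neg (by omega), if_pos (by push_cast; omega), reflFun_of_eq]
      rw [← h, neg_neg]
    · rw [if_neg (by omega), if_neg (by push_cast; omega), reflFun_of_ne]
      · exact intCast_ne_of_lt (by omega) (by omega)
      · rw [e]
        exact intCast_ne_of_lt (by omega) (by omega)

theorem toPerm_posWord_zero {j : ℕ} : toPerm n ((cs n).wordProd (posWord n j)) 0 = j := by
  induction j with
  | zero => simp [posWord, (cs n).wordProd_nil]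
  | succ j ih => rw [posWord_succ, toPerm_wordProd_cons, ih, reflFun_of_eq rfl]; push_cast; rfl

theorem toPerm_posWord {j : ℕ} {x : ℤ} (hx : (j : ℤ) < x + n) (hx' : x < 0) :
    toPerm n ((cs n).wordProd (posWord n j)) x = x := by
  induction j with
  | zero => simp [posWord, (cs n).wordProd_nil]
  | succ j ih =>
    rw [posWord_succ, toPerm_wordProd_cons, ih (by omega), reflFun_of_ne]
    · exact intCast_ne_of_lt (by omega) (by omega)
    · have := intCast_ne_of_lt (n := n) (x := x) (y := j + 1) (by omega) (by omega)
      simpa using this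

variable [NeZero m]

theorem exists_eq_mul_sub (m : ℕ) [NeZero m] (p : ℤ) : ∃ k i : ℤ, 0 ≤ i ∧ i < m ∧ p = -i + m * k := by
  have hm : (0 : ℤ) < m := by exact_mod_cast Nat.pos_of_ne_zero (NeZero.ne m)
  exact ⟨-(-p / m), -p % m, Int.emod_nonneg _ hm.ne', Int.emod_lt_of_pos _ hm, by
    have := Int.emod_add_mul_ediv (-p) m
    linarith [mul_neg (m : ℤ) (-p / m)]⟩

theorem vacuum_neg (hmn : m ≤ n) {i : ℤ} (hi : 0 ≤ i) (hi' : i < m) :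
    vacuum (m := m) hmn (-i) = -i := by
  rw [vacuum_apply, Int.ediv_eq_zero_of_lt (by omega) (by omega), mul_zero, add_zero]

/-- The right factor carries the particle at `0` to `n - m`, congruent to `-m` and so just behind
the next block; the left factor then pushes the classes `-m, …, -1` up by one. The vacuum is
restored, each particle taking the place of its successor. -/
theorem toPerm_ribbon_vacuum (hmn : m < n) (p : ℤ) :
    toPerm n (ribbon m n) (vacuum (m := m) hmn.le p) = vacuum (m := m) hmn.le (p + 1) := by
  have hr : ribbon m n = (cs n).wordProd (negWord n m) * (cs n).wordProd (posWord n (n - m)) :=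
    (cs n).wordProd_append _ _
  obtain ⟨k, i, hi, hi', rfl⟩ := exists_eq_mul_sub m p
  rw [(vacuum hmn.le).isPeriodicMap.add_mul, toPerm_add_mul, vacuum_neg hmn.le hi hi', hr, map_mul,
    Equiv.Perm.mul_apply, add_right_comm, (vacuum hmn.le).isPeriodicMap.add_mul]
  congr 1
  rcases hi.eq_or_lt with rfl | hpos
  · have h1 : ((n - m : ℕ) : ℤ) = -m + n * 1 := by push_cast [hmn.le]; ring
    have hm : (0 : ℤ) < m := hi'
    rw [neg_zero, toPerm_posWord_zero, h1, toPerm_add_mul, toPerm_negWord hmn (by omega) (by omega),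
      if_pos (by omega), show (0 : ℤ) + 1 = -(m - 1) + m * 1 by ring,
      (vacuum hmn.le).isPeriodicMap.add_mul, vacuum_neg hmn.le (by omega) (by omega)]
    ring
  · rw [toPerm_posWord (by omega) (by omega), toPerm_negWord hmn (by omega) (by omega),
      if_pos (by omega), show -i + 1 = -(i - 1) by ring, vacuum_neg hmn.le (by omega) (by omega)]

theorem weight_shift (f : Config m n) : weight m (shift 1 f) = weight m f + n := by
  have h := sum_range_succ (fun p : ℕ => f p) m
  have h' := sum_range_succ' (fun p : ℕ => f p) m
  have h0 := f.add 0
  rw [zero_add] at h0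
  simp only [weight, shift_apply]
  push_cast at h h'
  linarith

theorem ribbon_path (hmn : m < n) :
    Path (negWord n m ++ posWord n (n - m)) (vacuum (m := m) hmn.le) (shift 1 (vacuum hmn.le)) := by
  have h0 : (fun p => toPerm n ((cs n).wordProd (negWord n m ++ posWord n (n - m)))
      (vacuum (m := m) hmn.le p)) = shift 1 (vacuum (m := m) hmn.le) :=
    funext fun p => toPerm_ribbon_vacuum hmn p
  -- The shift adds `n` to the weight, which is the length of the word, so every letter is a legal
  -- move.
  obtain ⟨g, hg⟩ := (weight_toPerm_le (vacuum (m := m) hmn.le)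
    (negWord n m ++ posWord n (n - m))).2 (by
      rw [h0, weight_shift]
      simp [negWord, posWord]
      omega)
  have : g = shift 1 (vacuum hmn.le) := ext' fun p => (hg.apply p).trans (congrFun h0 p)
  rwa [← this]

theorem ribbon_path_pow (hmn : m < n) (d : ℕ) :
    Path (List.replicate d (negWord n m ++ posWord n (n - m))).flatten (vacuum (m := m) hmn.le)
      (shift d (vacuum hmn.le)) := by
  induction d with
  | zero => exact shift_zero _
  | succ d ih =>
    rw [List.replicate_succ, List.flatten_cons]
    refine path_append.2 ⟨_, ih, ?_⟩
    have := (ribbon_path hmn).shift d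
    rw [shift_shift] at this
    exact_mod_cast this

theorem wordProd_flatten_replicate (d : ℕ) (l : List (ZMod n)) :
    (cs n).wordProd (List.replicate d l).flatten = (cs n).wordProd l ^ d := by
  induction d with
  | zero => simp [(cs n).wordProd_nil]
  | succ d ih => rw [List.replicate_succ, List.flatten_cons, (cs n).wordProd_append, ih, pow_succ']

end Ribbon

/-! ## The factorization -/

section Main

variable {m n : ℕ} [Fact (1 < n)] [NeZero n]

open Config

/-- If `u` is not `0`-Grassmannian the condition only asks for vanishing pairings, and the zero
polynomial satisfies it. -/
theorem isKSchur_kSchur (u : AffSym n) : IsKSchur u (kSchur u) := by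
  apply Classical.epsilon_spec (p := IsKSchur u)
  by_cases hu : IsZeroGrassmannian u
  · exact exists_isKSchur hu
  · exact ⟨0, fun v hv => ⟨fun e => absurd (e ▸ hv) hu, fun _ => by simp [hallPairing]⟩⟩

/-- Beyond `n - m` every summand is zero in the quotient. -/
theorem proj_hElt_mem {r : ℕ} (hr : 0 < r) : proj m n (hElt r) ∈ BAlg m n := by
  rcases le_or_gt r (n - m) with h | h
  · exact Algebra.subset_adjoin ⟨r, hr, h, rfl⟩
  · rw [hElt, map_sum]
    refine sum_mem fun J hJ => ?_
    obtain ⟨-, hJ', rfl⟩ := mem_filter.1 hJ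
    rw [proj_eq_zero_of_rel (.dec J hJ' h)]
    exact zero_mem _

theorem proj_toNil_mem (f : SymmH n) : proj m n (toNil f) ∈ BAlg m n := by
  rw [toNil, map_sum]
  refine sum_mem fun e _ => ?_
  have h : proj m n (f.coeff e • ((partsOf e).map hElt).prod) =
      f.coeff e • proj m n ((partsOf e).map hElt).prod := map_smul (proj m n) _ _
  rw [h, map_list_prod, List.map_map]
  refine (BAlg m n).smul_mem (list_prod_mem fun x hx => ?_) _
  obtain ⟨r, hr, rfl⟩ := List.mem_map.1 hx
  exact proj_hElt_mem (partsOf_pos e r hr)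

theorem sMN_mem (u : AffSym n) : sMN m n u ∈ BAlg m n := proj_toNil_mem _

variable [NeZero m]

/-- An element of the affine Fomin–Stanley algebra that annihilates the vacuum vanishes in the
quotient. -/
theorem proj_eq_zero_of_action_vacuum (hmn : m < n) {a : NilCoxeter n} (ha : a ∈ fominStanley n)
    (h : action m n a (Finsupp.single (vacuum hmn.le) 1) = 0) : proj m n a = 0 := by
  refine proj_eq_zero_of_action_eq_zero hmn.le (end_ext fun x => ?_)
  obtain ⟨k, l, g, hl, rfl⟩ := exists_path_shift_vacuum hmn x
  -- The configuration `g` is created from the vacuum by a `k`-Schur element, past which `a`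
  -- commutes until it meets the vacuum.
  rw [action_single_shift, ← (isKSchur_kSchur ((cs n).wordProd l)).action_single hl,
    ← Module.End.mul_apply (action m n a), (action_comm ha (toNil_mem_fominStanley _)).eq,
    Module.End.mul_apply, h,
    map_zero, map_zero, LinearMap.zero_apply]

theorem action_ribbon_pow (hmn : m < n) (d : ℕ) :
    action m n (ncKSchur (ribbon m n) ^ d) (Finsupp.single (vacuum hmn.le) 1) =
      Finsupp.single (shift d (vacuum hmn.le)) 1 := by
  induction d with
  | zero => rw [pow_zero, map_one, Module.End.one_apply, Nat.cast_zero, shift_zero]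
  | succ d ih =>
    have h : action m n (ncKSchur (ribbon m n)) (Finsupp.single (vacuum hmn.le) 1) =
      Finsupp.single (shift 1 (vacuum hmn.le)) 1 :=
      (isKSchur_kSchur (ribbon m n)).action_single (ribbon_path hmn)
    rw [pow_succ', map_mul, Module.End.mul_apply, ih, action_single_shift, h,
      Finsupp.lmapDomain_apply, Finsupp.mapDomain_single, shift_shift, Nat.cast_succ]

theorem action_ncKSchur_eq (hmn : m < n) {w w₀ : AffSym n} {d : ℕ} (hw : w = w₀ * ribbon m n ^ d)
    (hl : (cs n).length w = (cs n).length w₀ + n * d) :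
    action m n (ncKSchur w) (Finsupp.single (vacuum hmn.le) 1) =
      action m n (ncKSchur w₀ * ncKSchur (ribbon m n) ^ d) (Finsupp.single (vacuum hmn.le) 1) := by
  rw [map_mul, Module.End.mul_apply, action_ribbon_pow hmn, action_single_shift]
  have hrib : ∀ l : List (ZMod n), (cs n).wordProd
      (l ++ (List.replicate d (negWord n m ++ posWord n (n - m))).flatten) =
        (cs n).wordProd l * ribbon m n ^ d := fun l => by
    rw [(cs n).wordProd_append, wordProd_flatten_replicate]; rfl
  by_cases h : ∃ l g, (cs n).wordProd l = w₀ ∧ Path l (vacuum (m := m) hmn.le) g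
  · obtain ⟨l, g, rfl, hg⟩ := h
    have h1 : Path (l ++ (List.replicate d (negWord n m ++ posWord n (n - m))).flatten)
        (vacuum (m := m) hmn.le) (shift d g) :=
      path_append.2 ⟨_, ribbon_path_pow hmn d, hg.shift d⟩
    rw [ncKSchur, ncKSchur, (isKSchur_kSchur _).action_single hg, Finsupp.lmapDomain_apply,
      Finsupp.mapDomain_single, hw, ← hrib, (isKSchur_kSchur _).action_single h1]
  · push Not at h
    rw [ncKSchur, ncKSchur, (isKSchur_kSchur w₀).action_single_eq_zero h, map_zero]
    -- If `w` could be executed on the vacuum, so could its word of the same length that starts with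
    -- `d` ribbons. After them the vacuum is only relabelled, so `w₀` could be executed on the
    -- vacuum too.
    refine (isKSchur_kSchur w).action_single_eq_zero fun l g hlw hg => ?_
    obtain ⟨l₀, hr, rfl⟩ := (cs n).exists_isReduced w₀
    have hlen : (l₀ ++ (List.replicate d (negWord n m ++ posWord n (n - m))).flatten).length =
        l.length := by
      have h3 := hg.isReduced.eq
      have h4 : m + (n - m) = n := by omega
      rw [hlw, hl, hr.eq] at h3
      rw [← h3]
      simp [negWord, posWord, h4, mul_comm]
    have hp := hg.of_wordProd_eq (by rw [hrib, hlw, hw]) hlen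
    obtain ⟨x, hx, hx'⟩ := path_append.1 hp
    rw [hx.right_unique (ribbon_path_pow hmn d)] at hx'
    exact h l₀ _ rfl hx'.of_shift

theorem sMN_eq_mul_pow (hmn : m < n) {w w₀ : AffSym n} {d : ℕ} (hw : w = w₀ * ribbon m n ^ d)
    (hl : (cs n).length w = (cs n).length w₀ + n * d) :
    sMN m n w = sMN m n w₀ * sMN m n (ribbon m n) ^ d := by
  have hmem : ∀ u : AffSym n, ncKSchur u ∈ fominStanley n := fun u => toNil_mem_fominStanley _
  have h := proj_eq_zero_of_action_vacuum hmn
    (sub_mem (hmem w) (mul_mem (hmem w₀) (pow_mem (hmem (ribbon m n)) d)))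
    (by rw [map_sub, LinearMap.sub_apply, action_ncKSchur_eq hmn hw hl, sub_self])
  rw [map_sub, map_mul, map_pow, sub_eq_zero] at h
  exact h

end Main

end AffineNil

theorem proposition4p12 (m n : ℕ) [NeZero n] (hm : 0 < m) (hmn : m < n)
    (w w₀ : AffineNil.AffSym n) (d : ℕ)
    (hw : w ∈ AffineNil.ASetZero m n)
    (hdec : AffineNil.IsRibbonDecomposition m n w w₀ (AffineNil.ribbon m n) d) :
    AffineNil.sMN m n w ∈ AffineNil.BAlg m n ∧
    AffineNil.sMN m n w₀ ∈ AffineNil.BAlg m n ∧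
    AffineNil.sMN m n (AffineNil.ribbon m n) ∈ AffineNil.BAlg m n ∧
    AffineNil.sMN m n w = AffineNil.sMN m n w₀ * AffineNil.sMN m n (AffineNil.ribbon m n) ^ d := by
  have : Fact (1 < n) := ⟨by omega⟩
  have : NeZero m := ⟨hm.ne'⟩
  exact ⟨AffineNil.sMN_mem w, AffineNil.sMN_mem w₀, AffineNil.sMN_mem _,
    AffineNil.sMN_eq_mul_pow hmn hdec.eq hdec.length_eq⟩

end
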